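/- **Setting.** Let $n\ge 2$, $m\ge 0$, $a<b$, and let $N:S^{n-1}\times[a,b]\to\mathbb R^{n+m}$ be a smooth immersion (smooth up to the boundary) with induced metric $g$. Let $\bar g$ be the standard metric of the cylinder and $\bar D$ its Levi-Civita connection. The mean radius $r(z)$ is defined by $|N(S^{n-1}\times\{z\})|=|S^{n-1}|\,r(z)^{n-1}$ (area of the cross section counted by the pulled back area form). The second fundamental form $h_{ij}$ is vector valued, $\partial_i\partial_jN-\Gamma_{ij}^k\partial_kN=-h_{ij}$; $W$ is the Weingarten map $h_i^j=g^{jl}h_{il}$, $H=h_i^i$, $|A|^2=\langle h_{ij},h^{ij}\rangle$, $\nu^+=H/|H|$ and $h^+_{ij}=\langle h_{ij},\nu^+\rangle$; indices are raised with $g$, and repeated indices are summed. $N$ is an *$(\varepsilon,k)$-cylindrical (submanifold) neck* if on $S^{n-1}\times[a,b]$ * $\hat g=r^{-2}g$ satisfies $|\hat g-\bar g|_{\bar g}\le\varepsilon$ and $|\bar D^j\hat g|_{\bar g}\le\varepsilon$ for $1\le j\le k$; * $|(d/dz)^j\log r|\le\varepsilon$ for $1\le j\le k$; * there is a unit normal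 direction $\nu$ with $|W_\nu-r^{-1}\bar W|\le\varepsilon r^{-1}$ and $|W_-|\le\varepsilon r^{-1}$, and $|\nabla^lW|\le\varepsilon r^{-l-1}$ for $1\le l\le k$. Here $W_\nu$ and $W_-$ are the components of $W$ along $\nu$ and orthogonal to $\nu$, $\bar W$ is the Weingarten map of the standard cylinder (the identity on $TS^{n-1}$, $0$ on $\partial_z$), and $\nabla$ is the connection induced by $g$ and the normal connection. Let $u:[a,b]\to\mathbb R$ be $C^2$ and $\tau\ge0$, and let $\tilde N_\tau=N-\tau u(z)\nu^+$ be the bending deformation; quantities of $\tilde N_\tau$ carry a tilde (in particular $\tilde h_i^j=\tilde g^{jl}\tilde h_{il}$). At a given point we use coordinates $x^1,\dots,x^n$ of the cylinder centred there, where $x^1$ is the axial coordinate $z$ up to a constant and $x^2,\dots,x^n$ are coordinates of $S^{n-1}$ that are normal at the point for the round metric (there the metric coefficients are $\delta_{ab}$ and their first derivatives vanish). **Theorem.** Let $n\ge2$, $m\ge 0$ and $0<\theta<1$. There are $\varepsilon_0>0$ and $c>0$, depending only on $n,m,\theta$, with the following property. Let $k\ge1$, and $k\ge2$ unless $m=1$;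 let $0<\varepsilon<\varepsilon_0$. Let $N$ be an $(\varepsilon,k)$-cylindrical neck (for instance one in normal parametrization; that condition is not needed), and let $u,\tau$ satisfy $\tau(|u|+|u'|)\le\theta r$ on $[a,b]$. Then $\tilde N_\tau$ is an immersion, and at every point, in coordinates as above centred at it and for all $i,j$, with $e_1=\varepsilon\tau(|u|+|u'|)$ and $e_2=\tau^2(|u|^2+|u'|^2+|u''|^2)$: (i) $$\begin{aligned}\tilde h_{ij}={}&h_{ij}+\tau\delta^1_i\delta^1_ju''\nu^++\tau u\,h^{+,k}_j\partial_i\partial_kN+\tau\delta^1_ju'\partial_i\nu^++\tau\delta^1_iu'h^{+,k}_j\partial_kN+\tau u\,(\partial_ih^{+,k}_j)\partial_kN\\&-\tau u'(\delta^1_ih^{+,k}_j+\delta^1_jh^{+,k}_i-g^{1k}h^+_{ij})\partial_kN+R_{ij},\qquad |R_{ij}|\le c\,(e_1+r^{-1}e_2);\end{aligned}$$ (ii) $$\begin{aligned}\tilde h_i^j={}&h_i^j+\tau g^{1j}\delta^1_iu''\nu^+-\tau u\,h^{+,jk}\partial_i\partial_kN+\tau g^{1j}u'\partial_i\nu^++\tau\delta^1_iu'h^{+,jk}\partial_kN+\tau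 u\,(\partial_ih^{+,jk})\partial_kN\\&-\tau u'(\delta^1_ih^{+,jk}+g^{1j}h^{+,k}_i-g^{1k}h^{+,j}_i)\partial_kN+R_i^j,\qquad |R_i^j|\le c\,(r^{-2}e_1+r^{-3}e_2);\end{aligned}$$ (iii) $$\begin{aligned}\tilde H={}&H+\tau g^{11}u''\nu^+-\tau u\,h^{+,ik}\partial_i\partial_kN+\tau g^{1i}u'\partial_i\nu^++\tau u'h^{+,1k}\partial_kN+\tau u\,(\partial_ih^{+,ik})\partial_kN\\&-\tau u'(\delta^1_ih^{+,ik}+g^{1i}h^{+,k}_i-g^{1k}h^{+,i}_i)\partial_kN+R,\qquad |R|\le c\,(r^{-2}e_1+r^{-3}e_2);\end{aligned}$$ (iv) $$\Big||\tilde A|^2-\big(|A|^2+2\tau\delta^1_i\delta^1_ju''h^{+,ij}+2\tau u\,h^{+,k}_j\langle h_{ik},h^{ij}\rangle\big)\Big|\le c\,(r^{-3}e_1+r^{-4}e_2);$$ (v) $$\Big||\tilde H|^2-\big(|H|^2+2\tau u''g^{11}|H|+2\tau u\,h^{+,k}_jh^+_{ik}g^{ij}|H|\big)\Big|\le c\,(r^{-3}e_1+r^{-4}e_2).$$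 (Everything is evaluated at the point considered; $u$, $r$ and their derivatives at its $z$.) -/

import Mathlib

open scoped Topology ContDiff

namespace BendNeck

noncomputable section

/-- Euclidean space `ℝⁿ`. -/
abbrev E (n : ℕ) : Type := EuclideanSpace ℝ (Fin n)

/-! ### Calculus of immersed coordinate patches `F : ℝⁿ → V` -/

/-- The partial derivative `∂f / ∂xⁱ` at `x`. -/
def pd {n : ℕ} {W : Type} [NormedAddCommGroup W] [NormedSpace ℝ W]
    (i : Fin n) (f : E n → W) (x : E n) : W :=
  fderiv ℝ f x (EuclideanSpace.single i 1)

/-- The Christoffel symbols `Γ_{ij}^k` of a metric `G` given by its coefficient matrix. -/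
def christoffel {n : ℕ} (G : E n → Matrix (Fin n) (Fin n) ℝ) (x : E n) (i j k : Fin n) : ℝ :=
  (1 / 2) * ∑ l, (G x)⁻¹ k l *
    (pd i (fun y => G y j l) x + pd j (fun y => G y l i) x - pd l (fun y => G y i j) x)

/-- Covariant derivative of a tensor with `l` lower indices and values in `V`; the new index is
the first one. `P` is the projection onto the bundle in which the tensor takes its values (the
identity for scalar tensors, the normal projection for tensors with values in the normal
bundle). -/
def covDeriv {n l : ℕ} {V : Type} [NormedAddCommGroup V] [NormedSpace ℝ V]
    (Γ : E n → Fin n → Fin n → Fin n → ℝ) (P : E n → V → V)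
    (T : E n → (Fin l → Fin n) → V) (x : E n) (I : Fin (l + 1) → Fin n) : V :=
  P x (pd (I 0) (fun y => T y (Fin.tail I)) x)
    - ∑ a : Fin l, ∑ k : Fin n,
        Γ x (I 0) (Fin.tail I a) k • T x (Function.update (Fin.tail I) a k)

/-- The `j`-th iterated covariant derivative of a tensor with two lower indices. -/
def iterCovDeriv {n : ℕ} {V : Type} [NormedAddCommGroup V] [NormedSpace ℝ V]
    (Γ : E n → Fin n → Fin n → Fin n → ℝ) (P : E n → V → V)
    (T : E n → (Fin 2 → Fin n) → V) : (j : ℕ) → E n → (Fin (2 + j) → Fin n) → V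
  | 0 => T
  | j + 1 => covDeriv Γ P (iterCovDeriv Γ P T j)

/-- The norm of a tensor with `l` lower indices; `Ginv` is the matrix `g^{ij}`. -/
def tensorNorm {n l : ℕ} {V : Type} [NormedAddCommGroup V] [InnerProductSpace ℝ V]
    (Ginv : Matrix (Fin n) (Fin n) ℝ) (T : (Fin l → Fin n) → V) : ℝ :=
  Real.sqrt (∑ I : Fin l → Fin n, ∑ J : Fin l → Fin n,
    (∏ a, Ginv (I a) (J a)) * inner ℝ (T I) (T J))

section Patch

variable {n : ℕ} {V : Type} [NormedAddCommGroup V] [InnerProductSpace ℝ V]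

/-- The induced metric `g_{ij} = ⟨∂_i F, ∂_j F⟩`. -/
def metric (F : E n → V) (x : E n) : Matrix (Fin n) (Fin n) ℝ :=
  Matrix.of fun i j => inner ℝ (pd i F x) (pd j F x)

/-- The inverse metric `g^{ij}`. -/
def metricInv (F : E n → V) (x : E n) : Matrix (Fin n) (Fin n) ℝ := (metric F x)⁻¹

/-- The vector valued second fundamental form, with the sign convention
`∂_i ∂_j F - Γ_{ij}^k ∂_k F = - h_{ij}`. -/
def sff (F : E n → V) (x : E n) (i j : Fin n) : V :=
  -(pd i (pd j F) x - ∑ k, christoffel (metric F) x i j k • pd k F x)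

/-- The Weingarten map `h_i^j = g^{jl} h_{il}` (vector valued). -/
def weingarten (F : E n → V) (x : E n) (i j : Fin n) : V :=
  ∑ l, metricInv F x j l • sff F x i l

/-- The mean curvature vector `H = h_i^i`. -/
def meanCurv (F : E n → V) (x : E n) : V := ∑ i, weingarten F x i i

/-- `|A|² = g^{ik} g^{jl} ⟨h_{ij}, h_{kl}⟩`. -/
def normSqA (F : E n → V) (x : E n) : ℝ :=
  ∑ i, ∑ j, ∑ k, ∑ l, metricInv F x i k * metricInv F x j l *
    inner ℝ (sff F x i j) (sff F x k l)

/-- The principal normal direction `ν⁺ = H / |H|`. -/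
def nuPlus (F : E n → V) (x : E n) : V := ‖meanCurv F x‖⁻¹ • meanCurv F x

/-- `h⁺_{ij} = ⟨h_{ij}, ν⁺⟩`. -/
def hPlus (F : E n → V) (x : E n) (i j : Fin n) : ℝ := inner ℝ (sff F x i j) (nuPlus F x)

/-- `h^{+,k}_j = g^{kl} h⁺_{jl}`. -/
def hPlusMixed (F : E n → V) (x : E n) (j k : Fin n) : ℝ :=
  ∑ l, metricInv F x k l * hPlus F x j l

/-- `h^{+,jk} = g^{jp} g^{kq} h⁺_{pq}`. -/
def hPlusUp (F : E n → V) (x : E n) (j k : Fin n) : ℝ :=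
  ∑ p, ∑ q, metricInv F x j p * metricInv F x k q * hPlus F x p q

/-- `h^{ij} = g^{ip} g^{jq} h_{pq}` (vector valued). -/
def sffUp (F : E n → V) (x : E n) (i j : Fin n) : V :=
  ∑ p, ∑ q, (metricInv F x i p * metricInv F x j q) • sff F x p q

/-- The orthogonal projection onto the normal space of the patch. -/
def normalProj (F : E n → V) (x : E n) (v : V) : V :=
  v - ∑ i, ∑ j, (metricInv F x i j * inner ℝ v (pd i F x)) • pd j F x

/-- The `l`-th covariant derivative of the second fundamental form, for the Levi-Civita
connection and the normal connection. Lowering the tangential index with the parallel metric, it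
is `∇^l W`. -/
def nablaSff (F : E n → V) (l : ℕ) : E n → (Fin (2 + l) → Fin n) → V :=
  iterCovDeriv (christoffel (metric F)) (normalProj F) (fun x I => sff F x (I 0) (I 1)) l

end Patch

/-! ### Coordinates on the cylinder `S^d × ℝ`, where `d = n - 1` -/

/-- `σ` is a local parametrization of the unit sphere `S^d ⊆ ℝ^{d+1}` near `σ 0` which is
normal at `0` for the round metric: there the metric coefficients are `δ_{ab}` and their first
derivatives (so the Christoffel symbols) vanish. -/
structure IsNormalSphereChart {d : ℕ} (σ : E d → E (d + 1)) : Prop where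
  smooth : ContDiffAt ℝ ∞ σ 0
  mem_sphere : ∀ᶠ y in 𝓝 (0 : E d), ‖σ y‖ = 1
  metric_eq : metric σ 0 = 1
  deriv_metric_eq : ∀ a b c : Fin d, pd c (fun y => metric σ y a b) 0 = 0

/-- Coordinates on the cylinder around `(σ 0, z)`: the coordinate with index `0` (usually written
`x¹`) is the axial coordinate minus `z`, the other ones are the coordinates of `σ`. -/
def cylChart {d : ℕ} (σ : E d → E (d + 1)) (z : ℝ) (x : E (d + 1)) : E (d + 1) × ℝ :=
  (σ (WithLp.toLp 2 (fun a : Fin d => x a.succ)), z + x 0)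

/-- The standard metric of the cylinder `S^d × ℝ` in these coordinates. -/
def cylMetric {d : ℕ} (σ : E d → E (d + 1)) (z : ℝ) (x : E (d + 1)) :
    Matrix (Fin (d + 1)) (Fin (d + 1)) ℝ :=
  Matrix.of fun i j =>
    inner ℝ (pd i (fun y => (cylChart σ z y).1) x) (pd j (fun y => (cylChart σ z y).1) x)
      + pd i (fun y => (cylChart σ z y).2) x * pd j (fun y => (cylChart σ z y).2) x

/-- `δ^1_i`, the components of `dz`. -/
def dz {d : ℕ} (i : Fin (d + 1)) : ℝ := if i = 0 then 1 else 0

/-- The Weingarten map of the standard cylinder of radius one: the identity on the tangent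
space of the sphere, zero on the axial direction. -/
def cylWeingarten {d : ℕ} (i j : Fin (d + 1)) : ℝ := (if i = j then 1 else 0) - dz i * dz j

/-! ### Necks

A map on `S^d × [a, b]` is given by a map `N` on `ℝ^{d+1} × ℝ`, smooth near `S^d × [a, b]`; only
its values on `S^d × ℝ` near `S^d × [a, b]` are used. -/

section Neck

variable {d m : ℕ}

/-- The density, with respect to the measure of the round sphere, of the area of the cross section
`N (S^d × {z})`: the square root of the Gram determinant of the images of an orthonormal
basis of `T_p S^d = p^⊥`. -/
def areaDensity (N : E (d + 1) × ℝ → E (d + 1 + m)) (z : ℝ) (p : E (d + 1)) : ℝ :=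
  let e := stdOrthonormalBasis ℝ (Submodule.span ℝ {p})ᗮ
  let D := fderiv ℝ (fun y => N (y, z)) p
  Real.sqrt (Matrix.det (Matrix.of fun a b =>
    inner ℝ (D (e a : E (d + 1))) (D (e b : E (d + 1)))))

/-- The measure of the round unit sphere `S^d`. -/
def sphereMeasure (d : ℕ) : MeasureTheory.Measure (Metric.sphere (0 : E (d + 1)) 1) :=
  (MeasureTheory.volume : MeasureTheory.Measure (E (d + 1))).toSphere

/-- The mean radius `r(z)`, determined by `|Σ_z| = σ_d r(z)^d` where `|Σ_z|` is the area of the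
cross section and `σ_d` the area of the unit sphere `S^d`. -/
def meanRadius (N : E (d + 1) × ℝ → E (d + 1 + m)) (z : ℝ) : ℝ :=
  ((∫ p, areaDensity N z (p : E (d + 1)) ∂(sphereMeasure d)) /
    (sphereMeasure d).real Set.univ) ^ (1 / (d : ℝ))

/-- `N` in the coordinates `cylChart σ z`. -/
def patch (N : E (d + 1) × ℝ → E (d + 1 + m)) (σ : E d → E (d + 1)) (z : ℝ)
    (x : E (d + 1)) : E (d + 1 + m) :=
  N (cylChart σ z x)

/-- The conformal metric `ĝ = r(z)^{-2} g` in the coordinates `cylChart σ z`. -/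
def confMetric (N : E (d + 1) × ℝ → E (d + 1 + m)) (σ : E d → E (d + 1)) (z : ℝ)
    (x : E (d + 1)) : Matrix (Fin (d + 1)) (Fin (d + 1)) ℝ :=
  ((meanRadius N (z + x 0)) ^ 2)⁻¹ • metric (patch N σ z) x

/-- The (intrinsic) `(ε, k)` geometric neck conditions for the metric induced by `N`. All tensors
are evaluated at the centre `x = 0` of the coordinates, and the coordinates range over all normal
coordinates centred at any point of `S^d × [a, b]`. -/
structure IsGeometricNeck (ε : ℝ) (k : ℕ) (a b : ℝ) (N : E (d + 1) × ℝ → E (d + 1 + m)) :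
    Prop where
  smooth : ∀ (p : E (d + 1)) (z : ℝ), ‖p‖ = 1 → z ∈ Set.Icc a b → ContDiffAt ℝ ∞ N (p, z)
  immersion : ∀ z ∈ Set.Icc a b, ∀ σ : E d → E (d + 1), IsNormalSphereChart σ →
    LinearIndependent ℝ (fun i => pd i (patch N σ z) 0)
  radius_smooth : ∀ z ∈ Set.Icc a b, ContDiffAt ℝ ∞ (meanRadius N) z
  metric_close : ∀ z ∈ Set.Icc a b, ∀ σ : E d → E (d + 1), IsNormalSphereChart σ →
    tensorNorm (cylMetric σ z 0)⁻¹
      (fun I : Fin 2 → Fin (d + 1) =>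
        confMetric N σ z 0 (I 0) (I 1) - cylMetric σ z 0 (I 0) (I 1)) ≤ ε
  deriv_metric_close : ∀ z ∈ Set.Icc a b, ∀ σ : E d → E (d + 1), IsNormalSphereChart σ →
    ∀ j : ℕ, 1 ≤ j → j ≤ k →
      tensorNorm (cylMetric σ z 0)⁻¹
        (iterCovDeriv (christoffel (cylMetric σ z)) (fun _ v => v)
          (fun x I => confMetric N σ z x (I 0) (I 1)) j 0) ≤ ε
  radius_close : ∀ z ∈ Set.Icc a b, ∀ j : ℕ, 1 ≤ j → j ≤ k →
    |iteratedDeriv j (fun s => Real.log (meanRadius N s)) z| ≤ ε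

/-- `(ε, k)`-cylindrical submanifold neck: a geometric neck together with a unit normal
direction `ν` such that `|W_ν - r⁻¹ W̄| ≤ ε r⁻¹`, `|W_-| ≤ ε r⁻¹` and `|∇^l W| ≤ ε r^{-l-1}` for
`1 ≤ l ≤ k`, where `W_-` is the part of `W` normal to `ν`. -/
structure IsCylindricalNeck (ε : ℝ) (k : ℕ) (a b : ℝ) (N : E (d + 1) × ℝ → E (d + 1 + m)) :
    Prop extends IsGeometricNeck ε k a b N where
  curvature_close : ∃ ν : E (d + 1) × ℝ → E (d + 1 + m),
    ∀ z ∈ Set.Icc a b, ∀ σ : E d → E (d + 1), IsNormalSphereChart σ →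
      ‖ν (σ 0, z)‖ = 1 ∧
      (∀ i, inner ℝ (ν (σ 0, z)) (pd i (patch N σ z) 0) = 0) ∧
      tensorNorm (metricInv (patch N σ z) 0)
        (fun I : Fin 2 → Fin (d + 1) =>
          inner ℝ (sff (patch N σ z) 0 (I 0) (I 1)) (ν (σ 0, z))
            - (meanRadius N z)⁻¹ *
              ∑ l, cylWeingarten (I 0) l * metric (patch N σ z) 0 l (I 1))
        ≤ ε * (meanRadius N z)⁻¹ ∧
      tensorNorm (metricInv (patch N σ z) 0)
        (fun I : Fin 2 → Fin (d + 1) =>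
          sff (patch N σ z) 0 (I 0) (I 1)
            - (inner ℝ (sff (patch N σ z) 0 (I 0) (I 1)) (ν (σ 0, z)) : ℝ) • ν (σ 0, z))
        ≤ ε * (meanRadius N z)⁻¹
  deriv_curvature : ∀ z ∈ Set.Icc a b, ∀ σ : E d → E (d + 1), IsNormalSphereChart σ →
    ∀ l : ℕ, 1 ≤ l → l ≤ k →
      tensorNorm (metricInv (patch N σ z) 0) (nablaSff (patch N σ z) l 0)
        ≤ ε * ((meanRadius N z) ^ (l + 1))⁻¹

/-- The bending deformation `Ñ_τ = N - τ u(z) ν⁺` in the coordinates `cylChart σ z`. -/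
def bentPatch (N : E (d + 1) × ℝ → E (d + 1 + m)) (τ : ℝ) (u : ℝ → ℝ)
    (σ : E d → E (d + 1)) (z : ℝ) (x : E (d + 1)) : E (d + 1 + m) :=
  patch N σ z x - (τ * u (z + x 0)) • nuPlus (patch N σ z) x

end Neck

end

end BendNeck

open BendNeck

/-! The estimates are pointwise and scale correctly, so it suffices to study the homothetic patch
`r⁻¹ • F` at the centre of the coordinates. There the neck conditions say that, up to `O(ε)`, the
metric is the identity, its first derivatives and the Christoffel symbols vanish, and `h_{ij}` is
`W̄_{ij}` times a fixed unit vector. These data, together with the rescaled profile `v`, form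
`BendData`. On the type of all such data the filter `lim` lets `ε` tend to zero. A relation `f
=O[lim] e` is then a bound with a constant and a threshold that depend only on `d`, `m`, `θ`, `K`,
so uniformity comes for free from the calculus of `O`.

The geometric core is the behaviour of `ν⁺`. Its derivative is `h^{+,k}_j ∂_kF` plus a normal part,
`nuDefect` (`pd_nuPlus`). The normal part of `∂_jH` is the trace of `∇h` because the metric is
parallel (`normalProj_pd_meanCurv`), so `nuDefect` is `O(ε)`. Its derivative is `O(ε)` as well
(`O_pd_nuDefect`): in codimension one the defect vanishes identically, and otherwise the bound on
`∇²h` is used. Hence `∂_i∂_jν⁺` is `h^{+,k}_j ∂_i∂_kF` up to `O(ε)`.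

For the bent patch, `∂F̃` and `∂∂F̃` are explicit in `v`, `v'`, `v''`. Its metric is `O(ε)`-close to
the diagonal matrix with entries `1 + v'²` and `(1 - v)²`, which is bounded below since `|v| ≤ θ <
1`. So the bent patch is immersed and its inverse metric is bounded, although `v` need not be small.
Expanding `h̃ = -∂∂F̃ + g̃^{kl}⟨∂∂F̃, ∂_kF̃⟩∂_lF̃`, the terms linear in `v, v', v''` are the
asserted ones; the remainders are `O(ε)` times `v` or `v'`, or quadratic (`O_sff_bent_sub_lin`). No
product of `ε` with `v''` arises, because to first order `v''` only multiplies `ν⁺`, which is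
exactly normal.

Raising an index adds `2v h^{+,jl} h_{il}`, and `h_{il}` is `-∂_i∂_lF` up to `O(ε)`; this reverses
the sign of the corresponding term (`O_weingarten_bent_sub_lin`). Pairing with `W` or with `H`,
which are normal, removes the tangential terms and gives the expansions of `|A|²` and `|H|²`.
Finally `exists_bendData` turns a neck into normalized data, and the homothety lemmas restore the
powers of `r`. -/

namespace BendNeck

open Filter Asymptotics
open scoped Topology ContDiff

noncomputable section

/-! ### Partial derivatives -/

section PartialDerivatives

variable {n : ℕ} {W W' : Type} [NormedAddCommGroup W] [NormedSpace ℝ W]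
  [NormedAddCommGroup W'] [InnerProductSpace ℝ W'] {x : E n} {i : Fin n}

lemma pd_congr {f g : E n → W} (h : f =ᶠ[𝓝 x] g) : pd i f x = pd i g x := by
  simp [pd, h.fderiv_eq]

@[simp] lemma pd_const (c : W) : pd i (fun _ => c) x = 0 := by simp [pd]

lemma pd_add {f g : E n → W} (hf : DifferentiableAt ℝ f x) (hg : DifferentiableAt ℝ g x) :
    pd i (fun y => f y + g y) x = pd i f x + pd i g x := by
  simp [pd, fderiv_fun_add hf hg]

lemma pd_sub {f g : E n → W} (hf : DifferentiableAt ℝ f x) (hg : DifferentiableAt ℝ g x) :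
    pd i (fun y => f y - g y) x = pd i f x - pd i g x := by
  simp [pd, fderiv_fun_sub hf hg]

lemma pd_sum {ι : Type*} {s : Finset ι} {f : ι → E n → W}
    (hf : ∀ a, DifferentiableAt ℝ (f a) x) :
    pd i (fun y => ∑ a ∈ s, f a y) x = ∑ a ∈ s, pd i (f a) x := by
  simp [pd, fderiv_fun_sum (u := s) (fun a _ => hf a)]

lemma pd_smul {c : E n → ℝ} {f : E n → W} (hc : DifferentiableAt ℝ c x)
    (hf : DifferentiableAt ℝ f x) :
    pd i (fun y => c y • f y) x = c x • pd i f x + pd i c x • f x := by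
  simp [pd, fderiv_fun_smul hc hf]

lemma pd_const_smul (c : ℝ) (f : E n → W) :
    pd i (fun y => c • f y) x = c • pd i f x := by
  simp only [pd]
  rw [show (fun y => c • f y) = c • f from rfl, fderiv_const_smul_field]; rfl

lemma pd_mul {c e : E n → ℝ} (hc : DifferentiableAt ℝ c x) (he : DifferentiableAt ℝ e x) :
    pd i (fun y => c y * e y) x = c x * pd i e x + pd i c x * e x :=
  pd_smul (W := ℝ) hc he

lemma pd_inner {f g : E n → W'} (hf : DifferentiableAt ℝ f x) (hg : DifferentiableAt ℝ g x) :
    pd i (fun y => (inner ℝ (f y) (g y) : ℝ)) x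
      = inner ℝ (pd i f x) (g x) + inner ℝ (f x) (pd i g x) := by
  simp only [pd]
  rw [fderiv_inner_apply ℝ hf hg, add_comm]

lemma _root_.ContDiffAt.pd_of_le {f : E n → W} {p q : WithTop ℕ∞} (hf : ContDiffAt ℝ q f x)
    (hpq : p + 1 ≤ q) (i : Fin n) : ContDiffAt ℝ p (pd i f) x :=
  (hf.fderiv_right hpq).clm_apply contDiffAt_const

lemma _root_.ContDiffAt.pd {f : E n → W} (hf : ContDiffAt ℝ ∞ f x) (i : Fin n) :
    ContDiffAt ℝ ∞ (pd i f) x :=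
  hf.pd_of_le (by simp) i

lemma _root_.ContDiffAt.pd_two {f : E n → W} (hf : ContDiffAt ℝ 2 f x) (i : Fin n) :
    ContDiffAt ℝ 1 (BendNeck.pd i f) x :=
  hf.pd_of_le (by norm_num) i

lemma _root_.ContDiffAt.diff_pd {f : E n → W} (hf : ContDiffAt ℝ 2 f x) (i : Fin n) :
    DifferentiableAt ℝ (BendNeck.pd i f) x :=
  (hf.pd_two i).differentiableAt (by simp)

lemma pd_comm {f : E n → W} (hf : ContDiffAt ℝ 2 f x) (i j : Fin n) :
    pd i (pd j f) x = pd j (pd i f) x := by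
  have hd : DifferentiableAt ℝ (fderiv ℝ f) x :=
    (hf.fderiv_right (m := 1) (by norm_num)).differentiableAt (by simp)
  have key : ∀ a b : Fin n, pd a (pd b f) x
      = fderiv ℝ (fderiv ℝ f) x (EuclideanSpace.single a 1) (EuclideanSpace.single b 1) := by
    intro a b
    change fderiv ℝ (fun y => fderiv ℝ f y (EuclideanSpace.single b 1)) x _ = _
    rw [fderiv_clm_apply hd (by fun_prop)]
    simp
  rw [key, key]
  exact (hf.isSymmSndFDerivAt (by simp)).eq _ _

lemma _root_.ContDiffAt.eventually_differentiableAt {f : E n → W} (hf : ContDiffAt ℝ ∞ f x) :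
    ∀ᶠ y in 𝓝 x, DifferentiableAt ℝ f y :=
  ((hf.of_le (m := 1) (by simp)).eventually (by simp)).mono
    fun _ h => h.differentiableAt (by simp)

lemma _root_.ContDiffAt.diff {f : E n → W} (hf : ContDiffAt ℝ ∞ f x) : DifferentiableAt ℝ f x :=
  hf.differentiableAt (by simp)

end PartialDerivatives

/-! ### Pointwise identities for immersed patches -/

section Pointwise

variable {n : ℕ} {V : Type} [NormedAddCommGroup V] [InnerProductSpace ℝ V] {F : E n → V}
  {x : E n}

lemma metric_apply (F : E n → V) (x : E n) (i j : Fin n) :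
    metric F x i j = inner ℝ (pd i F x) (pd j F x) := rfl

lemma metric_symm (F : E n → V) (x : E n) (i j : Fin n) : metric F x i j = metric F x j i := by
  simp [metric_apply, real_inner_comm]

lemma det_metric_ne_zero_iff :
    (metric F x).det ≠ 0 ↔ LinearIndependent ℝ (fun i => pd i F x) :=
  Matrix.det_gram_ne_zero_iff_linearIndependent

lemma metricInv_symm (F : E n → V) (x : E n) (i j : Fin n) :
    metricInv F x i j = metricInv F x j i := by
  have h : (metric F x).transpose = metric F x := by
    ext a b; simp [metric_symm F x a b]
  calc metricInv F x i j = (metricInv F x).transpose j i := rfl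
    _ = metricInv F x j i := by rw [metricInv, Matrix.transpose_nonsing_inv, h]

lemma sum_metricInv_mul_metric (hx : (metric F x).det ≠ 0) (i j : Fin n) :
    ∑ k, metricInv F x i k * metric F x k j = if i = j then 1 else 0 := by
  have := Matrix.nonsing_inv_mul (metric F x) (isUnit_iff_ne_zero.2 hx)
  have h := congrFun (congrFun this i) j
  rwa [Matrix.mul_apply, Matrix.one_apply] at h

lemma sum_metric_mul_metricInv (hx : (metric F x).det ≠ 0) (i j : Fin n) :
    ∑ k, metric F x i k * metricInv F x k j = if i = j then 1 else 0 := by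
  have := Matrix.mul_nonsing_inv (metric F x) (isUnit_iff_ne_zero.2 hx)
  have h := congrFun (congrFun this i) j
  rwa [Matrix.mul_apply, Matrix.one_apply] at h

lemma pd_metric (hF : ContDiffAt ℝ 2 F x) (k i j : Fin n) :
    pd k (fun y => metric F y i j) x
      = inner ℝ (pd k (pd i F) x) (pd j F x) + inner ℝ (pd i F x) (pd k (pd j F) x) :=
  pd_inner (hF.diff_pd i) (hF.diff_pd j)

/-- Of the six terms in the Koszul formula four cancel by symmetry of second derivatives; the two
that remain are equal. -/
lemma christoffel_metric (hF : ContDiffAt ℝ 2 F x) (i j k : Fin n) :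
    christoffel (metric F) x i j k
      = ∑ l, metricInv F x k l * inner ℝ (pd i (pd j F) x) (pd l F x) := by
  rw [christoffel, Finset.mul_sum]
  refine Finset.sum_congr rfl fun l _ => ?_
  rw [pd_metric hF, pd_metric hF, pd_metric hF, pd_comm hF i l, pd_comm hF j l, pd_comm hF j i,
    metricInv, real_inner_comm (pd i (pd j F) x) (pd l F x),
    real_inner_comm (pd l (pd i F) x) (pd j F x),
    real_inner_comm (pd l (pd j F) x) (pd i F x)]
  ring

lemma sum_metricInv_smul_inner (hx : (metric F x).det ≠ 0) (c : Fin n → ℝ) (m : Fin n) :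
    ∑ i, ∑ j, metricInv F x i j * c i * inner ℝ (pd j F x) (pd m F x) = c m := by
  calc _ = ∑ i, c i * ∑ j, metricInv F x i j * metric F x j m := by
        refine Finset.sum_congr rfl fun i _ => ?_
        rw [Finset.mul_sum]
        exact Finset.sum_congr rfl fun j _ => by rw [metric_apply]; ring
    _ = c m := by simp [sum_metricInv_mul_metric hx]

lemma inner_normalProj (hx : (metric F x).det ≠ 0) (v : V) (k : Fin n) :
    (inner ℝ (normalProj F x v) (pd k F x) : ℝ) = 0 := by
  simp only [normalProj, inner_sub_left, sum_inner, real_inner_smul_left]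
  rw [sum_metricInv_smul_inner hx (fun i => inner ℝ v (pd i F x)), sub_self]

lemma normalProj_of_forall_inner_eq_zero {v : V}
    (hv : ∀ k, (inner ℝ v (pd k F x) : ℝ) = 0) : normalProj F x v = v := by
  simp [normalProj, hv]

lemma normalProj_add (v w : V) :
    normalProj F x (v + w) = normalProj F x v + normalProj F x w := by
  simp only [normalProj, inner_add_left, mul_add, add_smul, Finset.sum_add_distrib]
  abel

lemma normalProj_smul (c : ℝ) (v : V) : normalProj F x (c • v) = c • normalProj F x v := by
  simp only [normalProj, real_inner_smul_left, smul_sub, Finset.smul_sum, smul_smul]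
  congr 1
  exact Finset.sum_congr rfl fun i _ => Finset.sum_congr rfl fun j _ => by congr 1; ring

lemma normalProj_sum {ι : Type*} (s : Finset ι) (f : ι → V) :
    normalProj F x (∑ a ∈ s, f a) = ∑ a ∈ s, normalProj F x (f a) := by
  classical
  induction s using Finset.induction_on with
  | empty => simp [normalProj]
  | insert a s ha ih => rw [Finset.sum_insert ha, Finset.sum_insert ha, normalProj_add, ih]

lemma inner_normalProj_of_normal {v w : V} (hw : ∀ k, (inner ℝ w (pd k F x) : ℝ) = 0) :
    (inner ℝ (normalProj F x v) w : ℝ) = inner ℝ v w := by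
  simp only [normalProj, inner_sub_left, sum_inner, real_inner_smul_left]
  simp [real_inner_comm w, hw]

lemma sff_eq (hF : ContDiffAt ℝ 2 F x) (i j : Fin n) :
    sff F x i j = -pd i (pd j F) x
      + ∑ k, ∑ l, (metricInv F x k l * inner ℝ (pd i (pd j F) x) (pd k F x)) • pd l F x := by
  simp only [sff, christoffel_metric hF, Finset.sum_smul, neg_sub]
  rw [Finset.sum_comm, add_comm, sub_eq_add_neg]
  congr 1
  exact Finset.sum_congr rfl fun k _ => Finset.sum_congr rfl fun l _ => by
    rw [metricInv_symm]

/-- The Christoffel sum is exactly the tangential part of the second derivative. -/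
lemma sff_eq_neg_normalProj (hF : ContDiffAt ℝ 2 F x) (i j : Fin n) :
    sff F x i j = -normalProj F x (pd i (pd j F) x) := by
  rw [sff_eq hF, normalProj]; abel

lemma sff_symm (hF : ContDiffAt ℝ 2 F x) (i j : Fin n) : sff F x i j = sff F x j i := by
  rw [sff_eq_neg_normalProj hF, sff_eq_neg_normalProj hF, pd_comm hF]

lemma inner_sff_pd (hF : ContDiffAt ℝ 2 F x) (hx : (metric F x).det ≠ 0) (i j k : Fin n) :
    (inner ℝ (sff F x i j) (pd k F x) : ℝ) = 0 := by
  rw [sff_eq_neg_normalProj hF, inner_neg_left, inner_normalProj hx, neg_zero]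

lemma inner_pd_pd_of_normal (hF : ContDiffAt ℝ 2 F x) {w : V}
    (hw : ∀ k, (inner ℝ w (pd k F x) : ℝ) = 0) (i j : Fin n) :
    (inner ℝ (pd i (pd j F) x) w : ℝ) = -inner ℝ (sff F x i j) w := by
  rw [sff_eq_neg_normalProj hF, inner_neg_left, inner_normalProj_of_normal hw, neg_neg]

lemma inner_meanCurv_pd (hF : ContDiffAt ℝ 2 F x) (hx : (metric F x).det ≠ 0) (k : Fin n) :
    (inner ℝ (meanCurv F x) (pd k F x) : ℝ) = 0 := by
  simp [meanCurv, weingarten, sum_inner, real_inner_smul_left, inner_sff_pd hF hx]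

lemma inner_nuPlus_pd (hF : ContDiffAt ℝ 2 F x) (hx : (metric F x).det ≠ 0) (k : Fin n) :
    (inner ℝ (nuPlus F x) (pd k F x) : ℝ) = 0 := by
  simp [nuPlus, real_inner_smul_left, inner_meanCurv_pd hF hx]

lemma hPlus_symm (hF : ContDiffAt ℝ 2 F x) (i j : Fin n) : hPlus F x i j = hPlus F x j i := by
  rw [hPlus, hPlus, sff_symm hF]

lemma norm_nuPlus (hH : meanCurv F x ≠ 0) : ‖nuPlus F x‖ = 1 := by
  simp [nuPlus, norm_smul, hH]

lemma norm_smul_nuPlus (hH : meanCurv F x ≠ 0) :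
    ‖meanCurv F x‖ • nuPlus F x = meanCurv F x := by
  simp [nuPlus, smul_smul, hH]

/-- If the normal space is a line, it is spanned by the principal normal. -/
lemma eq_inner_smul_of_finrank [FiniteDimensional ℝ V] (hV : Module.finrank ℝ V = n + 1)
    (hx : (metric F x).det ≠ 0) {v w : V} (hv : ∀ k, (inner ℝ v (pd k F x) : ℝ) = 0)
    (hw : ∀ k, (inner ℝ w (pd k F x) : ℝ) = 0) (hw1 : ‖w‖ = 1) :
    v = (inner ℝ v w : ℝ) • w := by
  have hli := det_metric_ne_zero_iff.1 hx
  set S := Submodule.span ℝ (Set.range fun i => pd i F x) with hS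
  have hSn : Module.finrank ℝ S = n := by
    simpa using finrank_span_eq_card hli
  have hperp : Module.finrank ℝ Sᗮ = 1 := by
    have := Submodule.finrank_add_finrank_orthogonal S
    omega
  have mem : ∀ y : V, (∀ k, (inner ℝ y (pd k F x) : ℝ) = 0) → y ∈ Sᗮ := by
    intro y hy
    rw [Submodule.mem_orthogonal']
    intro u hu
    induction hu using Submodule.span_induction with
    | mem u hu => obtain ⟨k, rfl⟩ := hu; exact hy k
    | zero => simp
    | add a b _ _ ha hb => rw [inner_add_right, ha, hb, add_zero]
    | smul c a _ ha => rw [real_inner_smul_right, ha, mul_zero]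
  have hne : (⟨w, mem w hw⟩ : Sᗮ) ≠ 0 := by
    intro h
    have : w = 0 := congrArg Subtype.val h
    simp [this] at hw1
  obtain ⟨c, hc⟩ := (finrank_eq_one_iff_of_nonzero' _ hne).1 hperp ⟨v, mem v hv⟩
  have hc' : c • w = v := congrArg Subtype.val hc
  rw [← hc', real_inner_smul_left, real_inner_self_eq_norm_sq, hw1]
  simp

end Pointwise

/-! ### Regularity of the geometric quantities -/

section Regularity

variable {n : ℕ} {V : Type} [NormedAddCommGroup V] [InnerProductSpace ℝ V] {F : E n → V}
  {x : E n}

lemma contDiffAt_metric {p q : WithTop ℕ∞} (hF : ContDiffAt ℝ q F x) (hpq : p + 1 ≤ q)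
    (i j : Fin n) : ContDiffAt ℝ p (fun y => metric F y i j) x :=
  (hF.pd_of_le hpq i).inner ℝ (hF.pd_of_le hpq j)

lemma contDiffAt_det {p : WithTop ℕ∞} {A : E n → Matrix (Fin n) (Fin n) ℝ}
    (hA : ∀ i j, ContDiffAt ℝ p (fun y => A y i j) x) : ContDiffAt ℝ p (fun y => (A y).det) x := by
  simp only [Matrix.det_apply']
  exact ContDiffAt.sum fun σ _ => contDiffAt_const.mul (contDiffAt_prod fun i _ => hA _ _)

lemma contDiffAt_metricInv {p q : WithTop ℕ∞} (hF : ContDiffAt ℝ q F x) (hpq : p + 1 ≤ q)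
    (hx : (metric F x).det ≠ 0) (i j : Fin n) :
    ContDiffAt ℝ p (fun y => metricInv F y i j) x := by
  have hg := contDiffAt_metric hF hpq
  have h1 : (fun y => metricInv F y i j)
      = fun y => ((metric F y).det)⁻¹ * (metric F y).adjugate i j := by
    funext y
    simp [metricInv, Matrix.inv_def]
  rw [h1]
  refine ((contDiffAt_det hg).inv hx).mul ?_
  simp only [Matrix.adjugate_apply]
  refine contDiffAt_det fun a b => ?_
  by_cases h : a = j
  · subst h
    simpa [Matrix.updateRow_self] using contDiffAt_const
  · simpa [Matrix.updateRow_ne h] using hg a b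

lemma eventually_det_metric_ne_zero (hF : ContDiffAt ℝ 1 F x)
    (hx : (metric F x).det ≠ 0) : ∀ᶠ y in 𝓝 x, (metric F y).det ≠ 0 :=
  ((contDiffAt_det (contDiffAt_metric (p := 0) hF (by norm_num))).continuousAt).eventually_ne hx

lemma eventually_regular (hF : ContDiffAt ℝ 2 F x) (hx : (metric F x).det ≠ 0) :
    ∀ᶠ y in 𝓝 x, ContDiffAt ℝ 2 F y ∧ (metric F y).det ≠ 0 :=
  (hF.eventually (by simp)).and
    (eventually_det_metric_ne_zero (hF.of_le (by norm_num)) hx)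

lemma contDiffAt_metricInv_smooth (hF : ContDiffAt ℝ ∞ F x) (hx : (metric F x).det ≠ 0)
    (i j : Fin n) : ContDiffAt ℝ ∞ (fun y => metricInv F y i j) x :=
  contDiffAt_metricInv hF (by simp) hx i j

lemma contDiffAt_christoffel (hF : ContDiffAt ℝ ∞ F x) (hx : (metric F x).det ≠ 0)
    (i j k : Fin n) : ContDiffAt ℝ ∞ (fun y => christoffel (metric F) y i j k) x := by
  have hg : ∀ a b c : Fin n, ContDiffAt ℝ ∞ (pd a fun y => metric F y b c) x := fun a b c =>
    (contDiffAt_metric hF (by simp) b c).pd a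
  unfold christoffel
  exact contDiffAt_const.mul (ContDiffAt.sum fun l _ =>
    (contDiffAt_metricInv_smooth hF hx k l).mul (((hg _ _ _).add (hg _ _ _)).sub (hg _ _ _)))

lemma contDiffAt_sff (hF : ContDiffAt ℝ ∞ F x) (hx : (metric F x).det ≠ 0) (i j : Fin n) :
    ContDiffAt ℝ ∞ (fun y => sff F y i j) x := by
  unfold sff
  exact (((hF.pd j).pd i).sub (ContDiffAt.sum fun k _ =>
    (contDiffAt_christoffel hF hx i j k).smul (hF.pd k))).neg

lemma contDiffAt_weingarten (hF : ContDiffAt ℝ ∞ F x) (hx : (metric F x).det ≠ 0)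
    (i j : Fin n) : ContDiffAt ℝ ∞ (fun y => weingarten F y i j) x := by
  unfold weingarten
  exact ContDiffAt.sum fun l _ =>
    (contDiffAt_metricInv_smooth hF hx j l).smul (contDiffAt_sff hF hx i l)

lemma contDiffAt_meanCurv (hF : ContDiffAt ℝ ∞ F x) (hx : (metric F x).det ≠ 0) :
    ContDiffAt ℝ ∞ (meanCurv F) x := by
  unfold meanCurv
  exact ContDiffAt.sum fun i _ => contDiffAt_weingarten hF hx i i

lemma contDiffAt_nuPlus (hF : ContDiffAt ℝ ∞ F x) (hx : (metric F x).det ≠ 0)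
    (hH : meanCurv F x ≠ 0) : ContDiffAt ℝ ∞ (nuPlus F) x := by
  have h := contDiffAt_meanCurv hF hx
  exact ((h.norm ℝ hH).inv (norm_ne_zero_iff.2 hH)).smul h

lemma contDiffAt_normalProj (hF : ContDiffAt ℝ ∞ F x) (hx : (metric F x).det ≠ 0)
    {f : E n → V} (hf : ContDiffAt ℝ ∞ f x) :
    ContDiffAt ℝ ∞ (fun y => normalProj F y (f y)) x := by
  unfold normalProj
  exact hf.sub (ContDiffAt.sum fun i _ => ContDiffAt.sum fun j _ =>
    ((contDiffAt_metricInv_smooth hF hx i j).mul (hf.inner ℝ (hF.pd i))).smul (hF.pd j))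

lemma contDiffAt_hPlus (hF : ContDiffAt ℝ ∞ F x) (hx : (metric F x).det ≠ 0)
    (hH : meanCurv F x ≠ 0) (i j : Fin n) : ContDiffAt ℝ ∞ (fun y => hPlus F y i j) x :=
  (contDiffAt_sff hF hx i j).inner ℝ (contDiffAt_nuPlus hF hx hH)

lemma contDiffAt_hPlusMixed (hF : ContDiffAt ℝ ∞ F x) (hx : (metric F x).det ≠ 0)
    (hH : meanCurv F x ≠ 0) (i j : Fin n) : ContDiffAt ℝ ∞ (fun y => hPlusMixed F y i j) x := by
  unfold hPlusMixed
  exact ContDiffAt.sum fun l _ =>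
    (contDiffAt_metricInv_smooth hF hx _ _).mul (contDiffAt_hPlus hF hx hH _ _)

lemma eventually_meanCurv_ne_zero (hF : ContDiffAt ℝ ∞ F x) (hx : (metric F x).det ≠ 0)
    (hH : meanCurv F x ≠ 0) : ∀ᶠ y in 𝓝 x, meanCurv F y ≠ 0 :=
  (contDiffAt_meanCurv hF hx).continuousAt.eventually_ne hH

end Regularity

/-! ### Derivatives of normal fields -/

section NormalFields

variable {n : ℕ} {V : Type} [NormedAddCommGroup V] [InnerProductSpace ℝ V] {F : E n → V}
  {x : E n}

/-- Differentiate `⟨Y, ∂_lF⟩ = 0`, which must hold on a neighbourhood; the normal part of `∂_k∂_lF`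
is `-h_{kl}`. -/
lemma inner_pd_of_eventually_normal (hF : ContDiffAt ℝ 2 F x) {Y : E n → V}
    (hY : DifferentiableAt ℝ Y x)
    (hn : ∀ᶠ y in 𝓝 x, ∀ k, (inner ℝ (Y y) (pd k F y) : ℝ) = 0) (k l : Fin n) :
    (inner ℝ (pd k Y x) (pd l F x) : ℝ) = inner ℝ (Y x) (sff F x k l) := by
  have h0 : pd k (fun y => (inner ℝ (Y y) (pd l F y) : ℝ)) x = 0 := by
    rw [pd_congr (g := fun _ => 0) (hn.mono fun y hy => hy l), pd_const]
  rw [pd_inner hY (hF.diff_pd l), real_inner_comm (pd k (pd l F) x) (Y x),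
    inner_pd_pd_of_normal hF hn.self_of_nhds, real_inner_comm] at h0
  rw [real_inner_comm, real_inner_comm (sff F x k l) (Y x)]
  linarith

lemma pd_eq_normalProj_add (hF : ContDiffAt ℝ 2 F x) {Y : E n → V}
    (hY : DifferentiableAt ℝ Y x)
    (hn : ∀ᶠ y in 𝓝 x, ∀ k, (inner ℝ (Y y) (pd k F y) : ℝ) = 0) (k : Fin n) :
    pd k Y x = normalProj F x (pd k Y x)
      + ∑ i, ∑ j, (metricInv F x i j * inner ℝ (Y x) (sff F x k i)) • pd j F x := by
  simp only [normalProj, inner_pd_of_eventually_normal hF hY hn, sub_add_cancel]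

/-- Differentiate `g⁻¹ g = 1`, valid near the point since nondegeneracy is open, and multiply by
`g⁻¹` on the right. -/
lemma pd_metricInv (hF : ContDiffAt ℝ 2 F x) (hx : (metric F x).det ≠ 0) (j a b : Fin n) :
    pd j (fun y => metricInv F y a b) x
      = -∑ c, ∑ e, metricInv F x a c * pd j (fun y => metric F y c e) x * metricInv F x e b := by
  have hI : ∀ a b, DifferentiableAt ℝ (fun y => metricInv F y a b) x := fun a b =>
    (contDiffAt_metricInv (p := 1) hF (by norm_num) hx a b).differentiableAt (by simp)
  have hG : ∀ a b, DifferentiableAt ℝ (fun y => metric F y a b) x := fun a b =>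
    (contDiffAt_metric (p := 1) hF (by norm_num) a b).differentiableAt (by simp)
  have key : ∀ e, ∑ c, pd j (fun y => metricInv F y a c) x * metric F x c e
      = -∑ c, metricInv F x a c * pd j (fun y => metric F y c e) x := by
    intro e
    have h0 : pd j (fun y => ∑ c, metricInv F y a c * metric F y c e) x = 0 := by
      rw [pd_congr (g := fun _ => if a = e then 1 else 0), pd_const]
      filter_upwards [eventually_regular hF hx] with y hy
      exact sum_metricInv_mul_metric hy.2 a e
    rw [pd_sum (fun c => (hI a c).fun_mul (hG c e))] at h0
    simp only [pd_mul (hI a _) (hG _ e), Finset.sum_add_distrib] at h0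
    linarith
  calc pd j (fun y => metricInv F y a b) x
      = ∑ c, pd j (fun y => metricInv F y a c) x * ∑ e, metric F x c e * metricInv F x e b := by
        simp [sum_metric_mul_metricInv hx]
    _ = ∑ e, (∑ c, pd j (fun y => metricInv F y a c) x * metric F x c e) * metricInv F x e b := by
        simp only [Finset.mul_sum, Finset.sum_mul]
        rw [Finset.sum_comm]
        exact Finset.sum_congr rfl fun _ _ => Finset.sum_congr rfl fun _ _ => by ring
    _ = _ := by
        simp only [key]
        rw [Finset.sum_comm (s := Finset.univ) (t := Finset.univ), ← Finset.sum_neg_distrib]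
        exact Finset.sum_congr rfl fun _ _ => by rw [neg_mul, Finset.sum_mul]

/-- This is `∇g⁻¹ = 0` in coordinates, in the form that cancels against the Christoffel terms of
`∇h`. -/
lemma pd_metricInv_eq_christoffel (hF : ContDiffAt ℝ 2 F x) (hx : (metric F x).det ≠ 0)
    (j a b : Fin n) :
    pd j (fun y => metricInv F y a b) x
      = -(∑ c, metricInv F x a c * christoffel (metric F) x j c b)
        - ∑ c, metricInv F x b c * christoffel (metric F) x j c a := by
  rw [pd_metricInv hF hx]
  simp only [pd_metric hF, christoffel_metric hF, Finset.mul_sum, mul_add, add_mul,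
    Finset.sum_add_distrib, neg_add, sub_eq_add_neg]
  congr 2
  · exact Finset.sum_congr rfl fun c _ => Finset.sum_congr rfl fun e _ => by
      rw [metricInv_symm F x e b]; ring
  · rw [Finset.sum_comm]
    exact Finset.sum_congr rfl fun c _ => Finset.sum_congr rfl fun e _ => by
      rw [metricInv_symm F x c b, real_inner_comm]; ring

lemma nablaSff_one (j a b : Fin n) :
    nablaSff F 1 x ![j, a, b] = normalProj F x (pd j (fun y => sff F y a b) x)
      - ((∑ k, christoffel (metric F) x j a k • sff F x k b)
        + ∑ k, christoffel (metric F) x j b k • sff F x a k) := by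
  have h : nablaSff F 1 x ![j, a, b] = normalProj F x (pd j (fun y => sff F y a b) x)
      - ∑ c : Fin 2, ∑ k, christoffel (metric F) x j ((![a, b] : Fin 2 → Fin n) c) k •
        sff F x (Function.update (![a, b] : Fin 2 → Fin n) c k 0)
          (Function.update (![a, b] : Fin 2 → Fin n) c k 1) := rfl
  rw [h, Fin.sum_univ_two]
  simp

lemma nablaSff_two (i j a b : Fin n) :
    nablaSff F 2 x ![i, j, a, b]
      = normalProj F x (pd i (fun y => nablaSff F 1 y ![j, a, b]) x)
      - ((∑ k, christoffel (metric F) x i j k • nablaSff F 1 x ![k, a, b])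
        + (∑ k, christoffel (metric F) x i a k • nablaSff F 1 x ![j, k, b])
        + ∑ k, christoffel (metric F) x i b k • nablaSff F 1 x ![j, a, k]) := by
  have h : nablaSff F 2 x ![i, j, a, b]
      = normalProj F x (pd i (fun y => nablaSff F 1 y ![j, a, b]) x)
      - ∑ c : Fin 3, ∑ k, christoffel (metric F) x i ((![j, a, b] : Fin 3 → Fin n) c) k •
        nablaSff F 1 x (Function.update (![j, a, b] : Fin 3 → Fin n) c k) := rfl
  rw [h, Fin.sum_univ_three]
  congr 3

lemma contDiffAt_nablaSff_one (hF : ContDiffAt ℝ ∞ F x) (hx : (metric F x).det ≠ 0)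
    (j a b : Fin n) : ContDiffAt ℝ ∞ (fun y => nablaSff F 1 y ![j, a, b]) x := by
  simp only [nablaSff_one]
  exact (contDiffAt_normalProj hF hx ((contDiffAt_sff hF hx a b).pd j)).sub
    ((ContDiffAt.sum fun k _ => (contDiffAt_christoffel hF hx _ _ _).smul
      (contDiffAt_sff hF hx _ _)).add (ContDiffAt.sum fun k _ =>
      (contDiffAt_christoffel hF hx _ _ _).smul (contDiffAt_sff hF hx _ _)))

lemma inner_nablaSff_one_pd (hF : ContDiffAt ℝ 2 F x) (hx : (metric F x).det ≠ 0)
    (j a b k : Fin n) : (inner ℝ (nablaSff F 1 x ![j, a, b]) (pd k F x) : ℝ) = 0 := by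
  simp [nablaSff_one, inner_sub_left, inner_add_left, sum_inner, real_inner_smul_left,
    inner_normalProj hx, inner_sff_pd hF hx]

/-- The normal derivative of the mean curvature is the trace of the derivative of `h`. -/
lemma normalProj_pd_meanCurv (hF : ContDiffAt ℝ 2 F x) (hx : (metric F x).det ≠ 0)
    (hh : ∀ a b, DifferentiableAt ℝ (fun y => sff F y a b) x) (j : Fin n) :
    normalProj F x (pd j (meanCurv F) x)
      = ∑ a, ∑ b, metricInv F x a b • nablaSff F 1 x ![j, a, b] := by
  have hI : ∀ a b, DifferentiableAt ℝ (fun y => metricInv F y a b) x := fun a b =>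
    (contDiffAt_metricInv (p := 1) hF (by norm_num) hx a b).differentiableAt (by simp)
  have h1 : pd j (meanCurv F) x = ∑ a, ∑ b, (metricInv F x a b • pd j (fun y => sff F y a b) x
      + pd j (fun y => metricInv F y a b) x • sff F x a b) := by
    unfold meanCurv weingarten
    rw [pd_sum (fun a => DifferentiableAt.fun_sum fun b _ => (hI a b).fun_smul (hh a b))]
    refine Finset.sum_congr rfl fun a _ => ?_
    rw [pd_sum (fun b => (hI a b).fun_smul (hh a b))]
    exact Finset.sum_congr rfl fun b _ => pd_smul (hI a b) (hh a b)
  have h2 : ∀ a b, normalProj F x (sff F x a b) = sff F x a b := fun a b =>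
    normalProj_of_forall_inner_eq_zero (inner_sff_pd hF hx a b)
  simp only [h1, normalProj_sum, normalProj_add, normalProj_smul, h2, nablaSff_one, smul_sub,
    smul_add, Finset.sum_add_distrib, Finset.sum_sub_distrib]
  rw [sub_eq_add_neg]
  congr 1
  -- The derivative of `g^{ab}` produces precisely the two Christoffel sums in the trace of `∇h`;
  -- what remains is relabelling of indices.
  simp only [pd_metricInv_eq_christoffel hF hx, sub_smul, neg_smul, Finset.sum_sub_distrib,
    Finset.sum_neg_distrib, Finset.sum_smul, Finset.smul_sum, smul_smul]
  rw [neg_add_rev, ← sub_eq_add_neg]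
  refine congrArg₂ (fun v w => -v - w) ?_ ?_
  · exact Finset.sum_congr rfl fun a _ => Finset.sum_comm
  · rw [Finset.sum_comm]
    calc _ = ∑ b, ∑ a, ∑ k, (metricInv F x b a * christoffel (metric F) x j a k) • sff F x k b :=
          Finset.sum_congr rfl fun b _ => Finset.sum_comm
      _ = _ := by
          rw [Finset.sum_comm]
          exact Finset.sum_congr rfl fun a _ => Finset.sum_congr rfl fun b _ =>
            Finset.sum_congr rfl fun k _ => by rw [metricInv_symm F x b a]

/-- The tangential part of the derivative of a normal field is read off from `h`; since `H = |H|
ν⁺`, only `h⁺` appears. -/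
lemma pd_meanCurv (hF : ContDiffAt ℝ 2 F x) (hx : (metric F x).det ≠ 0)
    (hH : DifferentiableAt ℝ (meanCurv F) x) (hH0 : meanCurv F x ≠ 0) (j : Fin n) :
    pd j (meanCurv F) x = normalProj F x (pd j (meanCurv F) x)
      + ‖meanCurv F x‖ • ∑ m, hPlusMixed F x j m • pd m F x := by
  conv_lhs => rw [pd_eq_normalProj_add hF hH
    ((eventually_regular hF hx).mono fun y hy => inner_meanCurv_pd hy.1 hy.2) j]
  congr 1
  rw [Finset.sum_comm, Finset.smul_sum]
  refine Finset.sum_congr rfl fun m _ => ?_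
  rw [← Finset.sum_smul, hPlusMixed, smul_smul, Finset.mul_sum]
  congr 1
  refine Finset.sum_congr rfl fun i _ => ?_
  rw [hPlus, metricInv_symm F x m i, real_inner_comm (sff F x j i)]
  conv_lhs => rw [← norm_smul_nuPlus hH0, real_inner_smul_right]
  ring

/-- The normal part of the derivative of `ν⁺`. -/
def nuDefect (F : E n → V) (j : Fin n) (x : E n) : V :=
  ‖meanCurv F x‖⁻¹ • (normalProj F x (pd j (meanCurv F) x)
    - (inner ℝ (normalProj F x (pd j (meanCurv F) x)) (nuPlus F x) : ℝ) • nuPlus F x)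

lemma inner_nuPlus_pd_nuPlus (hν : DifferentiableAt ℝ (nuPlus F) x)
    (hH0 : ∀ᶠ y in 𝓝 x, meanCurv F y ≠ 0) (j : Fin n) :
    (inner ℝ (nuPlus F x) (pd j (nuPlus F) x) : ℝ) = 0 := by
  have h0 : pd j (fun y => (inner ℝ (nuPlus F y) (nuPlus F y) : ℝ)) x = 0 := by
    rw [pd_congr (g := fun _ => 1), pd_const]
    filter_upwards [hH0] with y hy
    rw [real_inner_self_eq_norm_sq, norm_nuPlus hy, one_pow]
  rw [pd_inner hν hν, real_inner_comm] at h0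
  linarith

/-- Solve the product rule for `H = |H| ν⁺`: since `ν⁺` has constant length, `∂_jν⁺` is `|H|⁻¹`
times the part of `∂_jH` orthogonal to `ν⁺`. The factor `|H|` cancels in the tangential part. -/
lemma pd_nuPlus (hF : ContDiffAt ℝ 2 F x) (hx : (metric F x).det ≠ 0)
    (hH : DifferentiableAt ℝ (meanCurv F) x) (hH0 : meanCurv F x ≠ 0) (j : Fin n) :
    pd j (nuPlus F) x = ∑ m, hPlusMixed F x j m • pd m F x + nuDefect F j x := by
  have hne := hH.continuousAt.eventually_ne hH0
  have hN : DifferentiableAt ℝ (fun y => ‖meanCurv F y‖) x := hH.norm ℝ hH0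
  have hν : DifferentiableAt ℝ (nuPlus F) x := (hN.inv (norm_ne_zero_iff.2 hH0)).smul hH
  have hH1 : ‖meanCurv F x‖ ≠ 0 := norm_ne_zero_iff.2 hH0
  have h1 : pd j (meanCurv F) x = ‖meanCurv F x‖ • pd j (nuPlus F) x
      + pd j (fun y => ‖meanCurv F y‖) x • nuPlus F x := by
    rw [← pd_smul hN hν]
    exact pd_congr (hne.mono fun y hy => (norm_smul_nuPlus hy).symm)
  have h2 := pd_meanCurv hF hx hH hH0 j
  have h3 : (inner ℝ (pd j (meanCurv F) x) (nuPlus F x) : ℝ)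
      = pd j (fun y => ‖meanCurv F y‖) x := by
    rw [h1, inner_add_left, real_inner_smul_left, real_inner_smul_left, real_inner_comm,
      inner_nuPlus_pd_nuPlus hν hne, real_inner_self_eq_norm_sq, norm_nuPlus hH0]
    ring
  have h4 : pd j (nuPlus F) x = ‖meanCurv F x‖⁻¹ • (pd j (meanCurv F) x
      - (inner ℝ (pd j (meanCurv F) x) (nuPlus F x) : ℝ) • nuPlus F x) := by
    rw [h3, h1, add_sub_cancel_right, smul_smul, inv_mul_cancel₀ hH1, one_smul]
  rw [h4, nuDefect, inner_normalProj_of_normal (inner_nuPlus_pd hF hx)]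
  have h5 : ‖meanCurv F x‖⁻¹ • pd j (meanCurv F) x
      = ‖meanCurv F x‖⁻¹ • normalProj F x (pd j (meanCurv F) x)
        + ∑ m, hPlusMixed F x j m • pd m F x := by
    conv_lhs => rw [h2]
    rw [smul_add, smul_smul, inv_mul_cancel₀ hH1, one_smul]
  rw [smul_sub, smul_sub, h5]
  abel

lemma contDiffAt_nuDefect (hF : ContDiffAt ℝ ∞ F x) (hx : (metric F x).det ≠ 0)
    (hH : meanCurv F x ≠ 0) (j : Fin n) : ContDiffAt ℝ ∞ (nuDefect F j) x := by
  have h := contDiffAt_meanCurv hF hx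
  have hν := contDiffAt_nuPlus hF hx hH
  have hP := contDiffAt_normalProj hF hx (h.pd j)
  exact ((h.norm ℝ hH).inv (norm_ne_zero_iff.2 hH)).smul (hP.sub ((hP.inner ℝ hν).smul hν))

lemma eventually_pd_nuPlus (hF : ContDiffAt ℝ ∞ F x) (hx : (metric F x).det ≠ 0)
    (hH : meanCurv F x ≠ 0) (j : Fin n) : ∀ᶠ y in 𝓝 x,
      pd j (nuPlus F) y = ∑ m, hPlusMixed F y j m • pd m F y + nuDefect F j y := by
  filter_upwards [eventually_regular (hF.of_le (by norm_cast)) hx,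
    (contDiffAt_meanCurv hF hx).eventually_differentiableAt,
    eventually_meanCurv_ne_zero hF hx hH] with y h1 h2 h3
  exact pd_nuPlus h1.1 h1.2 h2 h3 j

lemma pd_pd_nuPlus (hF : ContDiffAt ℝ ∞ F x) (hx : (metric F x).det ≠ 0)
    (hH : meanCurv F x ≠ 0) (i j : Fin n) :
    pd i (pd j (nuPlus F)) x = ∑ m, (hPlusMixed F x j m • pd i (pd m F) x
      + pd i (fun y => hPlusMixed F y j m) x • pd m F x) + pd i (nuDefect F j) x := by
  have hm : ∀ m, DifferentiableAt ℝ (fun y => hPlusMixed F y j m) x := fun m =>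
    (contDiffAt_hPlusMixed hF hx hH j m).diff
  have hd : ∀ m, DifferentiableAt ℝ (fun y => hPlusMixed F y j m • pd m F y) x := fun m =>
    (hm m).fun_smul (hF.pd m).diff
  rw [pd_congr (eventually_pd_nuPlus hF hx hH j), pd_add
    (DifferentiableAt.fun_sum fun m _ => hd m) (contDiffAt_nuDefect hF hx hH j).diff, pd_sum hd]
  congr 1
  exact Finset.sum_congr rfl fun m _ => pd_smul (hm m) (hF.pd m).diff

/-- In codimension one `ν⁺` has no normal derivative. -/
lemma pd_nuDefect_of_finrank [FiniteDimensional ℝ V] (hV : Module.finrank ℝ V = n + 1)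
    (hF : ContDiffAt ℝ ∞ F x) (hx : (metric F x).det ≠ 0)
    (hH : meanCurv F x ≠ 0) (i j : Fin n) : pd i (nuDefect F j) x = 0 := by
  rw [pd_congr (g := fun _ => 0), pd_const]
  filter_upwards [eventually_regular (hF.of_le (by norm_cast)) hx,
    eventually_meanCurv_ne_zero hF hx hH] with y h1 h3
  rw [nuDefect, ← eq_inner_smul_of_finrank hV h1.2 (inner_normalProj h1.2 _)
    (inner_nuPlus_pd h1.1 h1.2) (norm_nuPlus h3), sub_self, smul_zero]

end NormalFields

/-! ### Products of bounded and small functions -/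

section BigO

variable {α : Type*} {l : Filter α} {W : Type*} [NormedAddCommGroup W] [InnerProductSpace ℝ W]
  {e a b : α → ℝ}

/-- The rules of this section bound a product by the product of the bounds of its factors; `hab`
then compares it with the target gauge, such as `ε` or `err`. -/
lemma O_smul_of_mul {c : α → ℝ} {f : α → W} (hc : c =O[l] a) (hf : f =O[l] b)
    (hab : (fun x => a x * b x) =O[l] e) : (fun x => c x • f x) =O[l] e :=
  (hc.smul hf).trans hab

lemma O_mul_of_mul {c f : α → ℝ} (hc : c =O[l] a) (hf : f =O[l] b)
    (hab : (fun x => a x * b x) =O[l] e) : (fun x => c x * f x) =O[l] e :=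
  (hc.mul hf).trans hab

lemma O_inner_of_mul {f g : α → W} (hf : f =O[l] a) (hg : g =O[l] b)
    (hab : (fun x => a x * b x) =O[l] e) : (fun x => (inner ℝ (f x) (g x) : ℝ)) =O[l] e :=
  ((isBigO_of_le l fun x => by
    rw [Real.norm_of_nonneg (by positivity : (0 : ℝ) ≤ ‖f x‖ * ‖g x‖)]
    exact norm_inner_le_norm _ _).trans (hf.norm_left.mul hg.norm_left)).trans hab

lemma O_one_mul : (fun x => (1 : ℝ) * e x) =O[l] e := by simpa using isBigO_refl e l

lemma O_mul_one : (fun x => e x * (1 : ℝ)) =O[l] e := by simpa using isBigO_refl e l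

lemma O_smul {c : α → ℝ} {f : α → W} (hc : c =O[l] fun _ => (1 : ℝ)) (hf : f =O[l] e) :
    (fun x => c x • f x) =O[l] e := O_smul_of_mul hc hf O_one_mul

lemma O_smul' {c : α → ℝ} {f : α → W} (hc : c =O[l] e) (hf : f =O[l] fun _ => (1 : ℝ)) :
    (fun x => c x • f x) =O[l] e := O_smul_of_mul hc hf O_mul_one

lemma O_mul {c f : α → ℝ} (hc : c =O[l] fun _ => (1 : ℝ)) (hf : f =O[l] e) :
    (fun x => c x * f x) =O[l] e := O_mul_of_mul hc hf O_one_mul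

lemma O_mul' {c f : α → ℝ} (hc : c =O[l] e) (hf : f =O[l] fun _ => (1 : ℝ)) :
    (fun x => c x * f x) =O[l] e := O_mul_of_mul hc hf O_mul_one

lemma O_inner {f g : α → W} (hf : f =O[l] fun _ => (1 : ℝ)) (hg : g =O[l] e) :
    (fun x => (inner ℝ (f x) (g x) : ℝ)) =O[l] e := O_inner_of_mul hf hg O_one_mul

lemma O_inner' {f g : α → W} (hf : f =O[l] e) (hg : g =O[l] fun _ => (1 : ℝ)) :
    (fun x => (inner ℝ (f x) (g x) : ℝ)) =O[l] e := O_inner_of_mul hf hg O_mul_one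

lemma O_sum {ι : Type*} {s : Finset ι} {W : Type*} [SeminormedAddCommGroup W] {f : ι → α → W}
    (h : ∀ i, f i =O[l] e) : (fun x => ∑ i ∈ s, f i x) =O[l] e :=
  IsBigO.fun_sum fun i _ => h i

lemma O_const {W : Type*} [SeminormedAddCommGroup W] (c : W) :
    (fun _ => c) =O[l] fun _ => (1 : ℝ) := isBigO_const_const c one_ne_zero l

lemma O_of_le {W : Type*} [SeminormedAddCommGroup W] {f : α → W} (C : ℝ)
    (h : ∀ x, ‖f x‖ ≤ C * |e x|) : f =O[l] e :=
  IsBigO.of_bound C (Eventually.of_forall h)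

end BigO

/-! ### Inverses of nearly diagonal matrices -/

section NearlyDiagonal

variable {n : ℕ}

/-- Each off-diagonal error is absorbed by `2|ξ_i ξ_j| ≤ ξ_i² + ξ_j²`; summing over all pairs costs
`nη`. -/
lemma quadratic_form_lower_bound {A : Matrix (Fin n) (Fin n) ℝ} {a : Fin n → ℝ} {c η : ℝ}
    (ha : ∀ i, c ≤ a i) (hA : ∀ i j, |A i j - if i = j then a i else 0| ≤ η) (ξ : Fin n → ℝ) :
    (c - n * η) * ∑ i, ξ i ^ 2 ≤ ∑ i, ∑ j, A i j * ξ i * ξ j := by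
  have h1 : ∀ i j, (if i = j then a i * ξ i ^ 2 else 0) - η * ((ξ i ^ 2 + ξ j ^ 2) / 2)
      ≤ A i j * ξ i * ξ j := by
    intro i j
    have h2 : |(A i j - if i = j then a i else 0) * (ξ i * ξ j)|
        ≤ η * ((ξ i ^ 2 + ξ j ^ 2) / 2) := by
      rw [abs_mul]
      refine mul_le_mul (hA i j) ?_ (abs_nonneg _) ((abs_nonneg _).trans (hA i j))
      rw [abs_le]
      constructor <;> nlinarith [sq_nonneg (ξ i + ξ j), sq_nonneg (ξ i - ξ j)]
    have h3 := (abs_le.1 h2).1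
    split_ifs at h3 ⊢ with h
    · subst h; nlinarith
    · nlinarith
  calc (c - n * η) * ∑ i, ξ i ^ 2
      ≤ ∑ i, a i * ξ i ^ 2 - η * (n * ∑ i, ξ i ^ 2) := by
        have : c * ∑ i, ξ i ^ 2 ≤ ∑ i, a i * ξ i ^ 2 := by
          rw [Finset.mul_sum]
          exact Finset.sum_le_sum fun i _ => mul_le_mul_of_nonneg_right (ha i) (sq_nonneg _)
        linarith
    _ = ∑ i, ∑ j, ((if i = j then a i * ξ i ^ 2 else 0) - η * ((ξ i ^ 2 + ξ j ^ 2) / 2)) := by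
        simp only [Finset.sum_sub_distrib, Finset.sum_ite_eq, Finset.mem_univ, if_true,
          ← Finset.mul_sum, ← Finset.sum_div, Finset.sum_add_distrib, Finset.sum_const,
          Finset.card_univ, Fintype.card_fin, nsmul_eq_mul]
        ring
    _ ≤ _ := Finset.sum_le_sum fun i _ => Finset.sum_le_sum fun j _ => h1 i j

lemma det_ne_zero_of_coercive {A : Matrix (Fin n) (Fin n) ℝ} {c : ℝ} (hc : 0 < c)
    (hA : ∀ ξ : Fin n → ℝ, c * ∑ i, ξ i ^ 2 ≤ ∑ i, ∑ j, A i j * ξ i * ξ j) : A.det ≠ 0 := by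
  intro h
  obtain ⟨ξ, hξ, h0⟩ := Matrix.exists_mulVec_eq_zero_iff.2 h
  have h1 : ∑ i, ∑ j, A i j * ξ i * ξ j = 0 := by
    calc _ = ∑ i, ξ i * (A.mulVec ξ) i := by
          refine Finset.sum_congr rfl fun i _ => ?_
          rw [Matrix.mulVec, dotProduct, Finset.mul_sum]
          exact Finset.sum_congr rfl fun j _ => by ring
      _ = 0 := by simp [h0]
  have h2 : ∑ i, ξ i ^ 2 ≤ 0 := by
    have := hA ξ
    rw [h1] at this
    by_contra h3
    push Not at h3
    nlinarith
  refine hξ (funext fun i => ?_)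
  have := (Finset.sum_eq_zero_iff_of_nonneg (fun i _ => sq_nonneg (ξ i))).1
    (le_antisymm h2 (Finset.sum_nonneg fun i _ => sq_nonneg (ξ i))) i (Finset.mem_univ i)
  simpa using this

/-- Test the form on the `j`-th column `ξ` of the inverse, where its value is `ξ_j`. From `c ξ_j² ≤
ξ_j` follows `ξ_j ≤ 1/c`, and then `c ξ_i² ≤ ξ_j` bounds every other entry. Symmetry plays no role.
-/
lemma abs_inv_le_of_coercive {A : Matrix (Fin n) (Fin n) ℝ} {c : ℝ} (hc : 0 < c)
    (hA : ∀ ξ : Fin n → ℝ, c * ∑ i, ξ i ^ 2 ≤ ∑ i, ∑ j, A i j * ξ i * ξ j) (i j : Fin n) :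
    |A⁻¹ i j| ≤ 1 / c := by
  have hdet := det_ne_zero_of_coercive hc hA
  set ξ : Fin n → ℝ := fun a => A⁻¹ a j with hξ
  have h1 : ∑ a, ∑ b, A a b * ξ a * ξ b = ξ j := by
    have h := Matrix.mul_nonsing_inv A (isUnit_iff_ne_zero.2 hdet)
    calc _ = ∑ a, ξ a * ∑ b, A a b * A⁻¹ b j := by
          refine Finset.sum_congr rfl fun a _ => ?_
          rw [Finset.mul_sum]
          exact Finset.sum_congr rfl fun b _ => by simp only [hξ]; ring
      _ = ∑ a, ξ a * (1 : Matrix (Fin n) (Fin n) ℝ) a j := by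
          simp only [← h, Matrix.mul_apply]
      _ = ξ j := by simp [Matrix.one_apply]
  have h2 := hA ξ
  rw [h1] at h2
  have h3 : ∀ a, ξ a ^ 2 ≤ ∑ a, ξ a ^ 2 := fun a =>
    Finset.single_le_sum (f := fun a => ξ a ^ 2) (fun a _ => sq_nonneg _) (Finset.mem_univ a)
  have hj : c * ξ j ^ 2 ≤ ξ j := (mul_le_mul_of_nonneg_left (h3 j) hc.le).trans h2
  have hi : c * ξ i ^ 2 ≤ ξ j := (mul_le_mul_of_nonneg_left (h3 i) hc.le).trans h2
  have hj0 : 0 ≤ ξ j := le_trans (by positivity) hj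
  have hj1 : c * ξ j ≤ 1 := by
    rcases hj0.eq_or_lt with h | h
    · rw [← h]; simp
    · nlinarith
  rw [show A⁻¹ i j = ξ i from rfl, le_div_iff₀ hc, mul_comm, ← abs_of_pos hc, ← abs_mul,
    ← abs_one, ← sq_le_sq]
  nlinarith

end NearlyDiagonal

/-! ### Normalized bending data -/

/-- A patch normalized to have mean radius one, which at `0` is `O(ε)`-close to the unit
cylinder, together with the function `v` by which it is bent. -/
structure BendData (d m : ℕ) (θ K : ℝ) where
  F : E (d + 1) → E (d + 1 + m)
  ε : ℝ
  v : ℝ → ℝ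
  axis : E (d + 1 + m)
  smooth : ContDiffAt ℝ ∞ F 0
  det_ne : (metric F 0).det ≠ 0
  metric_close : ∀ i j, |metric F 0 i j - if i = j then 1 else 0| ≤ K * |ε|
  deriv_metric : ∀ k i j, |pd k (fun y => metric F y i j) 0| ≤ K * |ε|
  norm_axis : ‖axis‖ = 1
  sff_close : ∀ i j, ‖sff F 0 i j - cylWeingarten i j • axis‖ ≤ K * |ε|
  nabla_one : ∀ I, ‖nablaSff F 1 0 I‖ ≤ K * |ε|
  nabla_two : m = 1 ∨ ∀ I, ‖nablaSff F 2 0 I‖ ≤ K * |ε|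
  v_smooth : ContDiffAt ℝ 2 v 0
  v_bound : |v 0| + |deriv v 0| ≤ θ

namespace BendData

variable {d m : ℕ} {θ K : ℝ}

/-- The filter on bending data along which `ε` tends to zero. -/
def lim (d m : ℕ) (θ K : ℝ) : Filter (BendData d m θ K) := comap BendData.ε (𝓝 0)

lemma tendsto_ε : Tendsto BendData.ε (lim d m θ K) (𝓝 0) := tendsto_comap

lemma O_ε : BendData.ε =O[lim d m θ K] fun _ => (1 : ℝ) := tendsto_ε.isBigO_one ℝ

lemma O_one_of_O_ε {W : Type*} [NormedAddCommGroup W] {f : BendData d m θ K → W}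
    (hf : f =O[lim d m θ K] BendData.ε) : f =O[lim d m θ K] fun _ => (1 : ℝ) := hf.trans O_ε

lemma smooth_two (D : BendData d m θ K) : ContDiffAt ℝ 2 D.F 0 := D.smooth.of_le (by norm_cast)

/-! ### The metric at the base point -/

lemma O_metric_sub (i j : Fin (d + 1)) :
    (fun D => metric D.F 0 i j - if i = j then 1 else 0) =O[lim d m θ K] BendData.ε :=
  O_of_le K fun D => D.metric_close i j

lemma O_metric (i j : Fin (d + 1)) :
    (fun D => metric D.F 0 i j) =O[lim d m θ K] fun _ => (1 : ℝ) := by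
  simpa using (O_one_of_O_ε (O_metric_sub i j)).add (O_const (if i = j then (1 : ℝ) else 0))

lemma O_pd_metric (k i j : Fin (d + 1)) :
    (fun D => pd k (fun y => metric D.F y i j) 0) =O[lim d m θ K] BendData.ε :=
  O_of_le K fun D => D.deriv_metric k i j

lemma O_pd (i : Fin (d + 1)) : (fun D => pd i D.F 0) =O[lim d m θ K] fun _ => (1 : ℝ) := by
  refine (isBigO_of_le (g := fun D => 1 + metric D.F 0 i i) _ fun D => ?_).trans
    ((O_const 1).add (O_metric i i))
  rw [metric_apply, real_inner_self_eq_norm_sq, Real.norm_of_nonneg (by positivity)]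
  nlinarith [sq_nonneg (‖pd i D.F 0‖ - 1)]

/-- For small `ε` the metric is coercive with constant `1/2`, which bounds the entries of its
inverse by `2`. -/
lemma O_metricInv (i j : Fin (d + 1)) :
    (fun D => metricInv D.F 0 i j) =O[lim d m θ K] fun _ => (1 : ℝ) := by
  have h : ∀ᶠ D in lim d m θ K, ((d + 1 : ℕ) : ℝ) * (K * |D.ε|) < 1 / 2 := by
    have : Tendsto (fun D => ((d + 1 : ℕ) : ℝ) * (K * |D.ε|)) (lim d m θ K) (𝓝 0) := by
      simpa using (tendsto_ε.abs.const_mul K).const_mul ((d + 1 : ℕ) : ℝ)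
    exact this.eventually_lt_const (by norm_num)
  refine IsBigO.of_bound 2 (h.mono fun D hD => ?_)
  rw [norm_one, mul_one, Real.norm_eq_abs, metricInv]
  have key := abs_inv_le_of_coercive (A := metric D.F 0) (c := 1 / 2) (by norm_num) (fun ξ => ?_)
    i j
  · norm_num at key ⊢; exact key
  · refine le_trans ?_ (quadratic_form_lower_bound (a := fun _ => 1) (c := 1)
      (fun _ => le_rfl) D.metric_close ξ)
    exact mul_le_mul_of_nonneg_right (by linarith) (Finset.sum_nonneg fun i _ => sq_nonneg _)

lemma O_metricInv_sub (i j : Fin (d + 1)) :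
    (fun D => metricInv D.F 0 i j - if i = j then 1 else 0) =O[lim d m θ K] BendData.ε := by
  have h : ∀ D : BendData d m θ K, metricInv D.F 0 i j - (if i = j then 1 else 0)
      = -∑ k, metricInv D.F 0 i k * (metric D.F 0 k j - if k = j then 1 else 0) := by
    intro D
    simp [mul_sub, Finset.sum_sub_distrib, sum_metricInv_mul_metric D.det_ne]
  simp only [h]
  exact (O_sum fun k => O_mul (O_metricInv i k) (O_metric_sub k j)).neg_left

lemma O_pd_metricInv (k i j : Fin (d + 1)) :
    (fun D => pd k (fun y => metricInv D.F y i j) 0) =O[lim d m θ K] BendData.ε := by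
  simp only [fun D : BendData d m θ K => pd_metricInv D.smooth_two D.det_ne k i j]
  exact (O_sum fun a => O_sum fun b =>
    O_mul' (O_mul (O_metricInv _ _) (O_pd_metric _ _ _)) (O_metricInv _ _)).neg_left

lemma O_christoffel (i j k : Fin (d + 1)) :
    (fun D => christoffel (metric D.F) 0 i j k) =O[lim d m θ K] BendData.ε := by
  unfold christoffel
  exact O_mul (O_const _) (O_sum fun l => O_mul (O_metricInv k l)
    (((O_pd_metric _ _ _).add (O_pd_metric _ _ _)).sub (O_pd_metric _ _ _)))

/-! ### The second fundamental form at the base point -/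

lemma O_axis : (fun D => D.axis) =O[lim d m θ K] fun _ => (1 : ℝ) :=
  O_of_le 1 fun D => by simp [D.norm_axis]

lemma O_sff_sub_axis (i j : Fin (d + 1)) :
    (fun D => sff D.F 0 i j - cylWeingarten i j • D.axis) =O[lim d m θ K] BendData.ε :=
  O_of_le K fun D => D.sff_close i j

lemma O_sff (i j : Fin (d + 1)) :
    (fun D => sff D.F 0 i j) =O[lim d m θ K] fun _ => (1 : ℝ) := by
  simpa using (O_one_of_O_ε (O_sff_sub_axis i j)).add
    (O_smul (O_const (cylWeingarten i j)) O_axis)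

lemma O_pd_pd_add_sff (i j : Fin (d + 1)) :
    (fun D => pd i (pd j D.F) 0 + sff D.F 0 i j) =O[lim d m θ K] BendData.ε := by
  simp only [sff, neg_sub, add_sub_cancel]
  exact O_sum fun k => O_smul' (O_christoffel i j k) (O_pd k)

lemma O_pd_pd (i j : Fin (d + 1)) :
    (fun D => pd i (pd j D.F) 0) =O[lim d m θ K] fun _ => (1 : ℝ) := by
  simpa using (O_one_of_O_ε (O_pd_pd_add_sff i j)).sub (O_sff i j)

/-- Second derivatives of the position are normal up to Christoffel terms, which are `O(ε)`. -/
lemma O_inner_pd_pd_pd (i j k : Fin (d + 1)) :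
    (fun D => (inner ℝ (pd i (pd j D.F) 0) (pd k D.F 0) : ℝ)) =O[lim d m θ K] BendData.ε := by
  have h : ∀ D : BendData d m θ K, (inner ℝ (pd i (pd j D.F) 0) (pd k D.F 0) : ℝ)
      = inner ℝ (pd i (pd j D.F) 0 + sff D.F 0 i j) (pd k D.F 0) := fun D => by
    rw [inner_add_left, inner_sff_pd D.smooth_two D.det_ne, add_zero]
  simp only [h]
  exact O_inner' (O_pd_pd_add_sff i j) (O_pd k)

/-- The trace of the Weingarten map of the unit cylinder is `d`. -/
lemma O_meanCurv_sub_axis :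
    (fun D => meanCurv D.F 0 - (d : ℝ) • D.axis) =O[lim d m θ K] BendData.ε := by
  have hd : ∑ i : Fin (d + 1), cylWeingarten i i = (d : ℝ) := by
    simp [cylWeingarten, dz, Finset.sum_sub_distrib]
  have h : ∀ D : BendData d m θ K, meanCurv D.F 0 - (d : ℝ) • D.axis
      = ∑ i, ((∑ l, (metricInv D.F 0 i l - if i = l then 1 else 0) • sff D.F 0 i l)
        + (sff D.F 0 i i - cylWeingarten i i • D.axis)) := by
    intro D
    simp only [meanCurv, weingarten, sub_smul, Finset.sum_sub_distrib, Finset.sum_add_distrib,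
      ite_smul, one_smul, zero_smul, Finset.sum_ite_eq, Finset.mem_univ, if_true,
      ← Finset.sum_smul, hd]
    abel
  simp only [h]
  exact O_sum fun i => (O_sum fun l => O_smul' (O_metricInv_sub i l) (O_sff i l)).add
    (O_sff_sub_axis i i)

lemma O_meanCurv : (fun D => meanCurv D.F 0) =O[lim d m θ K] fun _ => (1 : ℝ) := by
  simpa using (O_one_of_O_ε (O_meanCurv_sub_axis (d := d) (m := m) (θ := θ) (K := K))).add
    (O_smul (O_const (d : ℝ)) O_axis)

/-- The model value of `|H|` is `d ≥ 1`, so `ν⁺` is well defined for small `ε`. -/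
lemma eventually_norm_meanCurv (hd : 1 ≤ d) :
    ∀ᶠ D in lim d m θ K, 1 / 2 ≤ ‖meanCurv D.F 0‖ := by
  have h : Tendsto (fun D => ‖meanCurv D.F 0 - (d : ℝ) • D.axis‖) (lim d m θ K) (𝓝 0) := by
    simpa using (O_meanCurv_sub_axis.trans_tendsto tendsto_ε).norm
  filter_upwards [h.eventually_lt_const (show (0 : ℝ) < 1 / 2 by norm_num)] with D hD
  have h1 : ‖(d : ℝ) • D.axis‖ = d := by simp [norm_smul, D.norm_axis]
  have h2 := norm_sub_norm_le ((d : ℝ) • D.axis) (meanCurv D.F 0)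
  rw [norm_sub_rev] at h2
  have h3 : (1 : ℝ) ≤ d := by exact_mod_cast hd
  linarith

lemma eventually_meanCurv_ne (hd : 1 ≤ d) : ∀ᶠ D in lim d m θ K, meanCurv D.F 0 ≠ 0 :=
  (eventually_norm_meanCurv hd).mono fun D hD h => by
    rw [h, norm_zero] at hD; norm_num at hD

lemma O_inv_norm_meanCurv (hd : 1 ≤ d) :
    (fun D => ‖meanCurv D.F 0‖⁻¹) =O[lim d m θ K] fun _ => (1 : ℝ) := by
  refine IsBigO.of_bound 2 ((eventually_norm_meanCurv hd).mono fun D hD => ?_)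
  rw [norm_inv, norm_norm, norm_one, mul_one]
  exact inv_le_of_inv_le₀ (by norm_num) (by linarith)

/-- If `H = 0` the inverse norm is `0` by convention and `ν⁺ = 0`, so the bound by one holds for all
data. -/
lemma O_nuPlus : (fun D => nuPlus D.F 0) =O[lim d m θ K] fun _ => (1 : ℝ) := by
  refine O_of_le 1 fun D => ?_
  rw [abs_one, mul_one, nuPlus, norm_smul, norm_inv, norm_norm]
  exact inv_mul_le_one

lemma O_nuPlus_sub_axis (hd : 1 ≤ d) :
    (fun D => nuPlus D.F 0 - D.axis) =O[lim d m θ K] BendData.ε := by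
  have h1 : (fun D => (d : ℝ) - ‖meanCurv D.F 0‖) =O[lim d m θ K] BendData.ε := by
    refine (isBigO_of_le _ fun D => ?_).trans O_meanCurv_sub_axis
    have h1 : ‖(d : ℝ) • D.axis‖ = d := by simp [norm_smul, D.norm_axis]
    have := abs_norm_sub_norm_le ((d : ℝ) • D.axis) (meanCurv D.F 0)
    rwa [h1, norm_sub_rev] at this
  have h2 : (fun D => nuPlus D.F 0 - D.axis) =ᶠ[lim d m θ K] fun D =>
      ‖meanCurv D.F 0‖⁻¹ • ((meanCurv D.F 0 - (d : ℝ) • D.axis)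
        + ((d : ℝ) - ‖meanCurv D.F 0‖) • D.axis) := by
    filter_upwards [eventually_meanCurv_ne hd] with D hD
    rw [sub_smul, sub_add_sub_cancel, smul_sub, smul_smul,
      inv_mul_cancel₀ (norm_ne_zero_iff.2 hD), one_smul, nuPlus]
  exact h2.trans_isBigO (O_smul (O_inv_norm_meanCurv hd)
    (O_meanCurv_sub_axis.add (O_smul' h1 O_axis)))

lemma O_sff_sub (hd : 1 ≤ d) (i j : Fin (d + 1)) :
    (fun D => sff D.F 0 i j - cylWeingarten i j • nuPlus D.F 0) =O[lim d m θ K] BendData.ε := by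
  have h : ∀ D : BendData d m θ K, sff D.F 0 i j - cylWeingarten i j • nuPlus D.F 0
      = (sff D.F 0 i j - cylWeingarten i j • D.axis)
        - (cylWeingarten i j : ℝ) • (nuPlus D.F 0 - D.axis) := fun D => by
    rw [smul_sub]; abel
  simp only [h]
  exact (O_sff_sub_axis i j).sub (O_smul (O_const _) (O_nuPlus_sub_axis hd))

lemma O_hPlus_sub (hd : 1 ≤ d) (i j : Fin (d + 1)) :
    (fun D => hPlus D.F 0 i j - cylWeingarten i j) =O[lim d m θ K] BendData.ε := by
  have h : (fun D => hPlus D.F 0 i j - cylWeingarten i j) =ᶠ[lim d m θ K] fun D =>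
      inner ℝ (sff D.F 0 i j - (cylWeingarten i j : ℝ) • nuPlus D.F 0) (nuPlus D.F 0) := by
    filter_upwards [eventually_meanCurv_ne hd] with D hD
    rw [inner_sub_left, real_inner_smul_left, real_inner_self_eq_norm_sq, norm_nuPlus hD, hPlus]
    ring
  exact h.trans_isBigO (O_inner' (O_sff_sub hd i j) O_nuPlus)

lemma O_hPlus (i j : Fin (d + 1)) :
    (fun D => hPlus D.F 0 i j) =O[lim d m θ K] fun _ => (1 : ℝ) :=
  O_inner (O_sff i j) O_nuPlus

lemma O_hPlusMixed (i j : Fin (d + 1)) :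
    (fun D => hPlusMixed D.F 0 i j) =O[lim d m θ K] fun _ => (1 : ℝ) :=
  O_sum fun _ => O_mul (O_metricInv _ _) (O_hPlus _ _)

lemma O_hPlusUp (i j : Fin (d + 1)) :
    (fun D => hPlusUp D.F 0 i j) =O[lim d m θ K] fun _ => (1 : ℝ) :=
  O_sum fun _ => O_sum fun _ =>
    O_mul (O_mul (O_metricInv _ _) (O_metricInv _ _)) (O_hPlus _ _)

/-! ### Derivatives of the curvature at the base point -/

lemma O_nablaSff_one (I : Fin 3 → Fin (d + 1)) :
    (fun D => nablaSff D.F 1 0 I) =O[lim d m θ K] BendData.ε :=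
  O_of_le K fun D => D.nabla_one I

lemma O_normalProj_pd_sff (j a b : Fin (d + 1)) :
    (fun D => normalProj D.F 0 (pd j (fun y => sff D.F y a b) 0)) =O[lim d m θ K]
      BendData.ε := by
  have h : ∀ D : BendData d m θ K, normalProj D.F 0 (pd j (fun y => sff D.F y a b) 0)
      = nablaSff D.F 1 0 ![j, a, b]
        + ((∑ k, christoffel (metric D.F) 0 j a k • sff D.F 0 k b)
          + ∑ k, christoffel (metric D.F) 0 j b k • sff D.F 0 a k) := fun D => by
    rw [nablaSff_one, sub_add_cancel]
  simp only [h]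
  exact (O_nablaSff_one _).add ((O_sum fun k => O_smul' (O_christoffel _ _ _) (O_sff _ _)).add
    (O_sum fun k => O_smul' (O_christoffel _ _ _) (O_sff _ _)))

lemma differentiableAt_sff (D : BendData d m θ K) (a b : Fin (d + 1)) :
    DifferentiableAt ℝ (fun y => sff D.F y a b) 0 := (contDiffAt_sff D.smooth D.det_ne a b).diff

lemma O_normalProj_pd_meanCurv (j : Fin (d + 1)) :
    (fun D => normalProj D.F 0 (pd j (meanCurv D.F) 0)) =O[lim d m θ K] BendData.ε := by
  simp only [fun D : BendData d m θ K =>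
    normalProj_pd_meanCurv D.smooth_two D.det_ne D.differentiableAt_sff j]
  exact O_sum fun a => O_sum fun b => O_smul (O_metricInv a b) (O_nablaSff_one _)

/-- Only the normal part of `∂_jH` enters, and this is a trace of `∇h`. -/
lemma O_nuDefect (hd : 1 ≤ d) (j : Fin (d + 1)) :
    (fun D => nuDefect D.F j 0) =O[lim d m θ K] BendData.ε :=
  O_smul (O_inv_norm_meanCurv hd) ((O_normalProj_pd_meanCurv j).sub
    (O_smul' (O_inner' (O_normalProj_pd_meanCurv j) O_nuPlus) O_nuPlus))

lemma eventually_pd_nuPlus_eq (hd : 1 ≤ d) (i : Fin (d + 1)) : ∀ᶠ D in lim d m θ K,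
    pd i (nuPlus D.F) 0 = ∑ k, hPlusMixed D.F 0 i k • pd k D.F 0 + nuDefect D.F i 0 := by
  filter_upwards [eventually_meanCurv_ne hd] with D hD
  exact pd_nuPlus D.smooth_two D.det_ne (contDiffAt_meanCurv D.smooth D.det_ne).diff hD i

lemma O_pd_nuPlus_sub (hd : 1 ≤ d) (i : Fin (d + 1)) :
    (fun D => pd i (nuPlus D.F) 0 - ∑ k, hPlusMixed D.F 0 i k • pd k D.F 0)
      =O[lim d m θ K] BendData.ε := by
  have h : (fun D => pd i (nuPlus D.F) 0 - ∑ k, hPlusMixed D.F 0 i k • pd k D.F 0)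
      =ᶠ[lim d m θ K] fun D => nuDefect D.F i 0 := by
    filter_upwards [eventually_pd_nuPlus_eq hd i] with D hD
    rw [hD, add_sub_cancel_left]
  exact h.trans_isBigO (O_nuDefect hd i)

lemma O_pd_nuPlus (hd : 1 ≤ d) (i : Fin (d + 1)) :
    (fun D => pd i (nuPlus D.F) 0) =O[lim d m θ K] fun _ => (1 : ℝ) := by
  simpa using (O_one_of_O_ε (O_pd_nuPlus_sub hd i)).add
    (O_sum (s := Finset.univ) fun k => O_smul (O_hPlusMixed i k) (O_pd k))

/-- The large part of `∂_kν⁺` is tangential and so orthogonal to `h_{ij}`; only `nuDefect` and the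
normal part of `∂_kh_{ij}` contribute. -/
lemma O_pd_hPlus (hd : 1 ≤ d) (k i j : Fin (d + 1)) :
    (fun D => pd k (fun y => hPlus D.F y i j) 0) =O[lim d m θ K] BendData.ε := by
  have h : (fun D => pd k (fun y => hPlus D.F y i j) 0) =ᶠ[lim d m θ K] fun D =>
      inner ℝ (normalProj D.F 0 (pd k (fun y => sff D.F y i j) 0)) (nuPlus D.F 0)
        + inner ℝ (sff D.F 0 i j) (nuDefect D.F k 0) := by
    filter_upwards [eventually_meanCurv_ne hd, eventually_pd_nuPlus_eq hd k] with D hD h1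
    have h2 := inner_nuPlus_pd D.smooth_two D.det_ne
    unfold hPlus
    rw [pd_inner (D.differentiableAt_sff i j) (contDiffAt_nuPlus D.smooth D.det_ne hD).diff,
      inner_normalProj_of_normal h2, h1]
    simp [inner_add_right, inner_sum, real_inner_smul_right,
      inner_sff_pd D.smooth_two D.det_ne]
  exact h.trans_isBigO ((O_inner' (O_normalProj_pd_sff k i j) O_nuPlus).add
    (O_inner (O_sff i j) (O_nuDefect hd k)))

lemma O_pd_hPlusMixed (hd : 1 ≤ d) (k i j : Fin (d + 1)) :
    (fun D => pd k (fun y => hPlusMixed D.F y i j) 0) =O[lim d m θ K] BendData.ε := by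
  have h : (fun D => pd k (fun y => hPlusMixed D.F y i j) 0) =ᶠ[lim d m θ K] fun D =>
      ∑ l, (metricInv D.F 0 j l * pd k (fun y => hPlus D.F y i l) 0
        + pd k (fun y => metricInv D.F y j l) 0 * hPlus D.F 0 i l) := by
    filter_upwards [eventually_meanCurv_ne hd] with D hD
    have h1 := fun l => (contDiffAt_metricInv_smooth D.smooth D.det_ne j l).diff
    have h2 := fun l => (contDiffAt_hPlus D.smooth D.det_ne hD i l).diff
    unfold hPlusMixed
    rw [pd_sum fun l => (h1 l).fun_mul (h2 l)]
    exact Finset.sum_congr rfl fun l _ => pd_mul (h1 l) (h2 l)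
  exact h.trans_isBigO (O_sum fun l => (O_mul (O_metricInv _ _) (O_pd_hPlus hd _ _ _)).add
    (O_mul' (O_pd_metricInv _ _ _) (O_hPlus _ _)))

lemma O_pd_hPlusUp (hd : 1 ≤ d) (k i j : Fin (d + 1)) :
    (fun D => pd k (fun y => hPlusUp D.F y i j) 0) =O[lim d m θ K] BendData.ε := by
  have h : (fun D => pd k (fun y => hPlusUp D.F y i j) 0) =ᶠ[lim d m θ K] fun D =>
      ∑ p, ∑ q, ((metricInv D.F 0 i p * metricInv D.F 0 j q) * pd k (fun y => hPlus D.F y p q) 0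
        + (metricInv D.F 0 i p * pd k (fun y => metricInv D.F y j q) 0
          + pd k (fun y => metricInv D.F y i p) 0 * metricInv D.F 0 j q) * hPlus D.F 0 p q) := by
    filter_upwards [eventually_meanCurv_ne hd] with D hD
    have h1 := fun a b => (contDiffAt_metricInv_smooth D.smooth D.det_ne a b).diff
    have h2 := fun a b => (contDiffAt_hPlus D.smooth D.det_ne hD a b).diff
    unfold hPlusUp
    rw [pd_sum fun p => DifferentiableAt.fun_sum fun q _ =>
      ((h1 i p).fun_mul (h1 j q)).fun_mul (h2 p q)]
    refine Finset.sum_congr rfl fun p _ => ?_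
    rw [pd_sum fun q => ((h1 i p).fun_mul (h1 j q)).fun_mul (h2 p q)]
    refine Finset.sum_congr rfl fun q _ => ?_
    rw [pd_mul ((h1 i p).fun_mul (h1 j q)) (h2 p q), pd_mul (h1 i p) (h1 j q)]
  exact h.trans_isBigO (O_sum fun p => O_sum fun q =>
    (O_mul (O_mul (O_metricInv _ _) (O_metricInv _ _)) (O_pd_hPlus hd _ _ _)).add
      (O_mul' ((O_mul (O_metricInv _ _) (O_pd_metricInv _ _ _)).add
        (O_mul' (O_pd_metricInv _ _ _) (O_metricInv _ _))) (O_hPlus _ _)))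

/-! ### Second derivatives of the principal normal -/

/-- The normal part of the derivative is `∇²h` plus products of Christoffel symbols with `∇h`; its
tangential part is `∇h` paired with `h`, as for any normal field. -/
lemma O_pd_nablaSff_one (hm : m ≠ 1) (i j a b : Fin (d + 1)) :
    (fun D => pd i (fun y => nablaSff D.F 1 y ![j, a, b]) 0) =O[lim d m θ K] BendData.ε := by
  have h : ∀ D : BendData d m θ K, pd i (fun y => nablaSff D.F 1 y ![j, a, b]) 0
      = (nablaSff D.F 2 0 ![i, j, a, b]
        + ((∑ k, christoffel (metric D.F) 0 i j k • nablaSff D.F 1 0 ![k, a, b])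
        + (∑ k, christoffel (metric D.F) 0 i a k • nablaSff D.F 1 0 ![j, k, b])
        + ∑ k, christoffel (metric D.F) 0 i b k • nablaSff D.F 1 0 ![j, a, k]))
        + ∑ p, ∑ q, (metricInv D.F 0 p q *
          inner ℝ (nablaSff D.F 1 0 ![j, a, b]) (sff D.F 0 i p)) • pd q D.F 0 := by
    intro D
    rw [nablaSff_two, sub_add_cancel]
    exact pd_eq_normalProj_add D.smooth_two (contDiffAt_nablaSff_one D.smooth D.det_ne j a b).diff
      ((eventually_regular D.smooth_two D.det_ne).mono fun y hy =>
        inner_nablaSff_one_pd hy.1 hy.2 j a b) i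
  have h2 : (fun D => nablaSff D.F 2 0 ![i, j, a, b]) =O[lim d m θ K] BendData.ε :=
    O_of_le K fun D => (D.nabla_two.resolve_left hm) _
  simp only [h]
  have hΓ : ∀ (p q : Fin (d + 1)) (I : Fin (d + 1) → Fin 3 → Fin (d + 1)),
      (fun D => ∑ k, christoffel (metric D.F) 0 p q k • nablaSff D.F 1 0 (I k))
        =O[lim d m θ K] BendData.ε := fun p q I =>
    O_sum fun k => O_smul (O_one_of_O_ε (O_christoffel _ _ _)) (O_nablaSff_one _)
  exact (h2.add (((hΓ _ _ _).add (hΓ _ _ _)).add (hΓ _ _ _))).add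
    (O_sum fun p => O_sum fun q => O_smul' (O_mul (O_metricInv _ _)
      (O_inner' (O_nablaSff_one _) (O_sff _ _))) (O_pd q))

/-- Near the centre the projected field is the trace of `∇h`, so that trace can be differentiated
instead of the projection. -/
lemma O_pd_normalProj_pd_meanCurv (hm : m ≠ 1) (i j : Fin (d + 1)) :
    (fun D => pd i (fun y => normalProj D.F y (pd j (meanCurv D.F) y)) 0)
      =O[lim d m θ K] BendData.ε := by
  have h : ∀ D : BendData d m θ K, pd i (fun y => normalProj D.F y (pd j (meanCurv D.F) y)) 0
      = ∑ a, ∑ b, (metricInv D.F 0 a b • pd i (fun y => nablaSff D.F 1 y ![j, a, b]) 0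
        + pd i (fun y => metricInv D.F y a b) 0 • nablaSff D.F 1 0 ![j, a, b]) := by
    intro D
    have h1 := fun a b => (contDiffAt_metricInv_smooth D.smooth D.det_ne a b).diff
    have h2 := fun a b => (contDiffAt_nablaSff_one D.smooth D.det_ne j a b).diff
    have h3 : ∀ᶠ y in 𝓝 (0 : E (d + 1)), ∀ a b,
        DifferentiableAt ℝ (fun y => sff D.F y a b) y :=
      eventually_all.2 fun a => eventually_all.2 fun b =>
        (contDiffAt_sff D.smooth D.det_ne a b).eventually_differentiableAt
    rw [pd_congr (g := fun y => ∑ a, ∑ b, metricInv D.F y a b • nablaSff D.F 1 y ![j, a, b])]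
    · rw [pd_sum fun a => DifferentiableAt.fun_sum fun b _ => (h1 a b).fun_smul (h2 a b)]
      refine Finset.sum_congr rfl fun a _ => ?_
      rw [pd_sum fun b => (h1 a b).fun_smul (h2 a b)]
      exact Finset.sum_congr rfl fun b _ => pd_smul (h1 a b) (h2 a b)
    · filter_upwards [eventually_regular D.smooth_two D.det_ne, h3] with y hy hy3
      exact normalProj_pd_meanCurv hy.1 hy.2 hy3 j
  simp only [h]
  exact O_sum fun a => O_sum fun b => (O_smul (O_metricInv _ _) (O_pd_nablaSff_one hm _ _ _ _)).add
    (O_smul' (O_pd_metricInv _ _ _) (O_one_of_O_ε (O_nablaSff_one _)))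

lemma O_pd_meanCurv (hd : 1 ≤ d) (j : Fin (d + 1)) :
    (fun D => pd j (meanCurv D.F) 0) =O[lim d m θ K] fun _ => (1 : ℝ) := by
  have h : (fun D => pd j (meanCurv D.F) 0) =ᶠ[lim d m θ K] fun D =>
      normalProj D.F 0 (pd j (meanCurv D.F) 0)
        + ‖meanCurv D.F 0‖ • ∑ m, hPlusMixed D.F 0 j m • pd m D.F 0 := by
    filter_upwards [eventually_meanCurv_ne hd] with D hD
    exact pd_meanCurv D.smooth_two D.det_ne (contDiffAt_meanCurv D.smooth D.det_ne).diff hD j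
  exact h.trans_isBigO ((O_one_of_O_ε (O_normalProj_pd_meanCurv j)).add
    (O_smul O_meanCurv.norm_left (O_sum fun k => O_smul (O_hPlusMixed j k) (O_pd k))))

lemma O_pd_norm_meanCurv (hd : 1 ≤ d) (j : Fin (d + 1)) :
    (fun D => pd j (fun y => ‖meanCurv D.F y‖) 0) =O[lim d m θ K] fun _ => (1 : ℝ) := by
  have h : (fun D => pd j (fun y => ‖meanCurv D.F y‖) 0) =ᶠ[lim d m θ K] fun D =>
      inner ℝ (pd j (meanCurv D.F) 0) (nuPlus D.F 0)
        + inner ℝ (meanCurv D.F 0) (pd j (nuPlus D.F) 0) := by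
    filter_upwards [eventually_meanCurv_ne hd] with D hD
    rw [← pd_inner (contDiffAt_meanCurv D.smooth D.det_ne).diff
      (contDiffAt_nuPlus D.smooth D.det_ne hD).diff]
    refine pd_congr ((eventually_meanCurv_ne_zero D.smooth D.det_ne hD).mono fun y hy => ?_)
    have : ‖meanCurv D.F y‖ ≠ 0 := norm_ne_zero_iff.2 hy
    simp only [nuPlus, real_inner_smul_right, real_inner_self_eq_norm_sq]
    field_simp
  exact h.trans_isBigO ((O_inner (O_pd_meanCurv hd j) O_nuPlus).add
    (O_inner O_meanCurv (O_pd_nuPlus hd j)))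

/-- This is the only place where the codimension matters: for `m = 1` the derivative vanishes,
otherwise it is controlled by `∇²h`. -/
lemma O_pd_nuDefect (hd : 1 ≤ d) (i j : Fin (d + 1)) :
    (fun D => pd i (nuDefect D.F j) 0) =O[lim d m θ K] BendData.ε := by
  by_cases hm : m = 1
  · have h : (fun D => pd i (nuDefect D.F j) 0) =ᶠ[lim d m θ K] fun _ => 0 := by
      filter_upwards [eventually_meanCurv_ne hd] with D hD
      exact pd_nuDefect_of_finrank (by simp [hm]) D.smooth D.det_ne hD i j
    exact h.trans_isBigO (isBigO_zero _ _)
  · set Y : BendData d m θ K → E (d + 1) → E (d + 1 + m) := fun D y =>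
      normalProj D.F y (pd j (meanCurv D.F) y) with hY
    have h : (fun D => pd i (nuDefect D.F j) 0) =ᶠ[lim d m θ K] fun D =>
        ‖meanCurv D.F 0‖⁻¹ • ((pd i (Y D) 0
          - ((inner ℝ (Y D 0) (nuPlus D.F 0) : ℝ) • pd i (nuPlus D.F) 0
            + (inner ℝ (pd i (Y D) 0) (nuPlus D.F 0)
              + inner ℝ (Y D 0) (pd i (nuPlus D.F) 0) : ℝ) • nuPlus D.F 0))
          - pd i (fun y => ‖meanCurv D.F y‖) 0 • nuDefect D.F j 0) := by
      filter_upwards [eventually_meanCurv_ne hd] with D hD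
      have hH := contDiffAt_meanCurv D.smooth D.det_ne
      have hν := (contDiffAt_nuPlus D.smooth D.det_ne hD).diff
      have hYd : DifferentiableAt ℝ (Y D) 0 :=
        (contDiffAt_normalProj D.smooth D.det_ne (hH.pd j)).diff
      have hN : DifferentiableAt ℝ (fun y => ‖meanCurv D.F y‖) 0 := hH.diff.norm ℝ hD
      have hn : ‖meanCurv D.F 0‖ ≠ 0 := norm_ne_zero_iff.2 hD
      -- Differentiating the defect multiplied by `|H|` avoids the derivative of `|H|⁻¹`; the
      -- equation is then solved for the derivative of the defect.
      have h1 : pd i (fun y => ‖meanCurv D.F y‖ • nuDefect D.F j y) 0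
          = pd i (fun y => Y D y - (inner ℝ (Y D y) (nuPlus D.F y) : ℝ) • nuPlus D.F y) 0 := by
        refine pd_congr ((eventually_meanCurv_ne_zero D.smooth D.det_ne hD).mono fun y hy => ?_)
        simp only [nuDefect, hY]
        rw [smul_smul, mul_inv_cancel₀ (norm_ne_zero_iff.2 hy), one_smul]
      rw [pd_smul hN (contDiffAt_nuDefect D.smooth D.det_ne hD j).diff,
        pd_sub hYd ((hYd.inner ℝ hν).fun_smul hν), pd_smul (hYd.inner ℝ hν) hν,
        pd_inner hYd hν] at h1
      rw [← h1, add_sub_cancel_right, smul_smul, inv_mul_cancel₀ hn, one_smul]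
    have hY0 : (fun D => Y D 0) =O[lim d m θ K] BendData.ε := O_normalProj_pd_meanCurv j
    have hY1 : (fun D => pd i (Y D) 0) =O[lim d m θ K] BendData.ε :=
      O_pd_normalProj_pd_meanCurv hm i j
    exact h.trans_isBigO (O_smul (O_inv_norm_meanCurv hd) ((hY1.sub
      ((O_smul' (O_inner' hY0 O_nuPlus) (O_pd_nuPlus hd i)).add
        (O_smul' ((O_inner' hY1 O_nuPlus).add (O_inner' hY0 (O_pd_nuPlus hd i))) O_nuPlus))).sub
      (O_smul (O_pd_norm_meanCurv hd i) (O_nuDefect hd j))))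

/-- After differentiating the formula for `∂_jν⁺`, the terms with a derivative on `h⁺` or on the
defect are `O(ε)`. -/
lemma O_pd_pd_nuPlus_sub (hd : 1 ≤ d) (i j : Fin (d + 1)) :
    (fun D => pd i (pd j (nuPlus D.F)) 0 - ∑ k, hPlusMixed D.F 0 j k • pd i (pd k D.F) 0)
      =O[lim d m θ K] BendData.ε := by
  have h : (fun D => pd i (pd j (nuPlus D.F)) 0
      - ∑ k, hPlusMixed D.F 0 j k • pd i (pd k D.F) 0) =ᶠ[lim d m θ K] fun D =>
      ∑ k, pd i (fun y => hPlusMixed D.F y j k) 0 • pd k D.F 0 + pd i (nuDefect D.F j) 0 := by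
    filter_upwards [eventually_meanCurv_ne hd] with D hD
    rw [pd_pd_nuPlus D.smooth D.det_ne hD, Finset.sum_add_distrib]
    abel
  exact h.trans_isBigO ((O_sum fun k => O_smul' (O_pd_hPlusMixed hd _ _ _) (O_pd k)).add
    (O_pd_nuDefect hd i j))

lemma O_pd_pd_nuPlus (hd : 1 ≤ d) (i j : Fin (d + 1)) :
    (fun D => pd i (pd j (nuPlus D.F)) 0) =O[lim d m θ K] fun _ => (1 : ℝ) := by
  simpa using (O_one_of_O_ε (O_pd_pd_nuPlus_sub hd i j)).add
    (O_sum (s := Finset.univ) fun k => O_smul (O_hPlusMixed j k) (O_pd_pd i k))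

end BendData

/-! ### Perturbation of inverse matrices, axial functions, and mixed components of the curvature -/

lemma inv_apply_sub_inv_apply {n : ℕ} {A B : Matrix (Fin n) (Fin n) ℝ} (hA : A.det ≠ 0)
    (hB : B.det ≠ 0) (i j : Fin n) :
    A⁻¹ i j - B⁻¹ i j = -∑ a, ∑ b, A⁻¹ i a * (A a b - B a b) * B⁻¹ b j := by
  have h : A⁻¹ - B⁻¹ = -(A⁻¹ * (A - B) * B⁻¹) := by
    rw [mul_sub, Matrix.nonsing_inv_mul _ (isUnit_iff_ne_zero.2 hA), sub_mul, one_mul,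
      Matrix.mul_assoc, Matrix.mul_nonsing_inv _ (isUnit_iff_ne_zero.2 hB), mul_one, neg_sub]
  have h2 := congrFun (congrFun h i) j
  rw [Matrix.sub_apply] at h2
  rw [h2, Matrix.neg_apply, Matrix.mul_apply, Finset.sum_comm]
  simp only [Matrix.mul_apply, Finset.sum_mul, Matrix.sub_apply]

lemma pd_comp_apply_zero {d : ℕ} {f : ℝ → ℝ} {y : E (d + 1)} (hf : DifferentiableAt ℝ f (y 0))
    (i : Fin (d + 1)) : pd i (fun x : E (d + 1) => f (x 0)) y = dz i * deriv f (y 0) := by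
  have h1 : HasFDerivAt (fun x : E (d + 1) => x 0)
      (EuclideanSpace.proj 0 : E (d + 1) →L[ℝ] ℝ) y :=
    (EuclideanSpace.proj (𝕜 := ℝ) (0 : Fin (d + 1))).hasFDerivAt
  have h2 := hf.hasDerivAt.comp_hasFDerivAt y h1
  rw [pd, show (fun x : E (d + 1) => f (x 0)) = f ∘ fun x : E (d + 1) => x 0 from rfl, h2.fderiv]
  change deriv f (y 0) * (EuclideanSpace.single i (1 : ℝ) : E (d + 1)) 0 = _
  rw [mul_comm, dz]
  congr 1
  simp [eq_comm]

section MixedComponents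

variable {n : ℕ} {V : Type} [NormedAddCommGroup V] [InnerProductSpace ℝ V] {F : E n → V}
  {x : E n}

lemma sum_metricInv_mul_hPlusMixed (j k : Fin n) :
    ∑ l, metricInv F x j l * hPlusMixed F x l k = hPlusUp F x j k := by
  simp only [hPlusMixed, hPlusUp, Finset.mul_sum, mul_assoc]

lemma inner_weingarten_nuPlus (i j : Fin n) :
    (inner ℝ (weingarten F x i j) (nuPlus F x) : ℝ) = hPlusMixed F x i j := by
  simp [weingarten, sum_inner, real_inner_smul_left, hPlusMixed, hPlus]

lemma inner_weingarten_pd (hF : ContDiffAt ℝ 2 F x) (hx : (metric F x).det ≠ 0) (i j k : Fin n) :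
    (inner ℝ (weingarten F x i j) (pd k F x) : ℝ) = 0 := by
  simp [weingarten, sum_inner, real_inner_smul_left, inner_sff_pd hF hx]

/-- Written as the trace of the square of `W`, `|A|²` involves no metric, so its variation needs
only that of `W`. -/
lemma normSqA_eq (hF : ContDiffAt ℝ 2 F x) :
    normSqA F x = ∑ i, ∑ j, (inner ℝ (weingarten F x i j) (weingarten F x j i) : ℝ) := by
  have h : ∀ i j, (inner ℝ (weingarten F x i j) (weingarten F x j i) : ℝ)
      = ∑ l, ∑ k, metricInv F x j l * (metricInv F x i k * inner ℝ (sff F x i l) (sff F x j k)) :=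
    fun i j => by
      simp only [weingarten, sum_inner, inner_sum, real_inner_smul_left, real_inner_smul_right]
      rw [Finset.sum_comm]
      exact Finset.sum_congr rfl fun l _ => Finset.sum_congr rfl fun k _ => by ring
  simp only [h, normSqA]
  calc _ = ∑ i, ∑ j, ∑ l, ∑ k, metricInv F x i k * metricInv F x j l *
        (inner ℝ (sff F x i j) (sff F x k l) : ℝ) := by
        exact Finset.sum_congr rfl fun i _ => Finset.sum_congr rfl fun j _ => Finset.sum_comm
    _ = _ := by
        refine Finset.sum_congr rfl fun i _ => ?_
        rw [Finset.sum_comm]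
        refine Finset.sum_congr rfl fun j _ => Finset.sum_congr rfl fun l _ =>
          Finset.sum_congr rfl fun k _ => ?_
        rw [metricInv_symm F x l j, sff_symm hF k j]
        ring

/-- Moves the raised index from `h^{ij}` to `h⁺`, which links the form in the statement to the one
produced by the variation of `W`. -/
lemma sum_hPlusMixed_mul_inner_sffUp (hF : ContDiffAt ℝ 2 F x) :
    ∑ i, ∑ j, ∑ k, hPlusMixed F x j k * (inner ℝ (sff F x i k) (sffUp F x i j) : ℝ)
      = ∑ i, ∑ j, ∑ k, hPlusUp F x i k * (inner ℝ (weingarten F x i j) (sff F x j k) : ℝ) := by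
  have h1 : ∀ i j, sffUp F x i j = ∑ q, metricInv F x j q • weingarten F x q i := by
    intro i j
    simp only [sffUp, weingarten, Finset.smul_sum, smul_smul]
    rw [Finset.sum_comm]
    exact Finset.sum_congr rfl fun q _ => Finset.sum_congr rfl fun p _ => by
      rw [sff_symm hF p q, mul_comm]
  calc _ = ∑ i, ∑ j, ∑ k, ∑ q, metricInv F x q j * hPlusMixed F x j k *
        (inner ℝ (weingarten F x q i) (sff F x i k) : ℝ) := by
        refine Finset.sum_congr rfl fun i _ => Finset.sum_congr rfl fun j _ =>
          Finset.sum_congr rfl fun k _ => ?_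
        rw [h1, inner_sum, Finset.mul_sum]
        refine Finset.sum_congr rfl fun q _ => ?_
        rw [real_inner_smul_right, real_inner_comm, metricInv_symm F x q j]
        ring
    _ = ∑ i, ∑ q, ∑ k, ∑ j, metricInv F x q j * hPlusMixed F x j k *
        (inner ℝ (weingarten F x q i) (sff F x i k) : ℝ) := by
        refine Finset.sum_congr rfl fun i _ => ?_
        rw [Finset.sum_comm]
        calc _ = ∑ k, ∑ q, ∑ j, metricInv F x q j * hPlusMixed F x j k *
              (inner ℝ (weingarten F x q i) (sff F x i k) : ℝ) :=
              Finset.sum_congr rfl fun k _ => Finset.sum_comm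
          _ = _ := Finset.sum_comm
    _ = _ := by
        rw [Finset.sum_comm]
        refine Finset.sum_congr rfl fun q _ => Finset.sum_congr rfl fun i _ =>
          Finset.sum_congr rfl fun k _ => ?_
        rw [← Finset.sum_mul, sum_metricInv_mul_hPlusMixed]

end MixedComponents

/-! ### The bent patch and the size of the error -/

namespace BendData

variable {d m : ℕ} {θ K : ℝ}

/-- The bent patch. -/
def bent (D : BendData d m θ K) (x : E (d + 1)) : E (d + 1 + m) :=
  D.F x - D.v (x 0) • nuPlus D.F x

def v₀ (D : BendData d m θ K) : ℝ := D.v 0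
def v₁ (D : BendData d m θ K) : ℝ := deriv D.v 0
def v₂ (D : BendData d m θ K) : ℝ := deriv (deriv D.v) 0
def size₁ (D : BendData d m θ K) : ℝ := |D.v₀| + |D.v₁|
def size₂ (D : BendData d m θ K) : ℝ := |D.v₀| + |D.v₁| + |D.v₂|
-- Here `ε` is paired with `size₁` only: `v''` is not assumed bounded and must appear either exactly
-- or in a product of at most second order.
def err (D : BendData d m θ K) : ℝ := |D.ε| * D.size₁ + D.size₂ ^ 2

lemma size₁_nonneg (D : BendData d m θ K) : 0 ≤ D.size₁ := by unfold size₁; positivity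
lemma size₂_nonneg (D : BendData d m θ K) : 0 ≤ D.size₂ := by unfold size₂; positivity
lemma size₁_le_size₂ (D : BendData d m θ K) : D.size₁ ≤ D.size₂ := by
  unfold size₁ size₂; linarith [abs_nonneg D.v₂]

lemma O_v₀ : v₀ =O[lim d m θ K] size₁ := O_of_le 1 fun D => by
  rw [abs_of_nonneg D.size₁_nonneg, size₁, Real.norm_eq_abs]; linarith [abs_nonneg D.v₁]

lemma O_v₁ : v₁ =O[lim d m θ K] size₁ := O_of_le 1 fun D => by
  rw [abs_of_nonneg D.size₁_nonneg, size₁, Real.norm_eq_abs]; linarith [abs_nonneg D.v₀]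

lemma O_v₂ : v₂ =O[lim d m θ K] size₂ := O_of_le 1 fun D => by
  rw [abs_of_nonneg D.size₂_nonneg, size₂, Real.norm_eq_abs]
  linarith [abs_nonneg D.v₀, abs_nonneg D.v₁]

lemma O_size₁ : size₁ =O[lim d m θ K] size₂ := O_of_le 1 fun D => by
  rw [abs_of_nonneg D.size₂_nonneg, Real.norm_of_nonneg D.size₁_nonneg]
  linarith [D.size₁_le_size₂]

lemma O_size₁_one : size₁ =O[lim d m θ K] fun _ => (1 : ℝ) := O_of_le θ fun D => by
  rw [abs_one, mul_one, Real.norm_of_nonneg D.size₁_nonneg]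
  exact D.v_bound

lemma O_size₂_mul_size₂ : (fun D => D.size₂ * D.size₂) =O[lim d m θ K] err := O_of_le 1 fun D => by
  have h1 : 0 ≤ |D.ε| * D.size₁ := mul_nonneg (abs_nonneg _) D.size₁_nonneg
  rw [err, Real.norm_of_nonneg (mul_self_nonneg _), abs_of_nonneg (by positivity)]
  nlinarith

lemma O_size₂_mul_size₁ : (fun D => D.size₂ * D.size₁) =O[lim d m θ K] err :=
  ((isBigO_refl _ _).mul O_size₁).trans O_size₂_mul_size₂

lemma O_size₁_mul_size₂ : (fun D => D.size₁ * D.size₂) =O[lim d m θ K] err :=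
  (O_size₁.mul (isBigO_refl _ _)).trans O_size₂_mul_size₂

lemma O_size₁_mul_size₁ : (fun D => D.size₁ * D.size₁) =O[lim d m θ K] err :=
  (O_size₁.mul O_size₁).trans O_size₂_mul_size₂

lemma O_size₁_mul_ε : (fun D => D.size₁ * D.ε) =O[lim d m θ K] err := O_of_le 1 fun D => by
  have h1 : 0 ≤ |D.ε| * D.size₁ := mul_nonneg (abs_nonneg _) D.size₁_nonneg
  rw [err, norm_mul, Real.norm_of_nonneg D.size₁_nonneg, Real.norm_eq_abs,
    abs_of_nonneg (add_nonneg h1 (sq_nonneg D.size₂))]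
  nlinarith [sq_nonneg D.size₂]

/-! ### Two-jet of the bent patch -/

/-- `∂_i F - ∂_i F̃`. -/
def dev₁ (D : BendData d m θ K) (i : Fin (d + 1)) : E (d + 1 + m) :=
  D.v₀ • pd i (nuPlus D.F) 0 + (dz i * D.v₁) • nuPlus D.F 0

/-- `∂_i ∂_j F - ∂_i ∂_j F̃`. -/
def dev₂ (D : BendData d m θ K) (i j : Fin (d + 1)) : E (d + 1 + m) :=
  D.v₀ • pd i (pd j (nuPlus D.F)) 0 + (dz i * D.v₁) • pd j (nuPlus D.F) 0
    + (dz j * D.v₁) • pd i (nuPlus D.F) 0 + (dz i * dz j * D.v₂) • nuPlus D.F 0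

lemma contDiffAt_v_comp (D : BendData d m θ K) :
    ContDiffAt ℝ 2 (fun x : E (d + 1) => D.v (x 0)) 0 :=
  ContDiffAt.comp (0 : E (d + 1)) (g := D.v) (f := fun x : E (d + 1) => x 0)
    (by simpa using D.v_smooth)
    (EuclideanSpace.proj (𝕜 := ℝ) (0 : Fin (d + 1))).contDiff.contDiffAt

lemma contDiffAt_bent (D : BendData d m θ K) (hH : meanCurv D.F 0 ≠ 0) :
    ContDiffAt ℝ 2 D.bent 0 :=
  D.smooth_two.sub (D.contDiffAt_v_comp.smul
    ((contDiffAt_nuPlus D.smooth D.det_ne hH).of_le (by norm_cast)))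

/-- The formula is needed on a neighbourhood because it is differentiated once more in `pd_pd_bent`.
-/
lemma eventually_pd_bent (D : BendData d m θ K) (hH : meanCurv D.F 0 ≠ 0) (i : Fin (d + 1)) :
    ∀ᶠ y in 𝓝 (0 : E (d + 1)), pd i D.bent y
      = pd i D.F y - (D.v (y 0) • pd i (nuPlus D.F) y
        + (dz i * deriv D.v (y 0)) • nuPlus D.F y) := by
  have hv : ∀ᶠ y in 𝓝 (0 : E (d + 1)), DifferentiableAt ℝ D.v (y 0) := by
    have h1 : ∀ᶠ s in 𝓝 (0 : ℝ), DifferentiableAt ℝ D.v s :=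
      (D.v_smooth.eventually (by simp)).mono fun s hs => hs.differentiableAt (by simp)
    have h2 : Tendsto (fun y : E (d + 1) => y 0) (𝓝 0) (𝓝 0) := by
      have := (EuclideanSpace.proj (𝕜 := ℝ) (0 : Fin (d + 1))).continuous.tendsto 0
      simpa using this
    exact h2.eventually h1
  filter_upwards [hv, D.smooth.eventually_differentiableAt,
    (contDiffAt_nuPlus D.smooth D.det_ne hH).eventually_differentiableAt] with y h1 h2 h3
  have h4 : DifferentiableAt ℝ (fun x : E (d + 1) => D.v (x 0)) y :=
    DifferentiableAt.comp y (g := D.v) (f := fun x : E (d + 1) => x 0) h1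
      (EuclideanSpace.proj (𝕜 := ℝ) (0 : Fin (d + 1))).differentiableAt
  unfold bent
  rw [pd_sub h2 (h4.fun_smul h3), pd_smul h4 h3, pd_comp_apply_zero h1]

lemma pd_bent (D : BendData d m θ K) (hH : meanCurv D.F 0 ≠ 0) (i : Fin (d + 1)) :
    pd i D.bent 0 = pd i D.F 0 - D.dev₁ i := (D.eventually_pd_bent hH i).self_of_nhds

lemma pd_pd_bent (D : BendData d m θ K) (hH : meanCurv D.F 0 ≠ 0) (i j : Fin (d + 1)) :
    pd i (pd j D.bent) 0 = pd i (pd j D.F) 0 - D.dev₂ i j := by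
  have hv' : DifferentiableAt ℝ (deriv D.v) 0 :=
    ContDiffAt.differentiableAt (n := 1) ((D.v_smooth.fderiv_right (m := 1) (by norm_num)).clm_apply
      (contDiffAt_const (c := (1 : ℝ)))) (by simp)
  have hν := contDiffAt_nuPlus D.smooth D.det_ne hH
  have h0 : DifferentiableAt ℝ (fun y : E (d + 1) => D.v (y 0)) 0 :=
    D.contDiffAt_v_comp.differentiableAt (by simp)
  have h1 : DifferentiableAt ℝ (fun y : E (d + 1) => deriv D.v (y 0)) 0 :=
    DifferentiableAt.comp (0 : E (d + 1)) (g := deriv D.v) (f := fun x : E (d + 1) => x 0)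
      (by simpa using hv') (EuclideanSpace.proj (𝕜 := ℝ) (0 : Fin (d + 1))).differentiableAt
  rw [pd_congr (D.eventually_pd_bent hH j), pd_sub (D.smooth.pd j).diff
    ((h0.fun_smul (hν.pd j).diff).fun_add ((h1.const_mul (dz j)).fun_smul hν.diff)),
    pd_add (h0.fun_smul (hν.pd j).diff) ((h1.const_mul (dz j)).fun_smul hν.diff),
    pd_smul h0 (hν.pd j).diff, pd_smul (h1.const_mul (dz j)) hν.diff,
    pd_comp_apply_zero (by simpa using D.v_smooth.differentiableAt (by simp)),
    show (fun y : E (d + 1) => dz j * deriv D.v (y 0)) = fun y : E (d + 1) =>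
      dz j • deriv D.v (y 0) from rfl, pd_const_smul, pd_comp_apply_zero (by simpa using hv')]
  simp only [dev₂, v₀, v₁, v₂, smul_eq_mul, PiLp.zero_apply]
  rw [show dz j * (dz i * deriv (deriv D.v) 0) = dz i * dz j * deriv (deriv D.v) 0 by ring]
  abel

lemma O_dev₁ (hd : 1 ≤ d) (i : Fin (d + 1)) :
    (fun D => D.dev₁ i) =O[lim d m θ K] size₁ :=
  (O_smul' O_v₀ (O_pd_nuPlus hd i)).add (O_smul' (O_mul (O_const _) O_v₁) O_nuPlus)

lemma O_dev₂ (hd : 1 ≤ d) (i j : Fin (d + 1)) :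
    (fun D => D.dev₂ i j) =O[lim d m θ K] size₂ :=
  ((((O_smul' O_v₀ (O_pd_pd_nuPlus hd i j)).add
    (O_smul' (O_mul (O_const _) O_v₁) (O_pd_nuPlus hd j))).add
    (O_smul' (O_mul (O_const _) O_v₁) (O_pd_nuPlus hd i))).trans O_size₁).add
    (O_smul' (O_mul (O_const _) O_v₂) O_nuPlus)

lemma O_pd_bent (hd : 1 ≤ d) (i : Fin (d + 1)) :
    (fun D => pd i D.bent 0) =O[lim d m θ K] fun _ => (1 : ℝ) := by
  have h : (fun D => pd i D.bent 0) =ᶠ[lim d m θ K] fun D => pd i D.F 0 - D.dev₁ i :=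
    (eventually_meanCurv_ne hd).mono fun D hD => D.pd_bent hD i
  exact h.trans_isBigO ((O_pd i).sub ((O_dev₁ hd i).trans O_size₁_one))

/-! ### The metric of the bent patch -/

lemma inner_pd_nuPlus_pd (D : BendData d m θ K) (hH : meanCurv D.F 0 ≠ 0) (i j : Fin (d + 1)) :
    (inner ℝ (pd i (nuPlus D.F) 0) (pd j D.F 0) : ℝ) = hPlus D.F 0 i j := by
  rw [inner_pd_of_eventually_normal D.smooth_two (contDiffAt_nuPlus D.smooth D.det_ne hH).diff
    ((eventually_regular D.smooth_two D.det_ne).mono fun y hy => inner_nuPlus_pd hy.1 hy.2),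
    real_inner_comm, hPlus]

lemma inner_nuPlus_pd_nuPlus' (D : BendData d m θ K) (hH : meanCurv D.F 0 ≠ 0)
    (i : Fin (d + 1)) : (inner ℝ (nuPlus D.F 0) (pd i (nuPlus D.F) 0) : ℝ) = 0 :=
  inner_nuPlus_pd_nuPlus (contDiffAt_nuPlus D.smooth D.det_ne hH).diff
    (eventually_meanCurv_ne_zero D.smooth D.det_ne hH) i

/-- `ν⁺` is orthogonal to all `∂_iF` and all `∂_iν⁺`, so `v'` enters only quadratically, and
`⟨∂_iν⁺, ∂_jF⟩ = h⁺_{ij}` gives the linear term. -/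
lemma metric_bent (D : BendData d m θ K) (hH : meanCurv D.F 0 ≠ 0) (i j : Fin (d + 1)) :
    metric D.bent 0 i j = metric D.F 0 i j - 2 * D.v₀ * hPlus D.F 0 i j
      + (D.v₀ ^ 2 * inner ℝ (pd i (nuPlus D.F) 0) (pd j (nuPlus D.F) 0)
        + dz i * dz j * D.v₁ ^ 2) := by
  have e1 := D.inner_pd_nuPlus_pd hH i j
  have e2 := D.inner_pd_nuPlus_pd hH j i
  have e3 := inner_nuPlus_pd D.smooth_two D.det_ne i
  have e4 := inner_nuPlus_pd D.smooth_two D.det_ne j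
  have e5 := D.inner_nuPlus_pd_nuPlus' hH i
  have e6 := D.inner_nuPlus_pd_nuPlus' hH j
  have e7 : (inner ℝ (nuPlus D.F 0) (nuPlus D.F 0) : ℝ) = 1 := by
    rw [real_inner_self_eq_norm_sq, norm_nuPlus hH, one_pow]
  rw [hPlus_symm D.smooth_two] at e2
  rw [real_inner_comm] at e2 e3 e5
  rw [metric_apply, D.pd_bent hH, D.pd_bent hH, metric_apply]
  simp only [dev₁, inner_sub_left, inner_sub_right, inner_add_left, inner_add_right,
    real_inner_smul_left, real_inner_smul_right, e1, e2, e3, e4, e5, e6, e7]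
  ring

lemma O_hPlusMixed_sub (hd : 1 ≤ d) (i j : Fin (d + 1)) :
    (fun D => hPlusMixed D.F 0 i j - cylWeingarten i j) =O[lim d m θ K] BendData.ε := by
  have h : ∀ D : BendData d m θ K, hPlusMixed D.F 0 i j - cylWeingarten i j
      = ∑ l, (metricInv D.F 0 j l - if j = l then 1 else 0) * hPlus D.F 0 i l
        + (hPlus D.F 0 i j - cylWeingarten i j) := fun D => by
    simp [hPlusMixed, sub_mul, Finset.sum_sub_distrib]
  simp only [h]
  exact (O_sum fun l => O_mul' (O_metricInv_sub _ _) (O_hPlus _ _)).add (O_hPlus_sub hd i j)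

/-- The model Weingarten map is an orthogonal projection. -/
lemma sum_cylWeingarten_mul (i j : Fin (d + 1)) :
    ∑ k, (cylWeingarten i k : ℝ) * cylWeingarten j k = cylWeingarten i j := by
  have h1 : ∀ i k : Fin (d + 1), (cylWeingarten i k : ℝ)
      = if i = k then (if i = 0 then 0 else 1) else 0 := by
    intro i k
    by_cases hi : i = 0 <;> by_cases hk : k = 0 <;> by_cases hik : i = k <;>
      simp_all [cylWeingarten, dz]
  simp only [h1]
  by_cases hi : i = 0 <;> by_cases hij : j = i <;> simp_all [eq_comm]

lemma O_inner_pd_nuPlus_sub (hd : 1 ≤ d) (i j : Fin (d + 1)) :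
    (fun D => (inner ℝ (pd i (nuPlus D.F) 0) (pd j (nuPlus D.F) 0) : ℝ) - cylWeingarten i j)
      =O[lim d m θ K] BendData.ε := by
  have h : (fun D => (inner ℝ (pd i (nuPlus D.F) 0) (pd j (nuPlus D.F) 0) : ℝ)
      - cylWeingarten i j) =ᶠ[lim d m θ K] fun D =>
      inner ℝ (pd i (nuPlus D.F) 0 - ∑ k, hPlusMixed D.F 0 i k • pd k D.F 0)
        (pd j (nuPlus D.F) 0)
      + ∑ k, ((hPlusMixed D.F 0 i k - cylWeingarten i k) * hPlus D.F 0 j k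
        + cylWeingarten i k * (hPlus D.F 0 j k - cylWeingarten j k)) := by
    filter_upwards [eventually_meanCurv_ne hd] with D hD
    have h1 : ∀ k, (inner ℝ (pd k D.F 0) (pd j (nuPlus D.F) 0) : ℝ) = hPlus D.F 0 j k := fun k =>
      by rw [real_inner_comm, D.inner_pd_nuPlus_pd hD]
    simp only [inner_sub_left, sum_inner, real_inner_smul_left, h1, sub_mul, mul_sub,
      Finset.sum_add_distrib, Finset.sum_sub_distrib, sum_cylWeingarten_mul]
    ring
  exact h.trans_isBigO ((O_inner' (O_pd_nuPlus_sub hd i) (O_pd_nuPlus hd j)).add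
    (O_sum fun k => (O_mul' (O_hPlusMixed_sub hd i k) (O_hPlus j k)).add
      (O_mul (O_const _) (O_hPlus_sub hd j k))))

/-- The diagonal matrix is the metric obtained by bending the exact unit cylinder: axial length `1 +
v'²`, and spheres of radius `|1 - v|`. -/
lemma O_metric_bent_sub_diag (hd : 1 ≤ d) (i j : Fin (d + 1)) :
    (fun D => metric D.bent 0 i j
      - if i = j then (if i = 0 then 1 + D.v₁ ^ 2 else (1 - D.v₀) ^ 2) else 0)
      =O[lim d m θ K] BendData.ε := by
  have hv : v₀ =O[lim d m θ K] fun _ => (1 : ℝ) := O_v₀.trans O_size₁_one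
  have h : (fun D => metric D.bent 0 i j
      - if i = j then (if i = 0 then 1 + D.v₁ ^ 2 else (1 - D.v₀) ^ 2) else 0)
      =ᶠ[lim d m θ K] fun D => ((metric D.F 0 i j - if i = j then 1 else 0)
        - 2 * D.v₀ * (hPlus D.F 0 i j - cylWeingarten i j))
        + D.v₀ * (D.v₀ * ((inner ℝ (pd i (nuPlus D.F) 0) (pd j (nuPlus D.F) 0) : ℝ)
          - cylWeingarten i j)) := by
    filter_upwards [eventually_meanCurv_ne hd] with D hD
    rw [D.metric_bent hD]
    by_cases hi : i = 0 <;> by_cases hj : j = 0 <;> by_cases hij : i = j <;>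
      simp_all [cylWeingarten, dz] <;> ring
  exact h.trans_isBigO (((O_metric_sub i j).sub (O_mul (O_mul (O_const _) hv)
    (O_hPlus_sub hd i j))).add (O_mul hv (O_mul hv (O_inner_pd_nuPlus_sub hd i j))))

lemma exists_coercive_metric_bent (hd : 1 ≤ d) (hθ : θ < 1) : ∃ c : ℝ, 0 < c ∧
    ∀ᶠ D in lim d m θ K, ∀ ξ : Fin (d + 1) → ℝ,
      c * ∑ i, ξ i ^ 2 ≤ ∑ i, ∑ j, metric D.bent 0 i j * ξ i * ξ j := by
  set c : ℝ := (1 - θ) ^ 2 with hc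
  have hc0 : 0 < c := by have : 0 < 1 - θ := by linarith
                         positivity
  refine ⟨c / 2, by positivity, ?_⟩
  -- With this tolerance all `(d+1)²` entry errors together cost `(d+1)η = c/2`.
  set η : ℝ := c / (2 * ((d + 1 : ℕ) : ℝ)) with hη
  have hη0 : 0 < η := by positivity
  have h : ∀ᶠ D in lim d m θ K, ∀ i j, |metric D.bent 0 i j
      - if i = j then (if i = 0 then 1 + D.v₁ ^ 2 else (1 - D.v₀) ^ 2) else 0| ≤ η := by
    refine eventually_all.2 fun i => eventually_all.2 fun j => ?_
    have := ((O_metric_bent_sub_diag (m := m) (θ := θ) (K := K) hd i j).trans_tendsto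
      tendsto_ε).abs
    rw [abs_zero] at this
    exact this.eventually_le_const hη0
  filter_upwards [h] with D hD ξ
  have hb := D.v_bound
  have key := quadratic_form_lower_bound
    (a := fun i => if i = 0 then 1 + D.v₁ ^ 2 else (1 - D.v₀) ^ 2) (c := c) (fun i => ?_) hD ξ
  · have : c - ((d + 1 : ℕ) : ℝ) * η = c / 2 := by
      rw [hη]; field_simp; ring
    rwa [this] at key
  · have h0 := abs_nonneg (D.v 0)
    have h1 := abs_nonneg (deriv D.v 0)
    have h2 := le_abs_self (D.v 0)
    by_cases hi : i = 0
    -- `v_bound` forces `θ ≥ 0`, so `(1-θ)² ≤ 1` and the axial entry is large enough.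
    · simp only [hi, if_true, hc]; nlinarith [sq_nonneg D.v₁]
    · simp only [hi, if_false, hc, v₀]; nlinarith

lemma eventually_det_bent (hd : 1 ≤ d) (hθ : θ < 1) :
    ∀ᶠ D in lim d m θ K, (metric D.bent 0).det ≠ 0 := by
  obtain ⟨c, hc, h⟩ := exists_coercive_metric_bent (m := m) (K := K) hd hθ
  exact h.mono fun D hD => det_ne_zero_of_coercive hc hD

lemma O_metricInv_bent (hd : 1 ≤ d) (hθ : θ < 1) (i j : Fin (d + 1)) :
    (fun D => metricInv D.bent 0 i j) =O[lim d m θ K] fun _ => (1 : ℝ) := by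
  obtain ⟨c, hc, h⟩ := exists_coercive_metric_bent (m := m) (K := K) hd hθ
  refine IsBigO.of_bound (1 / c) (h.mono fun D hD => ?_)
  rw [norm_one, mul_one]
  exact abs_inv_le_of_coercive hc hD i j

lemma O_metric_quadratic (hd : 1 ≤ d) (i j : Fin (d + 1)) :
    (fun D => D.v₀ ^ 2 * (inner ℝ (pd i (nuPlus D.F) 0) (pd j (nuPlus D.F) 0) : ℝ)
        + dz i * dz j * D.v₁ ^ 2) =O[lim d m θ K] fun D => D.size₁ * D.size₁ := by
  simp only [sq]
  exact (O_mul' (O_v₀.mul O_v₀) (O_inner (O_pd_nuPlus hd i) (O_pd_nuPlus hd j))).add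
    (O_mul (O_const _) (O_v₁.mul O_v₁))

lemma O_size₁_mul_size₁' : (fun D => D.size₁ * D.size₁) =O[lim d m θ K] size₁ :=
  O_mul' (isBigO_refl _ _) O_size₁_one

lemma O_metric_bent_sub (hd : 1 ≤ d) (i j : Fin (d + 1)) :
    (fun D => metric D.bent 0 i j - metric D.F 0 i j) =O[lim d m θ K] size₁ := by
  have h : (fun D => metric D.bent 0 i j - metric D.F 0 i j) =ᶠ[lim d m θ K] fun D =>
      (D.v₀ ^ 2 * (inner ℝ (pd i (nuPlus D.F) 0) (pd j (nuPlus D.F) 0) : ℝ)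
        + dz i * dz j * D.v₁ ^ 2) - 2 * D.v₀ * hPlus D.F 0 i j := by
    filter_upwards [eventually_meanCurv_ne hd] with D hD
    rw [D.metric_bent hD]; ring
  exact h.trans_isBigO (((O_metric_quadratic hd i j).trans O_size₁_mul_size₁').sub
    (O_mul' (O_mul (O_const _) O_v₀) (O_hPlus i j)))

/-- The exact resolvent identity replaces a Neumann series, which would require `v` to be small. -/
lemma eventually_metricInv_bent_sub (hd : 1 ≤ d) (hθ : θ < 1) (i j : Fin (d + 1)) :
    ∀ᶠ D in lim d m θ K, metricInv D.bent 0 i j - metricInv D.F 0 i j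
      = -∑ a, ∑ b, metricInv D.bent 0 i a * (metric D.bent 0 a b - metric D.F 0 a b)
          * metricInv D.F 0 b j :=
  (eventually_det_bent hd hθ).mono fun D hD => inv_apply_sub_inv_apply hD D.det_ne i j

lemma O_metricInv_bent_sub (hd : 1 ≤ d) (hθ : θ < 1) (i j : Fin (d + 1)) :
    (fun D => metricInv D.bent 0 i j - metricInv D.F 0 i j) =O[lim d m θ K] size₁ :=
  EventuallyEq.trans_isBigO (eventually_metricInv_bent_sub hd hθ i j)
    (O_sum fun _ => O_sum fun _ => O_mul' (O_mul (O_metricInv_bent hd hθ _ _)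
      (O_metric_bent_sub hd _ _)) (O_metricInv _ _)).neg_left

/-- Insert `g̃ - g = -2v h⁺ + O(size₁²)` into the resolvent identity. Replacing the remaining `g̃⁻¹`
by `g⁻¹` in the linear term costs another factor `size₁`. -/
lemma O_metricInv_bent_sub_sub (hd : 1 ≤ d) (hθ : θ < 1) (i j : Fin (d + 1)) :
    (fun D => metricInv D.bent 0 i j - metricInv D.F 0 i j - 2 * D.v₀ * hPlusUp D.F 0 i j)
      =O[lim d m θ K] err := by
  have h : (fun D => metricInv D.bent 0 i j - metricInv D.F 0 i j
      - 2 * D.v₀ * hPlusUp D.F 0 i j) =ᶠ[lim d m θ K] fun D =>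
      ∑ a, ∑ b, (((metricInv D.bent 0 i a - metricInv D.F 0 i a) * (2 * D.v₀ * hPlus D.F 0 a b))
          * metricInv D.F 0 b j
        - (metricInv D.bent 0 i a *
          (D.v₀ ^ 2 * (inner ℝ (pd a (nuPlus D.F) 0) (pd b (nuPlus D.F) 0) : ℝ)
            + dz a * dz b * D.v₁ ^ 2)) * metricInv D.F 0 b j) := by
    filter_upwards [eventually_meanCurv_ne hd, eventually_metricInv_bent_sub hd hθ i j]
      with D hD h1
    rw [h1, hPlusUp]
    simp only [Finset.mul_sum, ← Finset.sum_neg_distrib, ← Finset.sum_sub_distrib]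
    refine Finset.sum_congr rfl fun a _ => Finset.sum_congr rfl fun b _ => ?_
    rw [D.metric_bent hD, metricInv_symm D.F 0 j b]
    ring
  refine h.trans_isBigO (O_sum fun _ => O_sum fun _ => IsBigO.sub (O_mul' ?_ (O_metricInv _ _))
    (O_mul' (O_mul (O_metricInv_bent hd hθ _ _)
      ((O_metric_quadratic hd _ _).trans O_size₁_mul_size₁)) (O_metricInv _ _)))
  exact O_mul_of_mul (O_metricInv_bent_sub hd hθ i _) (O_mul' (O_mul (O_const _) O_v₀)
    (O_hPlus _ _)) O_size₁_mul_size₁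

end BendData

namespace BendData

variable {d m : ℕ} {θ K : ℝ}

/-! ### First variation of the second fundamental form -/

/-- The first variation of `h_{ij}`, up to terms which are small for a neck. -/
def linSff (D : BendData d m θ K) (i j : Fin (d + 1)) : E (d + 1 + m) :=
  (dz i * dz j * D.v₂) • nuPlus D.F 0
    + D.v₀ • ∑ k, hPlusMixed D.F 0 j k • pd i (pd k D.F) 0
    + (dz j * D.v₁) • pd i (nuPlus D.F) 0
    + (dz i * D.v₁) • ∑ k, hPlusMixed D.F 0 j k • pd k D.F 0
    + D.v₀ • ∑ k, pd i (fun x => hPlusMixed D.F x j k) 0 • pd k D.F 0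
    - D.v₁ • ∑ k, (dz i * hPlusMixed D.F 0 j k + dz j * hPlusMixed D.F 0 i k
        - metricInv D.F 0 0 k * hPlus D.F 0 i j) • pd k D.F 0

/-- The first variation of `⟨∂_i∂_jF, ∂_kF⟩`, up to terms which are small for a neck. -/
def linProd (D : BendData d m θ K) (i j k : Fin (d + 1)) : ℝ :=
  D.v₁ * (dz k * hPlus D.F 0 i j - dz i * hPlus D.F 0 j k - dz j * hPlus D.F 0 i k)

lemma O_linProd (i j k : Fin (d + 1)) : (fun D => D.linProd i j k) =O[lim d m θ K] size₁ :=
  O_mul' O_v₁ (((O_mul (O_const _) (O_hPlus _ _)).sub (O_mul (O_const _) (O_hPlus _ _))).sub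
    (O_mul (O_const _) (O_hPlus _ _)))

/-- The `v'` terms of the expansion assemble to `linProd`, and the linear `v''` term vanishes since
`ν⁺` is normal. The two terms with `v` are small by the next lemmas. -/
lemma inner_bent_eq (D : BendData d m θ K) (hH : meanCurv D.F 0 ≠ 0) (i j k : Fin (d + 1)) :
    (inner ℝ (pd i (pd j D.bent) 0) (pd k D.bent 0) : ℝ)
      = inner ℝ (pd i (pd j D.F) 0) (pd k D.F 0) + D.linProd i j k
        - D.v₀ * inner ℝ (pd i (pd j D.F) 0) (pd k (nuPlus D.F) 0)
        - D.v₀ * inner ℝ (pd i (pd j (nuPlus D.F)) 0) (pd k D.F 0)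
        + inner ℝ (D.dev₂ i j) (D.dev₁ k) := by
  have e1 := D.inner_pd_nuPlus_pd hH i k
  have e2 := D.inner_pd_nuPlus_pd hH j k
  have e3 := inner_nuPlus_pd D.smooth_two D.det_ne k
  have e4 : (inner ℝ (pd i (pd j D.F) 0) (nuPlus D.F 0) : ℝ) = -hPlus D.F 0 i j :=
    inner_pd_pd_of_normal D.smooth_two (inner_nuPlus_pd D.smooth_two D.det_ne) i j
  have h1 : (inner ℝ (pd i (pd j D.F) 0) (D.dev₁ k) : ℝ)
      = D.v₀ * inner ℝ (pd i (pd j D.F) 0) (pd k (nuPlus D.F) 0)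
        - dz k * D.v₁ * hPlus D.F 0 i j := by
    rw [dev₁, inner_add_right, real_inner_smul_right, real_inner_smul_right, e4]; ring
  have h2 : (inner ℝ (D.dev₂ i j) (pd k D.F 0) : ℝ)
      = D.v₀ * inner ℝ (pd i (pd j (nuPlus D.F)) 0) (pd k D.F 0)
        + dz i * D.v₁ * hPlus D.F 0 j k + dz j * D.v₁ * hPlus D.F 0 i k := by
    simp only [dev₂, inner_add_left, real_inner_smul_left, e1, e2, e3]; ring
  rw [D.pd_pd_bent hH, D.pd_bent hH, inner_sub_left, inner_sub_right, inner_sub_right, h1, h2,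
    linProd]
  ring

/-- `∂_i∂_jF` is nearly normal while `∂_kν⁺` is nearly tangential. -/
lemma O_inner_pd_pd_pd_nuPlus (hd : 1 ≤ d) (i j k : Fin (d + 1)) :
    (fun D => (inner ℝ (pd i (pd j D.F) 0) (pd k (nuPlus D.F) 0) : ℝ))
      =O[lim d m θ K] BendData.ε := by
  have h : ∀ D : BendData d m θ K, (inner ℝ (pd i (pd j D.F) 0) (pd k (nuPlus D.F) 0) : ℝ)
      = inner ℝ (pd i (pd j D.F) 0)
          (pd k (nuPlus D.F) 0 - ∑ l, hPlusMixed D.F 0 k l • pd l D.F 0)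
        + ∑ l, hPlusMixed D.F 0 k l * inner ℝ (pd i (pd j D.F) 0) (pd l D.F 0) := fun D => by
    simp only [inner_sub_right, inner_sum, real_inner_smul_right, sub_add_cancel]
  simp only [h]
  exact (O_inner (O_pd_pd _ _) (O_pd_nuPlus_sub hd k)).add
    (O_sum fun l => O_mul (O_hPlusMixed _ _) (O_inner_pd_pd_pd _ _ _))

/-- Up to `O(ε)`, `∂_i∂_jν⁺` is a combination of the nearly normal vectors `∂_i∂_lF`. -/
lemma O_inner_pd_pd_nuPlus_pd (hd : 1 ≤ d) (i j k : Fin (d + 1)) :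
    (fun D => (inner ℝ (pd i (pd j (nuPlus D.F)) 0) (pd k D.F 0) : ℝ))
      =O[lim d m θ K] BendData.ε := by
  have h : ∀ D : BendData d m θ K, (inner ℝ (pd i (pd j (nuPlus D.F)) 0) (pd k D.F 0) : ℝ)
      = inner ℝ (pd i (pd j (nuPlus D.F)) 0 - ∑ l, hPlusMixed D.F 0 j l • pd i (pd l D.F) 0)
          (pd k D.F 0)
        + ∑ l, hPlusMixed D.F 0 j l * inner ℝ (pd i (pd l D.F) 0) (pd k D.F 0) := fun D => by
    simp only [inner_sub_left, sum_inner, real_inner_smul_left, sub_add_cancel]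
  simp only [h]
  exact (O_inner' (O_pd_pd_nuPlus_sub hd i j) (O_pd k)).add
    (O_sum fun l => O_mul (O_hPlusMixed _ _) (O_inner_pd_pd_pd _ _ _))

lemma O_inner_bent_sub_sub (hd : 1 ≤ d) (i j k : Fin (d + 1)) :
    (fun D => (inner ℝ (pd i (pd j D.bent) 0) (pd k D.bent 0) : ℝ)
      - (inner ℝ (pd i (pd j D.F) 0) (pd k D.F 0) + D.linProd i j k))
      =O[lim d m θ K] err := by
  have h : (fun D => (inner ℝ (pd i (pd j D.bent) 0) (pd k D.bent 0) : ℝ)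
      - (inner ℝ (pd i (pd j D.F) 0) (pd k D.F 0) + D.linProd i j k)) =ᶠ[lim d m θ K] fun D =>
      inner ℝ (D.dev₂ i j) (D.dev₁ k)
        - D.v₀ * inner ℝ (pd i (pd j D.F) 0) (pd k (nuPlus D.F) 0)
        - D.v₀ * inner ℝ (pd i (pd j (nuPlus D.F)) 0) (pd k D.F 0) := by
    filter_upwards [eventually_meanCurv_ne hd] with D hD
    rw [D.inner_bent_eq hD]; ring
  exact h.trans_isBigO (((O_inner_of_mul (O_dev₂ hd i j) (O_dev₁ hd k) O_size₂_mul_size₁).sub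
    (O_mul_of_mul O_v₀ (O_inner_pd_pd_pd_nuPlus hd _ _ _) O_size₁_mul_ε)).sub
    (O_mul_of_mul O_v₀ (O_inner_pd_pd_nuPlus_pd hd _ _ _) O_size₁_mul_ε))

lemma O_inner_bent_sub (hd : 1 ≤ d) (i j k : Fin (d + 1)) :
    (fun D => (inner ℝ (pd i (pd j D.bent) 0) (pd k D.bent 0) : ℝ)
      - inner ℝ (pd i (pd j D.F) 0) (pd k D.F 0)) =O[lim d m θ K] size₂ := by
  have h : (fun D => (inner ℝ (pd i (pd j D.bent) 0) (pd k D.bent 0) : ℝ)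
      - inner ℝ (pd i (pd j D.F) 0) (pd k D.F 0)) =ᶠ[lim d m θ K] fun D =>
      -(inner ℝ (D.dev₂ i j) (pd k D.bent 0) : ℝ) - inner ℝ (pd i (pd j D.F) 0) (D.dev₁ k) := by
    filter_upwards [eventually_meanCurv_ne hd] with D hD
    rw [D.pd_pd_bent hD, D.pd_bent hD]
    simp only [inner_sub_left, inner_sub_right]
    ring
  exact h.trans_isBigO ((O_inner' (O_dev₂ hd i j) (O_pd_bent hd k)).neg_left.sub
    (O_inner (O_pd_pd i j) ((O_dev₁ hd k).trans O_size₁)))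

lemma eventually_sff_bent (hd : 1 ≤ d) (i j : Fin (d + 1)) : ∀ᶠ D in lim d m θ K,
    sff D.bent 0 i j = -pd i (pd j D.F) 0 + D.dev₂ i j
      + ∑ k, ∑ l, (metricInv D.bent 0 k l *
        inner ℝ (pd i (pd j D.bent) 0) (pd k D.bent 0)) • pd l D.bent 0 := by
  filter_upwards [eventually_meanCurv_ne hd] with D hD
  rw [sff_eq (D.contDiffAt_bent hD)]
  congr 1
  rw [D.pd_pd_bent hD]
  abel

lemma O_sff_bent_sub (hd : 1 ≤ d) (hθ : θ < 1) (i j : Fin (d + 1)) :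
    (fun D => sff D.bent 0 i j - sff D.F 0 i j) =O[lim d m θ K] size₂ := by
  have h : (fun D => sff D.bent 0 i j - sff D.F 0 i j) =ᶠ[lim d m θ K] fun D =>
      D.dev₂ i j + ∑ k, ∑ l, (
        (metricInv D.bent 0 k l * ((inner ℝ (pd i (pd j D.bent) 0) (pd k D.bent 0) : ℝ)
          - inner ℝ (pd i (pd j D.F) 0) (pd k D.F 0))) • pd l D.bent 0
        + ((metricInv D.bent 0 k l - metricInv D.F 0 k l)
          * inner ℝ (pd i (pd j D.F) 0) (pd k D.F 0)) • pd l D.bent 0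
        + (metricInv D.F 0 k l * inner ℝ (pd i (pd j D.F) 0) (pd k D.F 0)) • (-D.dev₁ l)) := by
    filter_upwards [eventually_meanCurv_ne hd, eventually_sff_bent hd i j] with D hD h1
    rw [h1, sff_eq D.smooth_two, add_sub_add_comm, add_comm (-pd i (pd j D.F) 0),
      add_sub_cancel_right, ← Finset.sum_sub_distrib]
    congr 1
    refine Finset.sum_congr rfl fun k _ => ?_
    rw [← Finset.sum_sub_distrib]
    refine Finset.sum_congr rfl fun l _ => ?_
    have : -D.dev₁ l = pd l D.bent 0 - pd l D.F 0 := by rw [D.pd_bent hD]; abel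
    rw [this]
    module
  exact h.trans_isBigO ((O_dev₂ hd i j).add (O_sum fun k => O_sum fun l =>
    ((O_smul' (O_mul (O_metricInv_bent hd hθ _ _) (O_inner_bent_sub hd _ _ _)) (O_pd_bent hd l)).add
      (O_smul' (O_mul' ((O_metricInv_bent_sub hd hθ _ _).trans O_size₁)
        (O_one_of_O_ε (O_inner_pd_pd_pd _ _ _))) (O_pd_bent hd l))).add
      (O_smul (O_mul (O_metricInv _ _) (O_one_of_O_ε (O_inner_pd_pd_pd _ _ _)))
        ((O_dev₁ hd l).trans O_size₁).neg_left)))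

lemma sum_metricInv_mul_dz (D : BendData d m θ K) (l : Fin (d + 1)) :
    ∑ k, metricInv D.F 0 k l * dz k = metricInv D.F 0 0 l := by
  simp [dz]

/-- Raising the index of `linProd` turns it into the last line of `linSff`. -/
lemma sum_linProd (D : BendData d m θ K) (i j : Fin (d + 1)) :
    ∑ k, ∑ l, (metricInv D.F 0 k l * D.linProd i j k) • pd l D.F 0
      = -(D.v₁ • ∑ k, (dz i * hPlusMixed D.F 0 j k + dz j * hPlusMixed D.F 0 i k
        - metricInv D.F 0 0 k * hPlus D.F 0 i j) • pd k D.F 0) := by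
  rw [Finset.sum_comm, Finset.smul_sum, ← Finset.sum_neg_distrib]
  refine Finset.sum_congr rfl fun l _ => ?_
  rw [← Finset.sum_smul, smul_smul, ← neg_smul]
  congr 1
  have h1 : ∀ j, ∑ k, metricInv D.F 0 k l * hPlus D.F 0 j k = hPlusMixed D.F 0 j l := fun j =>
    Finset.sum_congr rfl fun k _ => by rw [metricInv_symm]
  calc _ = D.v₁ * ((∑ k, metricInv D.F 0 k l * dz k) * hPlus D.F 0 i j
        - dz i * (∑ k, metricInv D.F 0 k l * hPlus D.F 0 j k)
        - dz j * ∑ k, metricInv D.F 0 k l * hPlus D.F 0 i k) := by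
        rw [Finset.sum_mul, Finset.mul_sum, Finset.mul_sum, ← Finset.sum_sub_distrib,
          ← Finset.sum_sub_distrib, Finset.mul_sum]
        exact Finset.sum_congr rfl fun k _ => by rw [linProd]; ring
    _ = _ := by rw [sum_metricInv_mul_dz, h1, h1]; ring

/-- In `dev₂`, `∂_jν⁺` and `∂_i∂_jν⁺` are replaced by their leading parts. In the tangential
correction the inverse metric, the inner product and `∂_lF̃` are replaced one factor at a time. The
summand of `linSff` with `∂_ih^{+,k}_j` is itself of the size of the error. -/
lemma O_sff_bent_sub_lin (hd : 1 ≤ d) (hθ : θ < 1) (i j : Fin (d + 1)) :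
    (fun D => sff D.bent 0 i j - sff D.F 0 i j - D.linSff i j) =O[lim d m θ K] err := by
  have h : (fun D => sff D.bent 0 i j - sff D.F 0 i j - D.linSff i j) =ᶠ[lim d m θ K] fun D =>
      ((dz i * D.v₁) • (pd j (nuPlus D.F) 0 - ∑ k, hPlusMixed D.F 0 j k • pd k D.F 0)
        + D.v₀ • (pd i (pd j (nuPlus D.F)) 0 - ∑ k, hPlusMixed D.F 0 j k • pd i (pd k D.F) 0)
        - D.v₀ • ∑ k, pd i (fun x => hPlusMixed D.F x j k) 0 • pd k D.F 0)
      + ∑ k, ∑ l, (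
        (metricInv D.bent 0 k l * ((inner ℝ (pd i (pd j D.bent) 0) (pd k D.bent 0) : ℝ)
          - (inner ℝ (pd i (pd j D.F) 0) (pd k D.F 0) + D.linProd i j k))) • pd l D.bent 0
        + (((metricInv D.bent 0 k l - metricInv D.F 0 k l)
          * inner ℝ (pd i (pd j D.F) 0) (pd k D.F 0)) • pd l D.bent 0
          + ((metricInv D.bent 0 k l - metricInv D.F 0 k l) * D.linProd i j k) • pd l D.bent 0)
        + ((metricInv D.F 0 k l * inner ℝ (pd i (pd j D.F) 0) (pd k D.F 0)) • (-D.dev₁ l)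
          + (metricInv D.F 0 k l * D.linProd i j k) • (-D.dev₁ l))) := by
    filter_upwards [eventually_meanCurv_ne hd, eventually_sff_bent hd i j] with D hD h1
    have h2 : ∀ l, -D.dev₁ l = pd l D.bent 0 - pd l D.F 0 := fun l => by
      rw [D.pd_bent hD]; abel
    have h3 : ∀ k l, ((metricInv D.bent 0 k l
          * ((inner ℝ (pd i (pd j D.bent) 0) (pd k D.bent 0) : ℝ)
          - (inner ℝ (pd i (pd j D.F) 0) (pd k D.F 0) + D.linProd i j k))) • pd l D.bent 0
        + (((metricInv D.bent 0 k l - metricInv D.F 0 k l)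
          * inner ℝ (pd i (pd j D.F) 0) (pd k D.F 0)) • pd l D.bent 0
          + ((metricInv D.bent 0 k l - metricInv D.F 0 k l) * D.linProd i j k) • pd l D.bent 0)
        + ((metricInv D.F 0 k l * inner ℝ (pd i (pd j D.F) 0) (pd k D.F 0)) • (-D.dev₁ l)
          + (metricInv D.F 0 k l * D.linProd i j k) • (-D.dev₁ l)))
        = (metricInv D.bent 0 k l *
          inner ℝ (pd i (pd j D.bent) 0) (pd k D.bent 0)) • pd l D.bent 0
        - (metricInv D.F 0 k l * inner ℝ (pd i (pd j D.F) 0) (pd k D.F 0)) • pd l D.F 0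
        - (metricInv D.F 0 k l * D.linProd i j k) • pd l D.F 0 := fun k l => by
      rw [h2]; module
    simp only [h3, Finset.sum_sub_distrib, sum_linProd]
    rw [h1, sff_eq D.smooth_two, linSff, dev₂]
    simp only [smul_sub]
    abel
  refine h.trans_isBigO (((((O_smul_of_mul (O_mul (O_const _) O_v₁) (O_pd_nuPlus_sub hd j)
    O_size₁_mul_ε).add (O_smul_of_mul O_v₀ (O_pd_pd_nuPlus_sub hd i j) O_size₁_mul_ε)).sub
    (O_smul_of_mul O_v₀ (O_sum fun k => O_smul' (O_pd_hPlusMixed hd _ _ _) (O_pd k))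
      O_size₁_mul_ε))).add (O_sum fun k => O_sum fun l =>
    ((O_smul' (O_mul (O_metricInv_bent hd hθ _ _) (O_inner_bent_sub_sub hd _ _ _))
      (O_pd_bent hd l)).add (IsBigO.add ?_ ?_)).add (IsBigO.add ?_ ?_)))
  · exact O_smul' (O_mul_of_mul (O_metricInv_bent_sub hd hθ _ _) (O_inner_pd_pd_pd _ _ _)
      O_size₁_mul_ε) (O_pd_bent hd l)
  · exact O_smul' (O_mul_of_mul (O_metricInv_bent_sub hd hθ _ _) (O_linProd _ _ _)
      O_size₁_mul_size₁) (O_pd_bent hd l)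
  · exact O_smul_of_mul (O_mul (O_metricInv _ _) (O_inner_pd_pd_pd _ _ _))
      (O_dev₁ hd l).neg_left (by simpa only [mul_comm] using O_size₁_mul_ε)
  · exact O_smul_of_mul (O_mul (O_metricInv _ _) (O_linProd _ _ _))
      (O_dev₁ hd l).neg_left O_size₁_mul_size₁

/-! ### First variation of the Weingarten map -/

/-- The first variation of `h_i^j`, up to terms which are small for a neck. -/
def linWein (D : BendData d m θ K) (i j : Fin (d + 1)) : E (d + 1 + m) :=
  (metricInv D.F 0 0 j * dz i * D.v₂) • nuPlus D.F 0
    - D.v₀ • ∑ k, hPlusUp D.F 0 j k • pd i (pd k D.F) 0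
    + (metricInv D.F 0 0 j * D.v₁) • pd i (nuPlus D.F) 0
    + (dz i * D.v₁) • ∑ k, hPlusUp D.F 0 j k • pd k D.F 0
    + D.v₀ • ∑ k, pd i (fun x => hPlusUp D.F x j k) 0 • pd k D.F 0
    - D.v₁ • ∑ k, (dz i * hPlusUp D.F 0 j k + metricInv D.F 0 0 j * hPlusMixed D.F 0 i k
        - metricInv D.F 0 0 k * hPlusMixed D.F 0 i j) • pd k D.F 0

lemma sum_metricInv_smul_sum_hPlusMixed (D : BendData d m θ K) (j : Fin (d + 1))
    (X : Fin (d + 1) → E (d + 1 + m)) :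
    ∑ l, metricInv D.F 0 j l • ∑ k, hPlusMixed D.F 0 l k • X k = ∑ k, hPlusUp D.F 0 j k • X k := by
  simp only [Finset.smul_sum, smul_smul]
  rw [Finset.sum_comm]
  exact Finset.sum_congr rfl fun k _ => by
    rw [← Finset.sum_smul, sum_metricInv_mul_hPlusMixed]

lemma sum_metricInv_smul_dz (D : BendData d m θ K) (j : Fin (d + 1)) (c : ℝ)
    (X : E (d + 1 + m)) :
    ∑ l, metricInv D.F 0 j l • (dz l * c) • X = (metricInv D.F 0 0 j * c) • X := by
  simp [dz, smul_smul, metricInv_symm D.F 0 j 0]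

/-- Raising an index reproduces `linWein` apart from two terms: `2v h^{+,jk}∂_i∂_kF`, which the
variation of `g⁻¹` will cancel, and the derivative of `g⁻¹` hidden in `∂_ih^{+,jk}`, which is
`O(ε)`. -/
lemma sum_metricInv_smul_linSff (D : BendData d m θ K) (i j : Fin (d + 1)) :
    ∑ l, metricInv D.F 0 j l • D.linSff i l
      = D.linWein i j + (2 * D.v₀) • ∑ k, hPlusUp D.F 0 j k • pd i (pd k D.F) 0
        + D.v₀ • (∑ l, metricInv D.F 0 j l • ∑ k, pd i (fun x => hPlusMixed D.F x l k) 0 • pd k D.F 0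
          - ∑ k, pd i (fun x => hPlusUp D.F x j k) 0 • pd k D.F 0) := by
  have e1 : ∑ l, metricInv D.F 0 j l • (dz i * dz l * D.v₂) • nuPlus D.F 0
      = (metricInv D.F 0 0 j * dz i * D.v₂) • nuPlus D.F 0 := by
    rw [mul_assoc, ← sum_metricInv_smul_dz]
    exact Finset.sum_congr rfl fun l _ => by congr 2; ring
  have e2 : ∑ l, metricInv D.F 0 j l • D.v₀ • ∑ k, hPlusMixed D.F 0 l k • pd i (pd k D.F) 0
      = D.v₀ • ∑ k, hPlusUp D.F 0 j k • pd i (pd k D.F) 0 := by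
    rw [← sum_metricInv_smul_sum_hPlusMixed, Finset.smul_sum]
    exact Finset.sum_congr rfl fun l _ => smul_comm _ _ _
  have e3 : ∑ l, metricInv D.F 0 j l • (dz i * D.v₁) • ∑ k, hPlusMixed D.F 0 l k • pd k D.F 0
      = (dz i * D.v₁) • ∑ k, hPlusUp D.F 0 j k • pd k D.F 0 := by
    rw [← sum_metricInv_smul_sum_hPlusMixed, Finset.smul_sum]
    exact Finset.sum_congr rfl fun l _ => smul_comm _ _ _
  have e4 : ∑ l, metricInv D.F 0 j l • D.v₀ • ∑ k, pd i (fun x => hPlusMixed D.F x l k) 0 • pd k D.F 0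
      = D.v₀ • ∑ l, metricInv D.F 0 j l • ∑ k, pd i (fun x => hPlusMixed D.F x l k) 0 • pd k D.F 0 := by
    rw [Finset.smul_sum]
    exact Finset.sum_congr rfl fun l _ => smul_comm _ _ _
  have e5 : ∑ l, metricInv D.F 0 j l • D.v₁ • ∑ k, (dz i * hPlusMixed D.F 0 l k
        + dz l * hPlusMixed D.F 0 i k - metricInv D.F 0 0 k * hPlus D.F 0 i l) • pd k D.F 0
      = D.v₁ • ∑ k, (dz i * hPlusUp D.F 0 j k + metricInv D.F 0 0 j * hPlusMixed D.F 0 i k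
        - metricInv D.F 0 0 k * hPlusMixed D.F 0 i j) • pd k D.F 0 := by
    simp only [Finset.smul_sum, smul_smul]
    rw [Finset.sum_comm]
    refine Finset.sum_congr rfl fun k _ => ?_
    rw [← Finset.sum_smul]
    congr 1
    rw [← sum_metricInv_mul_hPlusMixed, hPlusMixed.eq_1 D.F 0 i j,
      ← sum_metricInv_mul_dz D j, Finset.mul_sum, Finset.sum_mul, Finset.mul_sum,
      ← Finset.sum_add_distrib, ← Finset.sum_sub_distrib, Finset.mul_sum]
    exact Finset.sum_congr rfl fun l _ => by rw [metricInv_symm D.F 0 l j]; ring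
  simp only [linSff, smul_add, smul_sub (metricInv _ _ _ _), Finset.sum_add_distrib,
    Finset.sum_sub_distrib, e1, e2, e3, e4, e5, sum_metricInv_smul_dz, linWein]
  module

lemma O_sum_pd_hPlus_sub (hd : 1 ≤ d) (i j : Fin (d + 1)) :
    (fun D => ∑ l, metricInv D.F 0 j l • ∑ k, pd i (fun x => hPlusMixed D.F x l k) 0 • pd k D.F 0
          - ∑ k, pd i (fun x => hPlusUp D.F x j k) 0 • pd k D.F 0)
      =O[lim d m θ K] BendData.ε :=
  (O_sum fun _ => O_smul (O_metricInv _ _) (O_sum fun _ =>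
    O_smul' (O_pd_hPlusMixed hd _ _ _) (O_pd _))).sub
    (O_sum fun _ => O_smul' (O_pd_hPlusUp hd _ _ _) (O_pd _))

lemma O_weingarten (i j : Fin (d + 1)) :
    (fun D => weingarten D.F 0 i j) =O[lim d m θ K] fun _ => (1 : ℝ) :=
  O_sum fun _ => O_smul (O_metricInv _ _) (O_sff _ _)

lemma O_weingarten_bent_sub (hd : 1 ≤ d) (hθ : θ < 1) (i j : Fin (d + 1)) :
    (fun D => weingarten D.bent 0 i j - weingarten D.F 0 i j) =O[lim d m θ K] size₂ := by
  have h : ∀ D : BendData d m θ K, weingarten D.bent 0 i j - weingarten D.F 0 i j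
      = ∑ l, (metricInv D.bent 0 j l • (sff D.bent 0 i l - sff D.F 0 i l)
        + (metricInv D.bent 0 j l - metricInv D.F 0 j l) • sff D.F 0 i l) := fun D => by
    rw [weingarten, weingarten, ← Finset.sum_sub_distrib]
    exact Finset.sum_congr rfl fun l _ => by module
  simp only [h]
  exact O_sum fun l => (O_smul (O_metricInv_bent hd hθ _ _) (O_sff_bent_sub hd hθ _ _)).add
    (O_smul' ((O_metricInv_bent_sub hd hθ _ _).trans O_size₁) (O_sff _ _))

/-- The product rule for `g̃⁻¹h̃` contributes `2v h^{+,jk}h_{ik}`; combined with the extra `2v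
h^{+,jk}∂_i∂_kF` it leaves only Christoffel terms, because `∂_i∂_kF + h_{ik} = O(ε)`. -/
lemma O_weingarten_bent_sub_lin (hd : 1 ≤ d) (hθ : θ < 1) (i j : Fin (d + 1)) :
    (fun D => weingarten D.bent 0 i j - weingarten D.F 0 i j - D.linWein i j)
      =O[lim d m θ K] err := by
  have h : ∀ D : BendData d m θ K,
      weingarten D.bent 0 i j - weingarten D.F 0 i j - D.linWein i j
      = ∑ l, ((metricInv D.bent 0 j l - metricInv D.F 0 j l - 2 * D.v₀ * hPlusUp D.F 0 j l)
            • sff D.F 0 i l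
          + (metricInv D.bent 0 j l - metricInv D.F 0 j l) • (sff D.bent 0 i l - sff D.F 0 i l)
          + metricInv D.F 0 j l • (sff D.bent 0 i l - sff D.F 0 i l - D.linSff i l))
        + (D.v₀ • ((2 : ℝ) • ∑ k, hPlusUp D.F 0 j k • (pd i (pd k D.F) 0 + sff D.F 0 i k))
          + D.v₀ • (∑ l, metricInv D.F 0 j l •
              ∑ k, pd i (fun x => hPlusMixed D.F x l k) 0 • pd k D.F 0
            - ∑ k, pd i (fun x => hPlusUp D.F x j k) 0 • pd k D.F 0)) := fun D => by
    have h1 : ∑ l, ((metricInv D.bent 0 j l - metricInv D.F 0 j l - 2 * D.v₀ * hPlusUp D.F 0 j l)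
            • sff D.F 0 i l
          + (metricInv D.bent 0 j l - metricInv D.F 0 j l) • (sff D.bent 0 i l - sff D.F 0 i l)
          + metricInv D.F 0 j l • (sff D.bent 0 i l - sff D.F 0 i l - D.linSff i l))
        = weingarten D.bent 0 i j - weingarten D.F 0 i j
          - (2 * D.v₀) • ∑ l, hPlusUp D.F 0 j l • sff D.F 0 i l
          - ∑ l, metricInv D.F 0 j l • D.linSff i l := by
      rw [weingarten, weingarten, Finset.smul_sum, ← Finset.sum_sub_distrib,
        ← Finset.sum_sub_distrib, ← Finset.sum_sub_distrib]
      exact Finset.sum_congr rfl fun l _ => by module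
    rw [h1, sum_metricInv_smul_linSff]
    simp only [smul_add, Finset.sum_add_distrib]
    module
  simp only [h]
  exact (O_sum fun l => ((O_smul' (O_metricInv_bent_sub_sub hd hθ _ _) (O_sff _ _)).add
      (O_smul_of_mul (O_metricInv_bent_sub hd hθ _ _) (O_sff_bent_sub hd hθ _ _)
        O_size₁_mul_size₂)).add
      (O_smul (O_metricInv _ _) (O_sff_bent_sub_lin hd hθ _ _))).add
    ((O_smul_of_mul O_v₀ (O_smul (O_const _) (O_sum fun k => O_smul (O_hPlusUp _ _)
      (O_pd_pd_add_sff _ _))) O_size₁_mul_ε).add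
      (O_smul_of_mul O_v₀ (O_sum_pd_hPlus_sub hd _ _) O_size₁_mul_ε))

/-! ### First variation of the scalar curvature quantities -/

lemma O_meanCurv_bent_sub (hd : 1 ≤ d) (hθ : θ < 1) :
    (fun D => meanCurv D.bent 0 - meanCurv D.F 0) =O[lim d m θ K] size₂ := by
  simp only [meanCurv, ← Finset.sum_sub_distrib]
  exact O_sum fun i => O_weingarten_bent_sub hd hθ i i

lemma O_meanCurv_bent_sub_lin (hd : 1 ≤ d) (hθ : θ < 1) :
    (fun D => meanCurv D.bent 0 - meanCurv D.F 0 - ∑ i, D.linWein i i)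
      =O[lim d m θ K] err := by
  simp only [meanCurv, ← Finset.sum_sub_distrib]
  exact O_sum fun i => O_weingarten_bent_sub_lin hd hθ i i

/-- A normal vector does not see the `∂_kF` terms and sees `∂_i∂_kF` as `-h_{ik}`, so the `v` term
changes sign. -/
lemma inner_linWein (D : BendData d m θ K) {w : E (d + 1 + m)}
    (hw : ∀ k, (inner ℝ w (pd k D.F 0) : ℝ) = 0) (i j : Fin (d + 1)) :
    (inner ℝ w (D.linWein i j) : ℝ) = metricInv D.F 0 0 j * dz i * D.v₂ * inner ℝ w (nuPlus D.F 0)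
      + D.v₀ * ∑ k, hPlusUp D.F 0 j k * inner ℝ w (sff D.F 0 i k)
      + metricInv D.F 0 0 j * D.v₁ * inner ℝ w (pd i (nuPlus D.F) 0) := by
  have h1 : ∀ k, (inner ℝ w (pd i (pd k D.F) 0) : ℝ) = -inner ℝ w (sff D.F 0 i k) := fun k => by
    rw [real_inner_comm, inner_pd_pd_of_normal D.smooth_two hw, real_inner_comm]
  simp only [linWein, inner_add_right, inner_sub_right, real_inner_smul_right, inner_sum, hw, h1]
  simp

/-- `W` is normal, so only the defect of `∂_kν⁺` is seen. This makes the `v'` contribution to `|A|²`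
an error term. -/
lemma O_inner_weingarten_pd_nuPlus (hd : 1 ≤ d) (i j k : Fin (d + 1)) :
    (fun D => (inner ℝ (weingarten D.F 0 i j) (pd k (nuPlus D.F) 0) : ℝ))
      =O[lim d m θ K] BendData.ε := by
  have h : ∀ D : BendData d m θ K, (inner ℝ (weingarten D.F 0 i j) (pd k (nuPlus D.F) 0) : ℝ)
      = inner ℝ (weingarten D.F 0 i j)
        (pd k (nuPlus D.F) 0 - ∑ l, hPlusMixed D.F 0 k l • pd l D.F 0) := fun D => by
    simp [inner_sub_right, inner_sum, real_inner_smul_right,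
      inner_weingarten_pd D.smooth_two D.det_ne]
  simp only [h]
  exact O_inner (O_weingarten _ _) (O_pd_nuPlus_sub hd k)

lemma sum_inner_linWein (D : BendData d m θ K) :
    ∑ i, ∑ j, (inner ℝ (weingarten D.F 0 i j) (D.linWein j i) : ℝ)
      = D.v₂ * hPlusUp D.F 0 0 0
        + D.v₀ * ∑ i, ∑ j, ∑ k, hPlusMixed D.F 0 j k *
          (inner ℝ (sff D.F 0 i k) (sffUp D.F 0 i j) : ℝ)
        + ∑ i, ∑ j, metricInv D.F 0 0 i * D.v₁ *
          inner ℝ (weingarten D.F 0 i j) (pd j (nuPlus D.F) 0) := by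
  simp only [fun i j => D.inner_linWein (inner_weingarten_pd D.smooth_two D.det_ne i j) j i,
    Finset.sum_add_distrib, inner_weingarten_nuPlus]
  rw [sum_hPlusMixed_mul_inner_sffUp D.smooth_two]
  congr 2
  · rw [← sum_metricInv_mul_hPlusMixed, Finset.mul_sum]
    exact Finset.sum_congr rfl fun i _ => by simp [dz]; ring
  · simp only [Finset.mul_sum]

/-- Expand the trace of the square of `W̃` around `W`: twice the pairing with the linear part, a
quadratic remainder, and the `v'` term. -/
lemma O_normSqA_bent_sub (hd : 1 ≤ d) (hθ : θ < 1) :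
    (fun D => normSqA D.bent 0 - (normSqA D.F 0 + 2 * D.v₂ * hPlusUp D.F 0 0 0
      + 2 * D.v₀ * ∑ i, ∑ j, ∑ k, hPlusMixed D.F 0 j k *
          (inner ℝ (sff D.F 0 i k) (sffUp D.F 0 i j) : ℝ))) =O[lim d m θ K] err := by
  have h : (fun D => normSqA D.bent 0 - (normSqA D.F 0 + 2 * D.v₂ * hPlusUp D.F 0 0 0
      + 2 * D.v₀ * ∑ i, ∑ j, ∑ k, hPlusMixed D.F 0 j k *
          (inner ℝ (sff D.F 0 i k) (sffUp D.F 0 i j) : ℝ))) =ᶠ[lim d m θ K] fun D =>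
      2 * ∑ i, ∑ j, (inner ℝ (weingarten D.F 0 i j)
          (weingarten D.bent 0 j i - weingarten D.F 0 j i - D.linWein j i) : ℝ)
        + ∑ i, ∑ j, (inner ℝ (weingarten D.bent 0 i j - weingarten D.F 0 i j)
          (weingarten D.bent 0 j i - weingarten D.F 0 j i) : ℝ)
        + 2 * ∑ i, ∑ j, D.v₁ * (metricInv D.F 0 0 i *
          inner ℝ (weingarten D.F 0 i j) (pd j (nuPlus D.F) 0)) := by
    filter_upwards [eventually_meanCurv_ne hd] with D hD
    have h1 := D.sum_inner_linWein
    have h2 : ∑ i, ∑ j, (inner ℝ (weingarten D.bent 0 i j) (weingarten D.F 0 j i) : ℝ)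
        = ∑ i, ∑ j, (inner ℝ (weingarten D.F 0 i j) (weingarten D.bent 0 j i) : ℝ) := by
      rw [Finset.sum_comm]
      exact Finset.sum_congr rfl fun i _ => Finset.sum_congr rfl fun j _ => real_inner_comm _ _
    have h3 : ∑ i, ∑ j, D.v₁ * (metricInv D.F 0 0 i *
          (inner ℝ (weingarten D.F 0 i j) (pd j (nuPlus D.F) 0) : ℝ))
        = ∑ i, ∑ j, metricInv D.F 0 0 i * D.v₁ *
          inner ℝ (weingarten D.F 0 i j) (pd j (nuPlus D.F) 0) :=
      Finset.sum_congr rfl fun i _ => Finset.sum_congr rfl fun j _ => by ring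
    rw [normSqA_eq (D.contDiffAt_bent hD), normSqA_eq D.smooth_two]
    simp only [inner_sub_left, inner_sub_right, Finset.sum_sub_distrib, h1, h2, h3]
    ring
  refine h.trans_isBigO (((O_mul (O_const _) (O_sum fun i => O_sum fun j =>
    O_inner (O_weingarten _ _) (O_weingarten_bent_sub_lin hd hθ _ _))).add
    (O_sum fun i => O_sum fun j => O_inner_of_mul (O_weingarten_bent_sub hd hθ _ _)
      (O_weingarten_bent_sub hd hθ _ _) O_size₂_mul_size₂)).add
    (O_mul (O_const _) (O_sum fun i => O_sum fun j => O_mul_of_mul O_v₁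
      (O_mul (O_metricInv _ _) (O_inner_weingarten_pd_nuPlus hd _ _ _)) O_size₁_mul_ε)))

/-- `H` is a multiple of `ν⁺`, which is exactly orthogonal to its own derivative, so here the `v'`
term vanishes. -/
lemma inner_meanCurv_sum_linWein (D : BendData d m θ K) (hH : meanCurv D.F 0 ≠ 0) :
    (inner ℝ (meanCurv D.F 0) (∑ i, D.linWein i i) : ℝ)
      = D.v₂ * metricInv D.F 0 0 0 * ‖meanCurv D.F 0‖
        + D.v₀ * (∑ i, ∑ j, ∑ k, hPlusMixed D.F 0 j k * hPlus D.F 0 i k * metricInv D.F 0 i j)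
          * ‖meanCurv D.F 0‖ := by
  have h0 := norm_smul_nuPlus hH
  have h1 : (inner ℝ (meanCurv D.F 0) (nuPlus D.F 0) : ℝ) = ‖meanCurv D.F 0‖ := by
    conv_lhs => rw [← h0]
    rw [real_inner_smul_left, real_inner_self_eq_norm_sq, norm_nuPlus hH]
    simp
  have h2 : ∀ i, (inner ℝ (meanCurv D.F 0) (pd i (nuPlus D.F) 0) : ℝ) = 0 := fun i => by
    conv_lhs => rw [← h0]
    rw [real_inner_smul_left, D.inner_nuPlus_pd_nuPlus' hH, mul_zero]
  have h3 : ∀ i k, (inner ℝ (meanCurv D.F 0) (sff D.F 0 i k) : ℝ)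
      = ‖meanCurv D.F 0‖ * hPlus D.F 0 i k := fun i k => by
    conv_lhs => rw [← h0]
    rw [real_inner_smul_left, real_inner_comm, hPlus]
  rw [inner_sum]
  simp only [D.inner_linWein (inner_meanCurv_pd D.smooth_two D.det_ne), h1, h2, h3, mul_zero,
    add_zero, Finset.sum_add_distrib]
  congr 1
  · simp [dz]
    exact Or.inl (mul_comm _ _)
  · rw [← Finset.mul_sum, mul_assoc, Finset.sum_mul]
    congr 1
    refine Finset.sum_congr rfl fun i _ => ?_
    rw [Finset.sum_comm, Finset.sum_mul]
    refine Finset.sum_congr rfl fun k _ => ?_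
    rw [← sum_metricInv_mul_hPlusMixed, Finset.sum_mul, Finset.sum_mul]
    exact Finset.sum_congr rfl fun j _ => by ring

lemma O_norm_meanCurv_bent_sub (hd : 1 ≤ d) (hθ : θ < 1) :
    (fun D => ‖meanCurv D.bent 0‖ ^ 2 - (‖meanCurv D.F 0‖ ^ 2
      + 2 * D.v₂ * metricInv D.F 0 0 0 * ‖meanCurv D.F 0‖
      + 2 * D.v₀ * (∑ i, ∑ j, ∑ k, hPlusMixed D.F 0 j k * hPlus D.F 0 i k * metricInv D.F 0 i j)
          * ‖meanCurv D.F 0‖)) =O[lim d m θ K] err := by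
  have h : (fun D => ‖meanCurv D.bent 0‖ ^ 2 - (‖meanCurv D.F 0‖ ^ 2
      + 2 * D.v₂ * metricInv D.F 0 0 0 * ‖meanCurv D.F 0‖
      + 2 * D.v₀ * (∑ i, ∑ j, ∑ k, hPlusMixed D.F 0 j k * hPlus D.F 0 i k * metricInv D.F 0 i j)
          * ‖meanCurv D.F 0‖)) =ᶠ[lim d m θ K] fun D =>
      2 * (inner ℝ (meanCurv D.F 0)
        (meanCurv D.bent 0 - meanCurv D.F 0 - ∑ i, D.linWein i i) : ℝ)
      + (inner ℝ (meanCurv D.bent 0 - meanCurv D.F 0)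
        (meanCurv D.bent 0 - meanCurv D.F 0) : ℝ) := by
    filter_upwards [eventually_meanCurv_ne hd] with D hD
    have h1 := D.inner_meanCurv_sum_linWein hD
    have h2 := real_inner_comm (meanCurv D.bent 0) (meanCurv D.F 0)
    simp only [inner_sub_left, inner_sub_right, h1, ← real_inner_self_eq_norm_sq] at h2 ⊢
    linarith
  exact h.trans_isBigO ((O_mul (O_const _) (O_inner O_meanCurv
    (O_meanCurv_bent_sub_lin hd hθ))).add (O_inner_of_mul (O_meanCurv_bent_sub hd hθ)
      (O_meanCurv_bent_sub hd hθ) O_size₂_mul_size₂))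

end BendData

/-! ### Homotheties -/

section Homothety

variable {n : ℕ} {V : Type} [NormedAddCommGroup V] [InnerProductSpace ℝ V] {F : E n → V}
  {c : ℝ}

lemma pd_homothety (i : Fin n) : pd i (fun y => c • F y) = fun x => c • pd i F x :=
  funext fun _ => pd_const_smul c F

lemma metric_homothety (x : E n) : metric (fun y => c • F y) x = c ^ 2 • metric F x := by
  ext i j
  simp only [metric_apply, pd_homothety, real_inner_smul_left, real_inner_smul_right,
    Matrix.smul_apply, smul_eq_mul]
  ring

lemma metricInv_homothety (hc : c ≠ 0) (x : E n) :
    metricInv (fun y => c • F y) x = (c ^ 2)⁻¹ • metricInv F x := by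
  have hc2 : c ^ 2 ≠ 0 := pow_ne_zero 2 hc
  rw [metricInv, metric_homothety, metricInv]
  by_cases h : (metric F x).det = 0
  -- A singular matrix has inverse `0`, so the scaling law also holds at degenerate points.
  · have h' : (c ^ 2 • metric F x).det = 0 := by rw [Matrix.det_smul, h, mul_zero]
    rw [Matrix.nonsing_inv_apply_not_isUnit _ (by simp [h']),
      Matrix.nonsing_inv_apply_not_isUnit _ (by simp [h]), smul_zero]
  · refine Matrix.inv_eq_left_inv ?_
    rw [Matrix.smul_mul, Matrix.mul_smul, smul_smul, inv_mul_cancel₀ hc2, one_smul,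
      Matrix.nonsing_inv_mul _ (isUnit_iff_ne_zero.2 h)]

lemma metricInv_homothety_apply (hc : c ≠ 0) (x : E n) (i j : Fin n) :
    metricInv (fun y => c • F y) x i j = (c ^ 2)⁻¹ * metricInv F x i j := by
  rw [metricInv_homothety hc]; rfl

lemma christoffel_homothety (hc : c ≠ 0) (x : E n) (i j k : Fin n) :
    christoffel (metric fun y => c • F y) x i j k = christoffel (metric F) x i j k := by
  have h1 : ∀ a i j, pd a (fun y => metric (fun y => c • F y) y i j) x
      = c ^ 2 * pd a (fun y => metric F y i j) x := fun a i j => by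
    simp only [metric_homothety, Matrix.smul_apply]
    exact pd_const_smul _ _
  have h2 : ∀ l, (metric (fun y => c • F y) x)⁻¹ k l = (c ^ 2)⁻¹ * (metric F x)⁻¹ k l := fun l =>
    metricInv_homothety_apply hc x k l
  unfold christoffel
  simp only [h1, h2]
  congr 1
  refine Finset.sum_congr rfl fun l _ => ?_
  field_simp

lemma sff_homothety (hc : c ≠ 0) (x : E n) (i j : Fin n) :
    sff (fun y => c • F y) x i j = c • sff F x i j := by
  simp only [sff, christoffel_homothety hc, pd_homothety, pd_const_smul, smul_neg, smul_sub,
    Finset.smul_sum, smul_comm c]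

lemma weingarten_homothety (hc : c ≠ 0) (x : E n) (i j : Fin n) :
    weingarten (fun y => c • F y) x i j = c⁻¹ • weingarten F x i j := by
  simp only [weingarten, metricInv_homothety_apply hc, sff_homothety hc, Finset.smul_sum,
    smul_smul]
  refine Finset.sum_congr rfl fun l _ => ?_
  congr 1
  field_simp

lemma meanCurv_homothety (hc : c ≠ 0) (x : E n) :
    meanCurv (fun y => c • F y) x = c⁻¹ • meanCurv F x := by
  simp only [meanCurv, weingarten_homothety hc, Finset.smul_sum]

lemma nuPlus_homothety (hc : 0 < c) (x : E n) : nuPlus (fun y => c • F y) x = nuPlus F x := by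
  rw [nuPlus, nuPlus, meanCurv_homothety hc.ne', norm_smul, smul_smul, norm_inv,
    Real.norm_of_nonneg hc.le, mul_inv, inv_inv, mul_right_comm, mul_inv_cancel₀ hc.ne', one_mul]

lemma hPlus_homothety (hc : 0 < c) (x : E n) (i j : Fin n) :
    hPlus (fun y => c • F y) x i j = c * hPlus F x i j := by
  rw [hPlus, nuPlus_homothety hc, sff_homothety hc.ne', real_inner_smul_left, hPlus]

lemma hPlusMixed_homothety (hc : 0 < c) (x : E n) (i j : Fin n) :
    hPlusMixed (fun y => c • F y) x i j = c⁻¹ * hPlusMixed F x i j := by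
  simp only [hPlusMixed, metricInv_homothety_apply hc.ne', hPlus_homothety hc, Finset.mul_sum]
  refine Finset.sum_congr rfl fun l _ => ?_
  field_simp

lemma hPlusUp_homothety (hc : 0 < c) (x : E n) (i j : Fin n) :
    hPlusUp (fun y => c • F y) x i j = (c ^ 3)⁻¹ * hPlusUp F x i j := by
  simp only [hPlusUp, metricInv_homothety_apply hc.ne', hPlus_homothety hc, Finset.mul_sum]
  refine Finset.sum_congr rfl fun p _ => Finset.sum_congr rfl fun q _ => ?_
  field_simp

lemma sffUp_homothety (hc : c ≠ 0) (x : E n) (i j : Fin n) :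
    sffUp (fun y => c • F y) x i j = (c ^ 3)⁻¹ • sffUp F x i j := by
  simp only [sffUp, metricInv_homothety_apply hc, sff_homothety hc, Finset.smul_sum, smul_smul]
  refine Finset.sum_congr rfl fun p _ => Finset.sum_congr rfl fun q _ => ?_
  congr 1
  field_simp

lemma normSqA_homothety (hc : c ≠ 0) (x : E n) :
    normSqA (fun y => c • F y) x = (c ^ 2)⁻¹ * normSqA F x := by
  simp only [normSqA, metricInv_homothety_apply hc, sff_homothety hc, Finset.mul_sum,
    real_inner_smul_left, real_inner_smul_right]
  refine Finset.sum_congr rfl fun i _ => Finset.sum_congr rfl fun j _ =>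
    Finset.sum_congr rfl fun k _ => Finset.sum_congr rfl fun l _ => ?_
  field_simp

lemma normalProj_homothety (hc : c ≠ 0) (x : E n) (v : V) :
    normalProj (fun y => c • F y) x v = normalProj F x v := by
  simp only [normalProj, metricInv_homothety_apply hc, pd_homothety, real_inner_smul_right,
    smul_smul]
  congr 1
  refine Finset.sum_congr rfl fun i _ => Finset.sum_congr rfl fun j _ => ?_
  congr 1
  field_simp

/-- The connection and the normal projection are scale invariant, so every covariant derivative with
lower indices scales like `h` itself. -/
lemma nablaSff_homothety (hc : c ≠ 0) (l : ℕ) (x : E n) (I : Fin (2 + l) → Fin n) :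
    nablaSff (fun y => c • F y) l x I = c • nablaSff F l x I := by
  induction l generalizing x with
  | zero => exact sff_homothety hc x _ _
  | succ l ih =>
    have h : ∀ G : E n → V, nablaSff G (l + 1) x I
        = normalProj G x (pd (I 0) (fun y => nablaSff G l y (Fin.tail I)) x)
          - ∑ a, ∑ k, christoffel (metric G) x (I 0) (Fin.tail I a) k •
            nablaSff G l x (Function.update (Fin.tail I) a k) := fun _ => rfl
    rw [h, h]
    simp only [ih, pd_const_smul, normalProj_homothety hc, christoffel_homothety hc,
      normalProj_smul, smul_sub, Finset.smul_sum, smul_comm c]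

end Homothety

/-! ### Components of tensors -/

lemma prod_sum_eq_sum_prod {n l : ℕ} (f : Fin l → Fin n → ℝ) :
    ∏ a, ∑ k, f a k = ∑ K : Fin l → Fin n, ∏ a, f a (K a) := by
  rw [Finset.prod_univ_sum, Fintype.piFinset_univ]

open scoped MatrixOrder Matrix.Norms.L2Operator in
lemma exists_eq_conjTranspose_mul_self {n : ℕ} {A : Matrix (Fin n) (Fin n) ℝ}
    (hA : A.PosSemidef) : ∃ B : Matrix (Fin n) (Fin n) ℝ, A = B.conjTranspose * B :=
  CStarAlgebra.nonneg_iff_eq_star_mul_self.1 hA.nonneg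

/-- A component of a tensor is bounded by the norm of the tensor. -/
lemma norm_apply_le_tensorNorm {n l : ℕ} {V : Type} [NormedAddCommGroup V]
    [InnerProductSpace ℝ V] {G : Matrix (Fin n) (Fin n) ℝ} (hG : G.PosDef)
    (T : (Fin l → Fin n) → V) (I : Fin l → Fin n) :
    ‖T I‖ ≤ Real.sqrt (∏ a, G (I a) (I a)) * tensorNorm G⁻¹ T := by
  -- Factoring `G⁻¹ = BᵀB` amounts to choosing an orthonormal frame: `S` below has the components in
  -- that frame, and its Euclidean norm is the tensor norm.
  obtain ⟨B, hB⟩ := exists_eq_conjTranspose_mul_self hG.inv.posSemidef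
  have hGu : IsUnit G.det := hG.det_pos.ne'.isUnit
  have hBe : ∀ i j, G⁻¹ i j = ∑ k, B k i * B k j := fun i j => by
    rw [hB, Matrix.mul_apply]; simp
  have hBu : IsUnit B.det := by
    have h1 : G⁻¹.det ≠ 0 := hG.inv.det_pos.ne'
    rw [hB, Matrix.det_mul] at h1
    exact (right_ne_zero_of_mul h1).isUnit
  set C := B⁻¹ with hC
  have hCB : ∀ i j, ∑ k, C i k * B k j = if i = j then 1 else 0 := fun i j => by
    have := congrFun (congrFun (Matrix.nonsing_inv_mul B hBu) i) j
    rwa [Matrix.mul_apply, Matrix.one_apply] at this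
  have hGC : ∀ i, G i i = ∑ k, C i k ^ 2 := fun i => by
    have h1 : G = C * C.conjTranspose := by
      rw [hC, Matrix.conjTranspose_nonsing_inv, ← Matrix.mul_inv_rev, ← hB,
        Matrix.nonsing_inv_nonsing_inv _ hGu]
    conv_lhs => rw [h1]
    rw [Matrix.mul_apply]
    exact Finset.sum_congr rfl fun k _ => by simp [sq]
  set S : (Fin l → Fin n) → V := fun K => ∑ J, (∏ a, B (K a) (J a)) • T J with hS
  have hnorm : tensorNorm G⁻¹ T = Real.sqrt (∑ K, ‖S K‖ ^ 2) := by
    rw [tensorNorm]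
    congr 1
    simp only [hBe, prod_sum_eq_sum_prod, ← real_inner_self_eq_norm_sq, hS, sum_inner, inner_sum,
      real_inner_smul_left, real_inner_smul_right, Finset.sum_mul, Finset.prod_mul_distrib]
    calc _ = ∑ I, ∑ K : Fin l → Fin n, ∑ J, (∏ a, B (K a) (I a)) * (∏ a, B (K a) (J a))
          * (inner ℝ (T I) (T J) : ℝ) := Finset.sum_congr rfl fun _ _ => Finset.sum_comm
      _ = _ := by
          rw [Finset.sum_comm]
          refine Finset.sum_congr rfl fun K _ => ?_
          rw [Finset.sum_comm]
          exact Finset.sum_congr rfl fun J _ => Finset.sum_congr rfl fun I _ => by ring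
  have hT : T I = ∑ K : Fin l → Fin n, (∏ a, C (I a) (K a)) • S K := by
    simp only [hS, Finset.smul_sum, smul_smul, ← Finset.prod_mul_distrib]
    rw [Finset.sum_comm]
    have : ∀ J, ∑ K : Fin l → Fin n, (∏ a, C (I a) (K a) * B (K a) (J a)) • T J
        = if I = J then T J else 0 := fun J => by
      rw [← Finset.sum_smul, ← prod_sum_eq_sum_prod (fun a k => C (I a) k * B k (J a))]
      simp only [hCB]
      by_cases h : I = J
      · simp [h]
      · obtain ⟨a, ha⟩ := Function.ne_iff.1 h
        rw [Finset.prod_eq_zero (Finset.mem_univ a) (if_neg ha), zero_smul, if_neg h]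
    simp [this]
  calc ‖T I‖ ≤ ∑ K : Fin l → Fin n, |∏ a, C (I a) (K a)| * ‖S K‖ := by
        rw [hT]
        refine (norm_sum_le _ _).trans (Finset.sum_le_sum fun K _ => ?_)
        rw [norm_smul, Real.norm_eq_abs]
    -- Cauchy–Schwarz; the first factor is `∏ G_{I_a I_a}` under the root, because `G = C Cᵀ`.
    _ ≤ Real.sqrt (∑ K : Fin l → Fin n, |∏ a, C (I a) (K a)| ^ 2)
          * Real.sqrt (∑ K, ‖S K‖ ^ 2) :=
        Real.sum_mul_le_sqrt_mul_sqrt _ _ _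
    _ = _ := by
        rw [hnorm]
        congr 2
        simp only [hGC, prod_sum_eq_sum_prod, sq_abs, Finset.prod_pow]

/-! ### Coordinates on the cylinder -/

section CylinderCoordinates

variable {d m : ℕ} {σ : E d → E (d + 1)} {z : ℝ}

/-- The coordinates on the sphere factor. -/
def sphereCoord (d : ℕ) : E (d + 1) →L[ℝ] E d :=
  LinearMap.toContinuousLinearMap
    { toFun := fun x => WithLp.toLp 2 (fun a : Fin d => x a.succ)
      map_add' := fun _ _ => rfl
      map_smul' := fun _ _ => rfl }

lemma sphereCoord_single_zero : sphereCoord d (EuclideanSpace.single 0 1) = 0 := by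
  ext a
  change (EuclideanSpace.single (0 : Fin (d + 1)) (1 : ℝ) : E (d + 1)) a.succ = 0
  simp [Fin.succ_ne_zero]

lemma sphereCoord_single_succ (a : Fin d) :
    sphereCoord d (EuclideanSpace.single a.succ 1) = EuclideanSpace.single a 1 := by
  ext b
  change (EuclideanSpace.single a.succ (1 : ℝ) : E (d + 1)) b.succ
    = (EuclideanSpace.single a (1 : ℝ) : E d) b
  simp [Fin.succ_inj]

lemma pd_comp_sphereCoord {W : Type} [NormedAddCommGroup W] [NormedSpace ℝ W] {f : E d → W}
    {x : E (d + 1)} (hf : DifferentiableAt ℝ f (sphereCoord d x)) (i : Fin (d + 1)) :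
    pd i (fun y => f (sphereCoord d y)) x
      = fderiv ℝ f (sphereCoord d x) (sphereCoord d (EuclideanSpace.single i 1)) := by
  have h := hf.hasFDerivAt.comp x (sphereCoord d).hasFDerivAt
  rw [pd, show (fun y => f (sphereCoord d y)) = f ∘ sphereCoord d from rfl, h.fderiv]
  rfl

lemma pd_zero_comp_sphereCoord {W : Type} [NormedAddCommGroup W] [NormedSpace ℝ W] {f : E d → W}
    {x : E (d + 1)} (hf : DifferentiableAt ℝ f (sphereCoord d x)) :
    pd 0 (fun y => f (sphereCoord d y)) x = 0 := by
  rw [pd_comp_sphereCoord hf, sphereCoord_single_zero, map_zero]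

lemma pd_succ_comp_sphereCoord {W : Type} [NormedAddCommGroup W] [NormedSpace ℝ W] {f : E d → W}
    {x : E (d + 1)} (hf : DifferentiableAt ℝ f (sphereCoord d x)) (a : Fin d) :
    pd a.succ (fun y => f (sphereCoord d y)) x = pd a f (sphereCoord d x) := by
  rw [pd_comp_sphereCoord hf, sphereCoord_single_succ]; rfl

lemma pd_add_apply_zero (z : ℝ) (x : E (d + 1)) (i : Fin (d + 1)) :
    pd i (fun y : E (d + 1) => z + y 0) x = dz i := by
  have h := pd_comp_apply_zero (f := fun s => z + s) (y := x)
    ((differentiableAt_const z).fun_add differentiableAt_id) i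
  rw [h]
  simp

lemma cylMetric_apply (i j : Fin (d + 1)) (x : E (d + 1)) :
    cylMetric σ z x i j = inner ℝ (pd i (fun y => σ (sphereCoord d y)) x)
        (pd j (fun y => σ (sphereCoord d y)) x) + dz i * dz j := by
  rw [← pd_add_apply_zero z x i, ← pd_add_apply_zero z x j]
  rfl

lemma eventually_differentiableAt_chart (hσ : IsNormalSphereChart σ) :
    ∀ᶠ x in 𝓝 (0 : E (d + 1)), DifferentiableAt ℝ σ (sphereCoord d x) := by
  have h : Tendsto (sphereCoord d) (𝓝 0) (𝓝 0) := by
    simpa using (sphereCoord d).continuous.tendsto 0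
  exact h.eventually hσ.smooth.eventually_differentiableAt

lemma cylMetric_zero (hσ : IsNormalSphereChart σ) : cylMetric σ z 0 = 1 := by
  have hd := (eventually_differentiableAt_chart hσ).self_of_nhds
  ext i j
  rw [cylMetric_apply]
  refine Fin.cases ?_ (fun a => ?_) i
  · rw [pd_zero_comp_sphereCoord hd, inner_zero_left, zero_add]
    refine Fin.cases (by simp [dz]) (fun b => ?_) j
    rw [Matrix.one_apply_ne (Fin.succ_ne_zero b).symm]
    simp [dz]
  · refine Fin.cases ?_ (fun b => ?_) j
    · rw [pd_zero_comp_sphereCoord hd, inner_zero_right, zero_add,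
        Matrix.one_apply_ne (Fin.succ_ne_zero a)]
      simp [dz]
    · rw [pd_succ_comp_sphereCoord hd, pd_succ_comp_sphereCoord hd, map_zero, ← metric_apply,
        hσ.metric_eq]
      simp [dz, Matrix.one_apply]

/-- All components with an axial index are constant near the centre; the spherical ones do not
depend on the axial variable and are stationary in normal coordinates. -/
lemma pd_cylMetric_zero (hσ : IsNormalSphereChart σ) (k i j : Fin (d + 1)) :
    pd k (fun y => cylMetric σ z y i j) 0 = 0 := by
  have hd := eventually_differentiableAt_chart hσ
  simp only [cylMetric_apply]
  refine Fin.cases ?_ (fun a => ?_) i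
  · rw [pd_congr (g := fun _ => dz 0 * dz j), pd_const]
    filter_upwards [hd] with x hx
    rw [pd_zero_comp_sphereCoord hx, inner_zero_left, zero_add]
  · refine Fin.cases ?_ (fun b => ?_) j
    · rw [pd_congr (g := fun _ => dz a.succ * dz 0), pd_const]
      filter_upwards [hd] with x hx
      rw [pd_zero_comp_sphereCoord hx, inner_zero_right, zero_add]
    · rw [pd_congr (g := fun y => metric σ (sphereCoord d y) a b)]
      · have hm : DifferentiableAt ℝ (fun y => metric σ y a b) (sphereCoord d 0) := by
          rw [map_zero]
          exact (contDiffAt_metric hσ.smooth (p := ∞) (by simp) a b).diff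
        refine Fin.cases ?_ (fun c => ?_) k
        · exact pd_zero_comp_sphereCoord hm
        · rw [pd_succ_comp_sphereCoord hm, map_zero]
          exact hσ.deriv_metric_eq a b c
      · filter_upwards [hd] with x hx
        rw [pd_succ_comp_sphereCoord hx, pd_succ_comp_sphereCoord hx, ← metric_apply]
        simp [dz]

lemma christoffel_cylMetric_zero (hσ : IsNormalSphereChart σ) (i j k : Fin (d + 1)) :
    christoffel (cylMetric σ z) 0 i j k = 0 := by
  simp [christoffel, pd_cylMetric_zero hσ]

lemma contDiffAt_patch {N : E (d + 1) × ℝ → E (d + 1 + m)} (hσ : IsNormalSphereChart σ)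
    (hN : ContDiffAt ℝ ∞ N (σ 0, z)) : ContDiffAt ℝ ∞ (patch N σ z) 0 := by
  have h1 : ContDiffAt ℝ ∞ (fun x : E (d + 1) => σ (sphereCoord d x)) 0 :=
    ContDiffAt.comp (0 : E (d + 1)) (g := σ) (by rw [map_zero]; exact hσ.smooth)
      (sphereCoord d).contDiff.contDiffAt
  have h2 : ContDiffAt ℝ ∞ (fun x : E (d + 1) => z + x 0) 0 :=
    contDiffAt_const.add (EuclideanSpace.proj (𝕜 := ℝ) (0 : Fin (d + 1))).contDiff.contDiffAt
  have h3 : ContDiffAt ℝ ∞ (fun x => (σ (sphereCoord d x), z + x 0)) (0 : E (d + 1)) :=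
    h1.prodMk h2
  refine ContDiffAt.comp (0 : E (d + 1)) (g := N) ?_ h3
  have h4 : (σ (sphereCoord d 0), z + (0 : E (d + 1)) 0) = (σ 0, z) := by simp
  rw [← h4] at hN
  exact hN

end CylinderCoordinates

/-! ### Estimates at a point of a neck -/

section NeckEstimates

variable {d m k : ℕ} {ε a b z : ℝ} {N : E (d + 1) × ℝ → E (d + 1 + m)} {σ : E d → E (d + 1)}

lemma norm_chart_zero (hσ : IsNormalSphereChart σ) : ‖σ 0‖ = 1 := hσ.mem_sphere.self_of_nhds

lemma abs_confMetric_sub_le (hN : IsGeometricNeck ε k a b N) (hz : z ∈ Set.Icc a b)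
    (hσ : IsNormalSphereChart σ) (i j : Fin (d + 1)) :
    |confMetric N σ z 0 i j - if i = j then 1 else 0| ≤ ε := by
  have h := hN.metric_close z hz σ hσ
  rw [cylMetric_zero hσ] at h
  have h1 := norm_apply_le_tensorNorm (Matrix.PosDef.one (n := Fin (d + 1)) (R := ℝ))
    (fun I : Fin 2 → Fin (d + 1) => confMetric N σ z 0 (I 0) (I 1)
      - (1 : Matrix (Fin (d + 1)) (Fin (d + 1)) ℝ) (I 0) (I 1)) ![i, j]
  simp only [Matrix.one_apply_eq, Finset.prod_const_one, Real.sqrt_one, one_mul] at h1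
  simpa [Matrix.one_apply] using h1.trans h

lemma meanRadius_nonneg (N : E (d + 1) × ℝ → E (d + 1 + m)) (z : ℝ) : 0 ≤ meanRadius N z :=
  Real.rpow_nonneg (div_nonneg (MeasureTheory.integral_nonneg fun _ => Real.sqrt_nonneg _)
    MeasureTheory.measureReal_nonneg) _

/-- If `r = 0`, then `r⁻² = 0` by convention and the rescaled metric vanishes, at distance at least
one from the cylinder metric; this contradicts `ε < 1`. -/
lemma meanRadius_pos (hN : IsGeometricNeck ε k a b N) (hz : z ∈ Set.Icc a b)
    (hσ : IsNormalSphereChart σ) (hε : ε < 1) : 0 < meanRadius N z := by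
  refine (meanRadius_nonneg N z).lt_of_ne fun h => ?_
  have h1 := abs_confMetric_sub_le hN hz hσ 0 0
  simp [confMetric, ← h] at h1
  linarith

lemma metric_patch_zero (hr : 0 < meanRadius N z) (i j : Fin (d + 1)) :
    metric (patch N σ z) 0 i j = meanRadius N z ^ 2 * confMetric N σ z 0 i j := by
  have : meanRadius N z ≠ 0 := hr.ne'
  simp [confMetric]
  field_simp

lemma abs_pd_confMetric_le (hN : IsGeometricNeck ε k a b N) (hz : z ∈ Set.Icc a b)
    (hσ : IsNormalSphereChart σ) (hk : 1 ≤ k) (l i j : Fin (d + 1)) :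
    |pd l (fun y => confMetric N σ z y i j) 0| ≤ ε := by
  have h := hN.deriv_metric_close z hz σ hσ 1 le_rfl hk
  rw [cylMetric_zero hσ] at h
  have h1 := norm_apply_le_tensorNorm (Matrix.PosDef.one (n := Fin (d + 1)) (R := ℝ))
    (iterCovDeriv (christoffel (cylMetric σ z)) (fun _ v => v)
          (fun x I => confMetric N σ z x (I 0) (I 1)) 1 0) ![l, i, j]
  simp only [Matrix.one_apply_eq, Finset.prod_const_one, Real.sqrt_one, one_mul] at h1
  -- At the centre the Christoffel symbols of the cylinder vanish, so the covariant derivative is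
  -- the partial one.
  have h2 : iterCovDeriv (christoffel (cylMetric σ z)) (fun _ v => v)
      (fun x I => confMetric N σ z x (I 0) (I 1)) 1 0 ![l, i, j]
      = pd l (fun y => confMetric N σ z y i j) 0 := by
    simp only [iterCovDeriv, covDeriv, christoffel_cylMetric_zero hσ, zero_smul,
      Finset.sum_const_zero, sub_zero]
    rfl
  rw [h2] at h1
  exact h1.trans h

lemma abs_deriv_meanRadius_le (hN : IsGeometricNeck ε k a b N) (hz : z ∈ Set.Icc a b)
    (hr : 0 < meanRadius N z) (hk : 1 ≤ k) :
    |deriv (meanRadius N) z| ≤ ε * meanRadius N z := by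
  have h := hN.radius_close z hz 1 le_rfl hk
  rw [iteratedDeriv_one, deriv.log ((hN.radius_smooth z hz).differentiableAt (by simp)) hr.ne', abs_div,
    abs_of_pos hr, div_le_iff₀ hr] at h
  exact h

end NeckEstimates

section NeckEstimates

variable {d m k : ℕ} {ε a b z : ℝ} {N : E (d + 1) × ℝ → E (d + 1 + m)} {σ : E d → E (d + 1)}

/-- Differentiate `g = r² ĝ`: the derivative of `ĝ` contributes `ε r²`, and `2 r r' ĝ` contributes
at most `4 ε r²`, since `|r'| ≤ ε r` and `|ĝ_{ij}| ≤ 2`. -/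
lemma abs_pd_metric_le (hN : IsGeometricNeck ε k a b N) (hz : z ∈ Set.Icc a b)
    (hσ : IsNormalSphereChart σ) (hk : 1 ≤ k) (hε0 : 0 ≤ ε) (hε : ε < 1) (l i j : Fin (d + 1)) :
    |pd l (fun y => metric (patch N σ z) y i j) 0| ≤ 5 * ε * meanRadius N z ^ 2 := by
  have hr := meanRadius_pos hN hz hσ hε
  have hrad := hN.radius_smooth z hz
  have hF := contDiffAt_patch (m := m) hσ (hN.smooth (σ 0) z (norm_chart_zero hσ) hz)
  have hρ : DifferentiableAt ℝ (fun s => meanRadius N (z + s)) 0 := by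
    have h1 : DifferentiableAt ℝ (meanRadius N) (z + 0) := by
      rw [add_zero]; exact hrad.differentiableAt (by simp)
    exact DifferentiableAt.comp (0 : ℝ) (g := meanRadius N) (f := fun s => z + s) h1
      ((differentiableAt_const z).fun_add differentiableAt_id)
  have hproj : DifferentiableAt ℝ (fun x : E (d + 1) => x 0) 0 :=
    (EuclideanSpace.proj (𝕜 := ℝ) (0 : Fin (d + 1))).differentiableAt
  have hρx : DifferentiableAt ℝ (fun x : E (d + 1) => meanRadius N (z + x 0)) 0 :=
    DifferentiableAt.comp (0 : E (d + 1)) (g := fun s => meanRadius N (z + s))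
      (f := fun x : E (d + 1) => x 0) (by simpa using hρ) hproj
  have hne : ∀ᶠ x in 𝓝 (0 : E (d + 1)), meanRadius N (z + x 0) ≠ 0 :=
    hρx.continuousAt.eventually_ne (by simpa using hr.ne')
  have hconf : DifferentiableAt ℝ (fun y => confMetric N σ z y i j) 0 :=
    ((hρx.fun_pow 2).fun_inv (by simpa using hr.ne')).fun_mul
      (contDiffAt_metric hF (p := ∞) (by simp) i j).diff
  have h1 : pd l (fun y => metric (patch N σ z) y i j) 0
      = meanRadius N z ^ 2 * pd l (fun y => confMetric N σ z y i j) 0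
        + dz l * (2 * meanRadius N z * deriv (meanRadius N) z) * confMetric N σ z 0 i j := by
    rw [pd_congr (g := fun y => meanRadius N (z + y 0) ^ 2 * confMetric N σ z y i j),
      pd_mul (hρx.fun_pow 2) hconf,
      pd_comp_apply_zero (f := fun s => meanRadius N (z + s) ^ 2) (by simpa using hρ.fun_pow 2)]
    · have h2 : deriv (fun s => meanRadius N (z + s) ^ 2) 0
          = 2 * meanRadius N z * deriv (meanRadius N) z := by
        rw [deriv_fun_pow hρ, deriv_comp_const_add]
        simp
      simp [h2]
    · filter_upwards [hne] with y hy
      simp only [confMetric, Matrix.smul_apply, smul_eq_mul]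
      field_simp
  have h2 := abs_pd_confMetric_le hN hz hσ hk l i j
  have h3 := abs_deriv_meanRadius_le hN hz hr hk
  have h4 : |confMetric N σ z 0 i j| ≤ 2 := by
    have h5 := abs_confMetric_sub_le hN hz hσ i j
    have h6 : |(if i = j then 1 else 0 : ℝ)| ≤ 1 := by split_ifs <;> simp
    have h7 := abs_add_le (confMetric N σ z 0 i j - if i = j then 1 else 0)
      (if i = j then 1 else 0)
    rw [sub_add_cancel] at h7
    linarith
  have h5 : |dz l| ≤ 1 := by unfold dz; split_ifs <;> simp
  rw [h1]
  refine (abs_add_le _ _).trans ?_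
  have e1 : |meanRadius N z ^ 2 * pd l (fun y => confMetric N σ z y i j) 0|
      ≤ meanRadius N z ^ 2 * ε := by
    rw [abs_mul, abs_of_pos (by positivity)]
    gcongr
  have e2 : |dz l * (2 * meanRadius N z * deriv (meanRadius N) z) * confMetric N σ z 0 i j|
      ≤ 1 * (2 * meanRadius N z * (ε * meanRadius N z)) * 2 := by
    rw [abs_mul, abs_mul, abs_mul, abs_of_pos (show 0 < 2 * meanRadius N z by positivity)]
    gcongr
  nlinarith

lemma metric_patch_posDef (hN : IsGeometricNeck ε k a b N) (hz : z ∈ Set.Icc a b)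
    (hσ : IsNormalSphereChart σ) : (metric (patch N σ z) 0).PosDef :=
  Matrix.posDef_gram_of_linearIndependent (hN.immersion z hz σ hσ)

/-- Each index costs `√g_{ii}`, and `g_{ii} ≤ 2r² ≤ (2r)²` since `ε < 1`. -/
lemma norm_apply_le_mul_tensorNorm (hN : IsGeometricNeck ε k a b N) (hz : z ∈ Set.Icc a b)
    (hσ : IsNormalSphereChart σ) (hε : ε < 1) {l : ℕ} {V : Type} [NormedAddCommGroup V]
    [InnerProductSpace ℝ V] (T : (Fin l → Fin (d + 1)) → V) (I : Fin l → Fin (d + 1)) :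
    ‖T I‖ ≤ (2 * meanRadius N z) ^ l * tensorNorm (metricInv (patch N σ z) 0) T := by
  have hr := meanRadius_pos hN hz hσ hε
  have hpos := metric_patch_posDef hN hz hσ
  refine (norm_apply_le_tensorNorm hpos T I).trans
    (mul_le_mul_of_nonneg_right ?_ (Real.sqrt_nonneg _))
  rw [Real.sqrt_le_left (by positivity), ← pow_mul, mul_comm l 2, pow_mul]
  refine (Finset.prod_le_prod (fun a _ => hpos.diag_pos.le)
    (g := fun _ => (2 * meanRadius N z) ^ 2) fun a _ => ?_).trans_eq (by simp)
  rw [metric_patch_zero hr]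
  have h := abs_le.1 (abs_confMetric_sub_le hN hz hσ (I a) (I a))
  rw [if_pos rfl] at h
  nlinarith [h.2, pow_pos hr 2]

lemma abs_cylWeingarten_le (i j : Fin (d + 1)) : |(cylWeingarten i j : ℝ)| ≤ 1 := by
  by_cases hi : i = 0 <;> by_cases hj : j = 0 <;> by_cases hij : i = j <;>
    simp_all [cylWeingarten, dz]

/-- The constant is `4 + 4 + (d+1)`: two lower indices cost `(2r)²` in each of the bounds on `W_ν`
and `W_-`, and replacing `g` by `r²δ` inside `W̄` costs one `ε` for each of the `d+1` indices. -/
lemma exists_axis (hN : IsCylindricalNeck ε k a b N) (hz : z ∈ Set.Icc a b)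
    (hσ : IsNormalSphereChart σ) (hε : ε < 1) :
    ∃ ν : E (d + 1 + m), ‖ν‖ = 1 ∧ ∀ i j, ‖sff (patch N σ z) 0 i j
      - (meanRadius N z * cylWeingarten i j) • ν‖ ≤ ((d : ℝ) + 9) * ε * meanRadius N z := by
  have hG := hN.toIsGeometricNeck
  have hr := meanRadius_pos hG hz hσ hε
  obtain ⟨ν', hν'⟩ := hN.curvature_close
  obtain ⟨hν, -, h1, h2⟩ := hν' z hz σ hσ
  refine ⟨ν' (σ 0, z), hν, fun i j => ?_⟩
  set ν := ν' (σ 0, z)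
  set h : E (d + 1 + m) := sff (patch N σ z) 0 i j with hh
  set r := meanRadius N z with hrdef
  set S : ℝ := ∑ l, cylWeingarten i l * metric (patch N σ z) 0 l j with hS
  have e1 : |inner ℝ h ν - r⁻¹ * S| ≤ 4 * ε * r := by
    have h3 := (norm_apply_le_mul_tensorNorm hG hz hσ hε _ ![i, j]).trans
      (mul_le_mul_of_nonneg_left h1 (by positivity))
    refine (le_of_eq ?_).trans (h3.trans (le_of_eq ?_))
    · rfl
    · field_simp; ring
  have e2 : ‖h - (inner ℝ h ν : ℝ) • ν‖ ≤ 4 * ε * r := by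
    have h3 := (norm_apply_le_mul_tensorNorm hG hz hσ hε _ ![i, j]).trans
      (mul_le_mul_of_nonneg_left h2 (by positivity))
    refine (le_of_eq ?_).trans (h3.trans (le_of_eq ?_))
    · rfl
    · field_simp; ring
  have e3 : |r⁻¹ * S - r * cylWeingarten i j| ≤ ((d : ℝ) + 1) * ε * r := by
    have h3 : r⁻¹ * S - r * cylWeingarten i j
        = r * ∑ l, cylWeingarten i l * (confMetric N σ z 0 l j - if l = j then 1 else 0) := by
      simp only [hS, fun l => metric_patch_zero (σ := σ) hr l j, mul_sub, Finset.sum_sub_distrib,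
        mul_ite, mul_one, mul_zero, Finset.sum_ite_eq', Finset.mem_univ, if_true, Finset.mul_sum]
      congr 1
      refine Finset.sum_congr rfl fun l _ => ?_
      rw [← hrdef]
      field_simp
    rw [h3, abs_mul, abs_of_pos hr]
    have h4 : |∑ l, cylWeingarten i l * (confMetric N σ z 0 l j - if l = j then 1 else 0)|
        ≤ ∑ _l : Fin (d + 1), ε := by
      refine (Finset.abs_sum_le_sum_abs _ _).trans (Finset.sum_le_sum fun l _ => ?_)
      rw [abs_mul]
      calc _ ≤ 1 * ε := mul_le_mul (abs_cylWeingarten_le i l) (abs_confMetric_sub_le hG hz hσ l j)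
            (abs_nonneg _) zero_le_one
        _ = ε := one_mul ε
    rw [Finset.sum_const, Finset.card_univ, Fintype.card_fin, nsmul_eq_mul] at h4
    push_cast at h4
    nlinarith
  have e4 : h - (r * cylWeingarten i j) • ν = (h - (inner ℝ h ν : ℝ) • ν)
      + ((inner ℝ h ν - r⁻¹ * S) • ν + (r⁻¹ * S - r * cylWeingarten i j) • ν) := by module
  rw [e4]
  refine (norm_add_le _ _).trans ?_
  have e5 := norm_add_le ((inner ℝ h ν - r⁻¹ * S) • ν) ((r⁻¹ * S - r * cylWeingarten i j) • ν)
  rw [norm_smul, norm_smul, hν, mul_one, mul_one, Real.norm_eq_abs, Real.norm_eq_abs] at e5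
  linarith

lemma norm_nablaSff_le (hN : IsCylindricalNeck ε k a b N) (hz : z ∈ Set.Icc a b)
    (hσ : IsNormalSphereChart σ) (hε : ε < 1) {l : ℕ} (hl : 1 ≤ l) (hlk : l ≤ k)
    (I : Fin (2 + l) → Fin (d + 1)) :
    ‖nablaSff (patch N σ z) l 0 I‖ ≤ 2 ^ (2 + l) * ε * meanRadius N z := by
  have hG := hN.toIsGeometricNeck
  have hr := meanRadius_pos hG hz hσ hε
  refine ((norm_apply_le_mul_tensorNorm hG hz hσ hε _ I).trans
    (mul_le_mul_of_nonneg_left (hN.deriv_curvature z hz σ hσ l hl hlk)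
      (by positivity))).trans_eq ?_
  rw [mul_pow, show 2 + l = (l + 1) + 1 by ring, pow_succ (meanRadius N z)]
  field_simp

/-- The rescaled neck as normalized bending data. -/
lemma exists_bendData {θ τ : ℝ} {u : ℝ → ℝ} (hN : IsCylindricalNeck ε k a b N)
    (hz : z ∈ Set.Icc a b) (hσ : IsNormalSphereChart σ) (hε0 : 0 ≤ ε) (hε : ε < 1) (hk : 1 ≤ k)
    (hkm : 2 ≤ k ∨ m = 1) (hτ : 0 ≤ τ) (hu : ContDiffAt ℝ 2 u z)
    (hbound : τ * (|u z| + |deriv u z|) ≤ θ * meanRadius N z) :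
    ∃ D : BendData d m θ ((d : ℝ) + 25), D.ε = ε
      ∧ (D.F = fun y => (meanRadius N z)⁻¹ • patch N σ z y)
      ∧ D.v = fun s => (meanRadius N z)⁻¹ * τ * u (z + s) := by
  have hG := hN.toIsGeometricNeck
  have hr := meanRadius_pos hG hz hσ hε
  have hc : (meanRadius N z)⁻¹ ≠ 0 := (inv_pos.2 hr).ne'
  set r := meanRadius N z with hrdef
  have hd : (0 : ℝ) ≤ d := Nat.cast_nonneg d
  have hF := contDiffAt_patch (m := m) hσ (hN.smooth (σ 0) z (norm_chart_zero hσ) hz)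
  obtain ⟨ν, hν, hνh⟩ := exists_axis hN hz hσ hε
  have hu' : ContDiffAt ℝ 2 (fun s => u (z + s)) 0 :=
    ContDiffAt.comp (0 : ℝ) (g := u) (f := fun s => z + s) (by simpa using hu)
      (contDiffAt_const.add contDiffAt_id)
  -- The constants to be absorbed into `d + 25` are `d + 9` for `h`, `2³` for `∇h` and `2⁴` for
  -- `∇²h`; those for the metric, `1` and `5`, are treated directly.
  have key : ∀ {x K : ℝ}, x ≤ K * ε * r → K ≤ d + 25 → r⁻¹ * x ≤ (d + 25) * |ε| := by
    intro x K hx hK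
    rw [abs_of_nonneg hε0]
    calc r⁻¹ * x ≤ r⁻¹ * (K * ε * r) := by gcongr
      _ = K * ε := by field_simp
      _ ≤ (d + 25) * ε := by gcongr
  have hnorm : ∀ v : E (d + 1 + m), ‖r⁻¹ • v‖ = r⁻¹ * ‖v‖ := fun v => by
    rw [norm_smul, Real.norm_of_nonneg (inv_pos.2 hr).le]
  have hmet : ∀ x i j, metric (fun y => r⁻¹ • patch N σ z y) x i j
      = (r⁻¹) ^ 2 * metric (patch N σ z) x i j := fun x i j => by
    rw [metric_homothety]; rfl
  have hGs : ContDiffAt ℝ ∞ (fun y => r⁻¹ • patch N σ z y) 0 :=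
    (contDiffAt_const (c := r⁻¹)).smul hF
  refine ⟨⟨fun y => r⁻¹ • patch N σ z y, ε, fun s => r⁻¹ * τ * u (z + s), ν,
    hGs, ?_, ?_, ?_, hν, ?_, ?_, ?_, contDiffAt_const.mul hu', ?_⟩,
    rfl, rfl, rfl⟩
  · rw [metric_homothety, Matrix.det_smul]
    exact mul_ne_zero (pow_ne_zero _ (pow_ne_zero _ hc)) (metric_patch_posDef hG hz hσ).det_pos.ne'
  · intro i j
    rw [hmet, metric_patch_zero hr, ← hrdef, ← mul_assoc, ← mul_pow, inv_mul_cancel₀ hr.ne',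
      one_pow, one_mul, abs_of_nonneg hε0]
    exact (abs_confMetric_sub_le hG hz hσ i j).trans (by nlinarith)
  · intro l i j
    have h1 := abs_pd_metric_le hG hz hσ hk hε0 hε l i j
    simp only [hmet]
    rw [show (fun y => r⁻¹ ^ 2 * metric (patch N σ z) y i j)
      = fun y => r⁻¹ ^ 2 • metric (patch N σ z) y i j from rfl, pd_const_smul, smul_eq_mul,
      abs_mul, abs_of_pos (by positivity), abs_of_nonneg hε0]
    calc _ ≤ r⁻¹ ^ 2 * (5 * ε * r ^ 2) := by gcongr
      _ = 5 * ε := by field_simp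
      _ ≤ _ := by gcongr; linarith
  · intro i j
    have h1 : sff (fun y => r⁻¹ • patch N σ z y) 0 i j - cylWeingarten i j • ν
        = r⁻¹ • (sff (patch N σ z) 0 i j - (r * cylWeingarten i j) • ν) := by
      rw [sff_homothety hc, smul_sub, smul_smul, ← mul_assoc, inv_mul_cancel₀ hr.ne', one_mul]
    rw [h1, hnorm]
    exact key (hνh i j) (by linarith)
  · intro I
    rw [nablaSff_homothety hc, hnorm]
    exact key (norm_nablaSff_le hN hz hσ hε le_rfl hk I) (by norm_num; linarith)
  · refine hkm.symm.imp_right fun hk2 I => ?_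
    rw [nablaSff_homothety hc, hnorm]
    exact key (norm_nablaSff_le hN hz hσ hε (by norm_num) hk2 I) (by norm_num; linarith)
  · have h1 : deriv (fun s => r⁻¹ * τ * u (z + s)) 0 = r⁻¹ * τ * deriv u z := by
      rw [deriv_const_mul_field, deriv_comp_const_add, add_zero]
    rw [h1, add_zero, abs_mul, abs_mul _ (deriv u z), abs_of_nonneg (by positivity), ← mul_add,
      mul_assoc, inv_mul_le_iff₀ hr, mul_comm r]
    exact hbound

end NeckEstimates

/-! ### Uniform bounds -/

namespace BendData

variable {d m : ℕ} {θ K : ℝ}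

/-- Unfolds the `O` statements along `lim` into one threshold and one constant valid for all
normalized data. -/
lemma exists_uniform_bound (d m : ℕ) (θ K : ℝ) (hd : 1 ≤ d) (hθ : θ < 1) :
    ∃ δ : ℝ, 0 < δ ∧ ∃ C : ℝ, 0 < C ∧ ∀ D : BendData d m θ K, |D.ε| < δ →
      (metric D.bent 0).det ≠ 0 ∧
      (∀ i j, ‖sff D.bent 0 i j - sff D.F 0 i j - D.linSff i j‖ ≤ C * D.err) ∧
      (∀ i j, ‖weingarten D.bent 0 i j - weingarten D.F 0 i j - D.linWein i j‖ ≤ C * D.err) ∧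
      ‖meanCurv D.bent 0 - meanCurv D.F 0 - ∑ i, D.linWein i i‖ ≤ C * D.err ∧
      |normSqA D.bent 0 - (normSqA D.F 0 + 2 * D.v₂ * hPlusUp D.F 0 0 0
        + 2 * D.v₀ * ∑ i, ∑ j, ∑ k, hPlusMixed D.F 0 j k *
          (inner ℝ (sff D.F 0 i k) (sffUp D.F 0 i j) : ℝ))| ≤ C * D.err ∧
      |‖meanCurv D.bent 0‖ ^ 2 - (‖meanCurv D.F 0‖ ^ 2
        + 2 * D.v₂ * metricInv D.F 0 0 0 * ‖meanCurv D.F 0‖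
        + 2 * D.v₀ * (∑ i, ∑ j, ∑ k, hPlusMixed D.F 0 j k * hPlus D.F 0 i k
          * metricInv D.F 0 i j) * ‖meanCurv D.F 0‖)| ≤ C * D.err := by
  have h1 := isBigO_pi.2 fun i => isBigO_pi.2 fun j =>
    O_sff_bent_sub_lin (m := m) (K := K) hd hθ i j
  have h2 := isBigO_pi.2 fun i => isBigO_pi.2 fun j =>
    O_weingarten_bent_sub_lin (m := m) (K := K) hd hθ i j
  have h3 := O_meanCurv_bent_sub_lin (m := m) (K := K) hd hθ
  have h4 := O_normSqA_bent_sub (m := m) (K := K) hd hθ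
  have h5 := O_norm_meanCurv_bent_sub (m := m) (K := K) hd hθ
  -- Packing all remainders, with all their indices, into one product space yields a single
  -- constant.
  obtain ⟨C, hC, hb⟩ := ((((h1.prod_left h2).prod_left h3).prod_left h4).prod_left h5).exists_pos
  have hev := hb.bound.and (eventually_det_bent (m := m) (K := K) hd hθ)
  rw [lim, eventually_comap] at hev
  obtain ⟨δ, hδ, hball⟩ := Metric.eventually_nhds_iff.1 hev
  refine ⟨δ, hδ, C, hC, fun D hD => ?_⟩
  obtain ⟨hbD, hdet⟩ := hball (y := D.ε) (by simpa using hD) D rfl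
  have herr : ‖D.err‖ = D.err := Real.norm_of_nonneg
    (add_nonneg (mul_nonneg (abs_nonneg _) D.size₁_nonneg) (sq_nonneg _))
  rw [herr, Prod.norm_def, Prod.norm_def, Prod.norm_def, Prod.norm_def] at hbD
  simp only [max_le_iff] at hbD
  obtain ⟨⟨⟨⟨b1, b2⟩, b3⟩, b4⟩, b5⟩ := hbD
  exact ⟨hdet, fun i j => ((norm_le_pi_norm (fun j => sff D.bent 0 i j - sff D.F 0 i j
      - D.linSff i j) j).trans (norm_le_pi_norm (fun i j => sff D.bent 0 i j
      - sff D.F 0 i j - D.linSff i j) i)).trans b1,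
    fun i j => ((norm_le_pi_norm (fun j => weingarten D.bent 0 i j - weingarten D.F 0 i j
      - D.linWein i j) j).trans (norm_le_pi_norm (fun i j => weingarten D.bent 0 i j
      - weingarten D.F 0 i j - D.linWein i j) i)).trans b2, b3, b4, b5⟩

end BendData

end

end BendNeck

/-! ### The theorem: undoing the normalization -/

set_option maxHeartbeats 1600000 in
theorem mainTheorem8 (d m : ℕ) (hd : 1 ≤ d) (θ : ℝ) (hθ₀ : 0 < θ) (hθ₁ : θ < 1) :
    ∃ ε₀ : ℝ, 0 < ε₀ ∧ ∃ c : ℝ, 0 < c ∧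
      ∀ (k : ℕ), 1 ≤ k → (2 ≤ k ∨ m = 1) →
      ∀ (ε : ℝ), 0 < ε → ε < ε₀ →
      ∀ (a b : ℝ), a < b →
      ∀ (N : E (d + 1) × ℝ → E (d + 1 + m)), IsCylindricalNeck ε k a b N →
      ∀ (u : ℝ → ℝ) (τ : ℝ), 0 ≤ τ →
      (∀ z ∈ Set.Icc a b, ContDiffAt ℝ 2 u z) →
      (∀ z ∈ Set.Icc a b, τ * (|u z| + |deriv u z|) ≤ θ * meanRadius N z) →
      ∀ z ∈ Set.Icc a b, ∀ σ : E d → E (d + 1), IsNormalSphereChart σ →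
        let F : E (d + 1) → E (d + 1 + m) := patch N σ z
        let F' : E (d + 1) → E (d + 1 + m) := bentPatch N τ u σ z
        let r : ℝ := meanRadius N z
        let u₀ : ℝ := u z
        let u₁ : ℝ := deriv u z
        let u₂ : ℝ := deriv (deriv u) z
        let e₁ : ℝ := ε * τ * (|u₀| + |u₁|)
        let e₂ : ℝ := τ ^ 2 * (|u₀| ^ 2 + |u₁| ^ 2 + |u₂| ^ 2)
        -- the deformed neck is immersed
        LinearIndependent ℝ (fun i => pd i F' 0) ∧
        -- (i)
        (∀ i j : Fin (d + 1),
          ‖sff F' 0 i j -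
            (sff F 0 i j
              + (τ * dz i * dz j * u₂) • nuPlus F 0
              + (τ * u₀) • ∑ k, hPlusMixed F 0 j k • pd i (pd k F) 0
              + (τ * dz j * u₁) • pd i (nuPlus F) 0
              + (τ * dz i * u₁) • ∑ k, hPlusMixed F 0 j k • pd k F 0
              + (τ * u₀) • ∑ k, pd i (fun x => hPlusMixed F x j k) 0 • pd k F 0
              - (τ * u₁) • ∑ k, (dz i * hPlusMixed F 0 j k + dz j * hPlusMixed F 0 i k
                  - metricInv F 0 0 k * hPlus F 0 i j) • pd k F 0)‖
            ≤ c * (e₁ + e₂ / r)) ∧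
        -- (ii)
        (∀ i j : Fin (d + 1),
          ‖weingarten F' 0 i j -
            (weingarten F 0 i j
              + (τ * metricInv F 0 0 j * dz i * u₂) • nuPlus F 0
              - (τ * u₀) • ∑ k, hPlusUp F 0 j k • pd i (pd k F) 0
              + (τ * metricInv F 0 0 j * u₁) • pd i (nuPlus F) 0
              + (τ * dz i * u₁) • ∑ k, hPlusUp F 0 j k • pd k F 0
              + (τ * u₀) • ∑ k, pd i (fun x => hPlusUp F x j k) 0 • pd k F 0
              - (τ * u₁) • ∑ k, (dz i * hPlusUp F 0 j k
                  + metricInv F 0 0 j * hPlusMixed F 0 i k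
                  - metricInv F 0 0 k * hPlusMixed F 0 i j) • pd k F 0)‖
            ≤ c * (e₁ / r ^ 2 + e₂ / r ^ 3)) ∧
        -- (iii)
        ‖meanCurv F' 0 -
            (meanCurv F 0
              + (τ * metricInv F 0 0 0 * u₂) • nuPlus F 0
              - (τ * u₀) • ∑ i, ∑ k, hPlusUp F 0 i k • pd i (pd k F) 0
              + (τ * u₁) • ∑ i, metricInv F 0 0 i • pd i (nuPlus F) 0
              + (τ * u₁) • ∑ k, hPlusUp F 0 0 k • pd k F 0
              + (τ * u₀) • ∑ i, ∑ k, pd i (fun x => hPlusUp F x i k) 0 • pd k F 0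
              - (τ * u₁) • ∑ i, ∑ k, (dz i * hPlusUp F 0 i k
                  + metricInv F 0 0 i * hPlusMixed F 0 i k
                  - metricInv F 0 0 k * hPlusMixed F 0 i i) • pd k F 0)‖
            ≤ c * (e₁ / r ^ 2 + e₂ / r ^ 3) ∧
        -- (iv)
        |normSqA F' 0 -
            (normSqA F 0
              + 2 * τ * u₂ * hPlusUp F 0 0 0
              + 2 * τ * u₀ * ∑ i, ∑ j, ∑ k,
                  hPlusMixed F 0 j k * inner ℝ (sff F 0 i k) (sffUp F 0 i j))|
            ≤ c * (e₁ / r ^ 3 + e₂ / r ^ 4) ∧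
        -- (v)
        |‖meanCurv F' 0‖ ^ 2 -
            (‖meanCurv F 0‖ ^ 2
              + 2 * τ * u₂ * metricInv F 0 0 0 * ‖meanCurv F 0‖
              + 2 * τ * u₀ * (∑ i, ∑ j, ∑ k,
                  hPlusMixed F 0 j k * hPlus F 0 i k * metricInv F 0 i j) * ‖meanCurv F 0‖)|
            ≤ c * (e₁ / r ^ 3 + e₂ / r ^ 4) := by
  obtain ⟨δ, hδ, C, hC, hmain⟩ := BendData.exists_uniform_bound d m θ ((d : ℝ) + 25) hd hθ₁
  -- The bound `ε < 1` makes `r` positive; the factor `3` comes from `(a+b+c)² ≤ 3(a²+b²+c²)` in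
  -- `herr`.
  refine ⟨min δ 1, lt_min hδ one_pos, 3 * C, by positivity, ?_⟩
  intro k hk hkm ε hε0 hε a b _ N hN u τ hτ hu hbound z hz σ hσ F F' r u₀ u₁ u₂ e₁ e₂
  have hε1 : ε < 1 := hε.trans_le (min_le_right _ _)
  have hr : 0 < r := meanRadius_pos hN.toIsGeometricNeck hz hσ hε1
  have hc : 0 < r⁻¹ := inv_pos.2 hr
  obtain ⟨D, hDε, hDF, hDv⟩ := exists_bendData hN hz hσ hε0.le hε1 hk hkm hτ (hu z hz)
    (hbound z hz)
  have hDF' : D.F = fun y => r⁻¹ • F y := hDF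
  -- Bending commutes with the homothety because `ν⁺` is scale invariant and `v` carries the factor
  -- `r⁻¹`.
  have hbent : D.bent = fun y => r⁻¹ • F' y := by
    funext y
    change D.F y - D.v (y 0) • BendNeck.nuPlus D.F y
      = r⁻¹ • (F y - (τ * u (z + y 0)) • BendNeck.nuPlus F y)
    rw [hDF', hDv, nuPlus_homothety hc, smul_sub, smul_smul, ← mul_assoc]
  have hv0 : D.v₀ = r⁻¹ * τ * u₀ := by
    rw [BendData.v₀, hDv]; simp [r, u₀]
  have hv1 : D.v₁ = r⁻¹ * τ * u₁ := by
    rw [BendData.v₁, hDv, deriv_const_mul_field, deriv_comp_const_add, add_zero]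
  have hv2 : D.v₂ = r⁻¹ * τ * u₂ := by
    rw [BendData.v₂, hDv]
    have h1 : (deriv fun s => r⁻¹ * τ * u (z + s)) = fun s => r⁻¹ * τ * deriv u (z + s) := by
      funext s
      rw [deriv_const_mul_field, deriv_comp_const_add]
    change deriv (deriv fun s => r⁻¹ * τ * u (z + s)) 0 = _
    rw [h1, deriv_const_mul_field, deriv_comp_const_add, add_zero]
  obtain ⟨hdet, m1, m2, m3, m4, m5⟩ := hmain D (by
    rw [hDε, abs_of_pos hε0]; exact hε.trans_le (min_le_left _ _))
  have herr : C * D.err ≤ 3 * C * (e₁ / r + e₂ / r ^ 2) := by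
    have h1 : ε * D.size₁ = e₁ / r := by
      simp only [BendData.size₁, hv0, hv1, abs_mul, abs_of_pos hc, abs_of_nonneg hτ, e₁]
      field_simp
    have h2 : D.size₂ ^ 2 ≤ 3 * (e₂ / r ^ 2) := by
      have h3 : D.size₂ = r⁻¹ * τ * (|u₀| + |u₁| + |u₂|) := by
        simp only [BendData.size₂, hv0, hv1, hv2, abs_mul, abs_of_pos hc, abs_of_nonneg hτ]
        ring
      have h4 : 3 * (e₂ / r ^ 2) = (r⁻¹ * τ) ^ 2 * (3 * (|u₀| ^ 2 + |u₁| ^ 2 + |u₂| ^ 2)) := by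
        simp only [e₂]; field_simp
      rw [h3, h4, mul_pow]
      refine mul_le_mul_of_nonneg_left ?_ (sq_nonneg _)
      nlinarith [sq_nonneg (|u₀| - |u₁|), sq_nonneg (|u₀| - |u₂|), sq_nonneg (|u₁| - |u₂|)]
    have h5 : 0 ≤ e₁ / r := by
      simp only [e₁]; positivity
    rw [BendData.err, hDε, abs_of_pos hε0, h1]
    nlinarith
  have hnorm : ∀ v : E (d + 1 + m), ‖r⁻¹ • v‖ = r⁻¹ * ‖v‖ := fun v => by
    rw [norm_smul, Real.norm_of_nonneg hc.le]
  have hnorm' : ∀ v : E (d + 1 + m), ‖r • v‖ = r * ‖v‖ := fun v => by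
    rw [norm_smul, Real.norm_of_nonneg hr.le]
  have hpd : ∀ (i : Fin (d + 1)) (f : E (d + 1) → ℝ) (q : ℝ),
      pd i (fun x => q * f x) 0 = q * pd i f 0 := fun i f q => pd_const_smul q f
  -- The first variation of `h_{ij}` scales like a length; that of `h_i^j` below scales like an
  -- inverse length. This accounts for the different powers of `r` in the error terms.
  have hlinS : ∀ i j, D.linSff i j = r⁻¹ • (
      (τ * dz i * dz j * u₂) • nuPlus F 0
      + (τ * u₀) • ∑ k, hPlusMixed F 0 j k • pd i (pd k F) 0
      + (τ * dz j * u₁) • pd i (nuPlus F) 0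
      + (τ * dz i * u₁) • ∑ k, hPlusMixed F 0 j k • pd k F 0
      + (τ * u₀) • ∑ k, pd i (fun x => hPlusMixed F x j k) 0 • pd k F 0
      - (τ * u₁) • ∑ k, (dz i * hPlusMixed F 0 j k + dz j * hPlusMixed F 0 i k
          - metricInv F 0 0 k * hPlus F 0 i j) • pd k F 0) := by
    intro i j
    have hν : nuPlus (fun y => r⁻¹ • F y) = nuPlus F := funext fun x => nuPlus_homothety hc x
    have e1 : ∀ p : ℝ, r⁻¹⁻¹ * p * r⁻¹ = p := fun p => by field_simp
    have e2 : ∀ k, (dz i * (r⁻¹⁻¹ * hPlusMixed F 0 j k) + dz j * (r⁻¹⁻¹ * hPlusMixed F 0 i k)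
          - (r⁻¹ ^ 2)⁻¹ * metricInv F 0 0 k * (r⁻¹ * hPlus F 0 i j)) * r⁻¹
        = dz i * hPlusMixed F 0 j k + dz j * hPlusMixed F 0 i k
          - metricInv F 0 0 k * hPlus F 0 i j := fun k => by field_simp
    rw [BendData.linSff, hDF']
    simp only [hν, hPlusMixed_homothety hc, metricInv_homothety_apply hc.ne', hPlus_homothety hc,
      pd_homothety, pd_const_smul, hpd, hv0, hv1, hv2, smul_smul, e1, e2]
    module
  have hlinW : ∀ i j, D.linWein i j = r • (
      (τ * metricInv F 0 0 j * dz i * u₂) • nuPlus F 0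
      - (τ * u₀) • ∑ k, hPlusUp F 0 j k • pd i (pd k F) 0
      + (τ * metricInv F 0 0 j * u₁) • pd i (nuPlus F) 0
      + (τ * dz i * u₁) • ∑ k, hPlusUp F 0 j k • pd k F 0
      + (τ * u₀) • ∑ k, pd i (fun x => hPlusUp F x j k) 0 • pd k F 0
      - (τ * u₁) • ∑ k, (dz i * hPlusUp F 0 j k + metricInv F 0 0 j * hPlusMixed F 0 i k
          - metricInv F 0 0 k * hPlusMixed F 0 i j) • pd k F 0) := by
    intro i j
    have hν : nuPlus (fun y => r⁻¹ • F y) = nuPlus F := funext fun x => nuPlus_homothety hc x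
    have e1 : ∀ p : ℝ, (r⁻¹ ^ 3)⁻¹ * p * r⁻¹ = r ^ 2 * p := fun p => by field_simp
    have e2 : ∀ k, (dz i * ((r⁻¹ ^ 3)⁻¹ * hPlusUp F 0 j k)
          + (r⁻¹ ^ 2)⁻¹ * metricInv F 0 0 j * (r⁻¹⁻¹ * hPlusMixed F 0 i k)
          - (r⁻¹ ^ 2)⁻¹ * metricInv F 0 0 k * (r⁻¹⁻¹ * hPlusMixed F 0 i j)) * r⁻¹
        = r ^ 2 * (dz i * hPlusUp F 0 j k + metricInv F 0 0 j * hPlusMixed F 0 i k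
          - metricInv F 0 0 k * hPlusMixed F 0 i j) := fun k => by field_simp
    have e3 : ∀ p : ℝ, r⁻¹ * τ * p = (r ^ 2)⁻¹ * (r * (τ * p)) := fun p => by field_simp
    have hr2 : r ^ 2 ≠ 0 := pow_ne_zero 2 hr.ne'
    rw [BendData.linWein, hDF']
    simp only [hν, hPlusMixed_homothety hc, metricInv_homothety_apply hc.ne', hPlusUp_homothety hc,
      pd_homothety, pd_const_smul, hpd, hv0, hv1, hv2, smul_smul, e1, e2]
    simp only [mul_smul (r ^ 2), ← Finset.smul_sum]
    match_scalars <;> field_simp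
  refine ⟨?_, fun i j => ?_, fun i j => ?_, ?_, ?_, ?_⟩
  · rw [hbent, metric_homothety, Matrix.det_smul] at hdet
    exact det_metric_ne_zero_iff.1 (right_ne_zero_of_mul hdet)
  · have h := (m1 i j).trans herr
    rw [hlinS, hDF', hbent, sff_homothety hc.ne', sff_homothety hc.ne', ← smul_sub, ← smul_sub,
      hnorm, inv_mul_le_iff₀ hr] at h
    refine (le_of_eq ?_).trans (h.trans (le_of_eq ?_))
    · congr 1; abel
    · field_simp
  · have h := (m2 i j).trans herr
    rw [hlinW, hDF', hbent, weingarten_homothety hc.ne', weingarten_homothety hc.ne', inv_inv,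
      ← smul_sub, ← smul_sub, hnorm', ← le_div_iff₀' hr] at h
    refine (le_of_eq ?_).trans (h.trans (le_of_eq ?_))
    · congr 1; abel
    · field_simp
  · have hlinH : ∑ i, D.linWein i i = r • (
        (τ * metricInv F 0 0 0 * u₂) • nuPlus F 0
        - (τ * u₀) • ∑ i, ∑ k, hPlusUp F 0 i k • pd i (pd k F) 0
        + (τ * u₁) • ∑ i, metricInv F 0 0 i • pd i (nuPlus F) 0
        + (τ * u₁) • ∑ k, hPlusUp F 0 0 k • pd k F 0
        + (τ * u₀) • ∑ i, ∑ k, pd i (fun x => hPlusUp F x i k) 0 • pd k F 0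
        - (τ * u₁) • ∑ i, ∑ k, (dz i * hPlusUp F 0 i k
            + metricInv F 0 0 i * hPlusMixed F 0 i k
            - metricInv F 0 0 k * hPlusMixed F 0 i i) • pd k F 0) := by
      have e1 : ∑ i, (τ * metricInv F 0 0 i * dz i * u₂) • nuPlus F 0
          = (τ * metricInv F 0 0 0 * u₂) • nuPlus F 0 := by
        simp [dz]
      have e2 : ∑ i, (τ * metricInv F 0 0 i * u₁) • pd i (nuPlus F) 0
          = (τ * u₁) • ∑ i, metricInv F 0 0 i • pd i (nuPlus F) 0 := by
        rw [Finset.smul_sum]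
        exact Finset.sum_congr rfl fun i _ => by rw [smul_smul, mul_right_comm]
      have e3 : ∑ i, (τ * dz i * u₁) • ∑ k, hPlusUp F 0 i k • pd k F 0
          = (τ * u₁) • ∑ k, hPlusUp F 0 0 k • pd k F 0 := by
        simp [dz]
      simp only [hlinW, Finset.sum_add_distrib, Finset.sum_sub_distrib, e1, e2, e3,
        ← Finset.smul_sum]
    have h := m3.trans herr
    rw [hlinH, hDF', hbent, meanCurv_homothety hc.ne', meanCurv_homothety hc.ne', inv_inv,
      ← smul_sub, ← smul_sub, hnorm', ← le_div_iff₀' hr] at h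
    refine (le_of_eq ?_).trans (h.trans (le_of_eq ?_))
    · congr 1; abel
    · field_simp
  · have h := m4.trans herr
    have hsum : ∀ i j k, r⁻¹⁻¹ * hPlusMixed F 0 j k *
        inner ℝ (r⁻¹ • sff F 0 i k) ((r⁻¹ ^ 3)⁻¹ • sffUp F 0 i j)
        = r ^ 3 * (hPlusMixed F 0 j k * inner ℝ (sff F 0 i k) (sffUp F 0 i j)) :=
      fun i j k => by
        rw [real_inner_smul_left, real_inner_smul_right]; field_simp
    -- Every term of the expansion of `|A|²` scales by `r²`, so one division converts the normalized
    -- error into the asserted one.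
    have hfac : ∀ A B S T : ℝ, (r⁻¹ ^ 2)⁻¹ * A - ((r⁻¹ ^ 2)⁻¹ * B
        + 2 * (r⁻¹ * τ * u₂) * ((r⁻¹ ^ 3)⁻¹ * S) + 2 * (r⁻¹ * τ * u₀) * (r ^ 3 * T))
        = r ^ 2 * (A - (B + 2 * τ * u₂ * S + 2 * τ * u₀ * T)) := fun A B S T => by
      field_simp
    rw [hDF', hbent, normSqA_homothety hc.ne', normSqA_homothety hc.ne', hv0, hv2,
      hPlusUp_homothety hc] at h
    simp only [hPlusMixed_homothety hc, sff_homothety hc.ne', sffUp_homothety hc.ne', hsum,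
      ← Finset.mul_sum] at h
    rw [hfac, abs_mul, abs_of_pos (pow_pos hr 2), ← le_div_iff₀' (pow_pos hr 2)] at h
    refine h.trans (le_of_eq ?_)
    field_simp
  · have h := m5.trans herr
    have hsum : ∀ i j k, r⁻¹⁻¹ * hPlusMixed F 0 j k * (r⁻¹ * hPlus F 0 i k)
        * ((r⁻¹ ^ 2)⁻¹ * metricInv F 0 i j)
        = r ^ 2 * (hPlusMixed F 0 j k * hPlus F 0 i k * metricInv F 0 i j) :=
      fun i j k => by field_simp
    have hfac : ∀ A B S T : ℝ, (r * A) ^ 2 - ((r * B) ^ 2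
        + 2 * (r⁻¹ * τ * u₂) * ((r⁻¹ ^ 2)⁻¹ * S) * (r * B)
        + 2 * (r⁻¹ * τ * u₀) * (r ^ 2 * T) * (r * B))
        = r ^ 2 * (A ^ 2 - (B ^ 2 + 2 * τ * u₂ * S * B + 2 * τ * u₀ * T * B)) :=
      fun A B S T => by field_simp
    rw [hDF', hbent, meanCurv_homothety hc.ne', meanCurv_homothety hc.ne', hv0, hv2, inv_inv,
      hnorm', hnorm', metricInv_homothety_apply hc.ne'] at h
    simp only [hPlusMixed_homothety hc, hPlus_homothety hc, metricInv_homothety_apply hc.ne', hsum,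
      ← Finset.mul_sum] at h
    rw [hfac, abs_mul, abs_of_pos (pow_pos hr 2), ← le_div_iff₀' (pow_pos hr 2)] at h
    refine h.trans (le_of_eq ?_)
    field_simp
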